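/- **Setting.** Let $\mathbb K$ be a field of characteristic $0$, $n\in\mathbb Z$, $k\ge 0$. A $(k+1)$-oriented graph has $v\ge1$ numbered vertices, $e$ numbered edges, no tadpoles, an intrinsic orientation of each edge, and $k+1$ further orientations (colours) of each edge such that there is no oriented cycle in any colour. A 2-valent vertex *passes* in a colour if in that colour it is the head of one of its edges and the tail of the other; it is *passing* if it passes in all colours, and *weakly passing* if it passes in the colours $1,\dots,k$ but not in the colour $k+1$. Let $\mathrm O_{k+1}\mathrm{GC}_n$ be spanned by the connected $(k+1)$-oriented graphs with all vertices at least 2-valent, no passing vertex, and at least one at least 3-valent vertex, modulo the actions of $S_v$, $S_e$ and the reversals of intrinsic orientations: for $n$ even, edges are odd, vertices and intrinsic orientations are even; for $n$ odd, vertices and intrinsic orientations are odd, edges are even. Its degree is $(v-1)n+(1-n)e$, and the differential $\delta$, of degree $-1$, is the signed sum of the contractions of edges, where contractions having a coloured cycle or a passing vertex are put to $0$. Let $\mathrm O_{k+1}\mathrm{fGCc}_n^{\circ\nrightarrow}$ be the same with all vertices exactly 2-valent. The vertices that are not weakly passing are the *skeleton vertices*; the strings of edges and weakly passing vertices between them are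 the *skeleton edges*. A skeleton edge of length 2 with middle vertex $z$ has one of the two forms $\to z\leftarrow$ and $\leftarrow z\to$ in the colour $k+1$. The *dotted edge* is half the difference, and the *crossed edge* half the sum, of these two forms (with the same numbering of vertices and edges, and intrinsic orientations equal to the colour $k+1$). Let $\mathrm O_{k+1}\mathrm{sGC}'_n\subset \mathrm O_{k+1}\mathrm{GC}_n$ and $\mathrm O_{k+1}\mathrm{sGC}^\circ_n\subset\mathrm O_{k+1}\mathrm{fGCc}_n^{\circ\nrightarrow}$ be the subspaces spanned by the graphs all of whose skeleton edges are single edges or dotted edges, and let $\mathrm O_{k+1}\mathrm{fGCc}_n^{\dagger}$ and $\mathrm O_{k+1}\mathrm{fGCc}_n^{\circ\dagger}$ be the subspaces spanned by the graphs with at least one skeleton edge of another kind (crossed, or of length at least 3). **Proposition.** Let $(C,S,D)$ be $(\mathrm O_{k+1}\mathrm{GC}_n,\ \mathrm O_{k+1}\mathrm{sGC}'_n,\ \mathrm O_{k+1}\mathrm{fGCc}_n^\dagger)$ with $k\ge0$, or $(\mathrm O_{k+1}\mathrm{fGCc}_n^{\circ\nrightarrow},\ \mathrm O_{k+1}\mathrm{sGC}_n^\circ,\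 \mathrm O_{k+1}\mathrm{fGCc}_n^{\circ\dagger})$ with $k\ge1$. Then 1. $\delta^2=0$ on $C$, $C=S\oplus D$ as vector spaces, and $D$ is an acyclic subcomplex of $C$. 2. Let $S$ carry the differential $\pi\circ\delta|_S$, where $\pi:C\to S$ is the projection along $D$ (that is, $S$ is identified with the quotient complex $C/D$). This is a complex, and $\pi$ is a map of complexes that induces an isomorphism $H(C)\cong H(S)$ in every degree. 3. For $k=0$, $S$ is a subcomplex of $C$. Whenever $S$ is a subcomplex of $C$, the inclusion $S\hookrightarrow C$ induces an isomorphism on homology in every degree. -/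

import Mathlib

open scoped Classical

noncomputable section

namespace OGC

/-! ### Coloured graphs -/

/-- A graph with vertex set `Fin v`, edge set `Fin e` and `K` colours. The edge `a` has the
intrinsic orientation from `src a` to `tgt a`, and `ori c a` is the sign `o_c(a)` (`true` is `+`).
The conditions (no tadpoles, no coloured cycles, ...) are imposed in `IsOriented` below. -/
@[ext]
structure Graph (K v e : ℕ) where
  src : Fin e → Fin v
  tgt : Fin e → Fin v
  ori : Fin K → Fin e → Bool

namespace Graph

variable {K v e : ℕ}

/-- The vertex at which the edge `a` ends with respect to the orientation of the colour `c`. -/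
def head (Γ : Graph K v e) (c : Fin K) (a : Fin e) : Fin v :=
  if Γ.ori c a then Γ.tgt a else Γ.src a

/-- The vertex at which the edge `a` starts with respect to the orientation of the colour `c`. -/
def tail (Γ : Graph K v e) (c : Fin K) (a : Fin e) : Fin v :=
  if Γ.ori c a then Γ.src a else Γ.tgt a

/-- The vertex `x` is an end of the edge `a`. -/
def Inc (Γ : Graph K v e) (x : Fin v) (a : Fin e) : Prop := Γ.src a = x ∨ Γ.tgt a = x

/-- The valence of a vertex (the graphs that occur have no tadpoles). -/
def valence (Γ : Graph K v e) (x : Fin v) : ℕ := (Finset.univ.filter fun a => Γ.Inc x a).card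

/-- Connected `K`-oriented graphs: at least one vertex, no tadpoles, no oriented cycle in any
colour, and any two vertices are joined by a string of edges. -/
structure IsOriented (Γ : Graph K v e) : Prop where
  pos : 0 < v
  no_tadpole : ∀ a, Γ.src a ≠ Γ.tgt a
  no_cycle : ∀ c a, ¬ Relation.TransGen (fun a b => Γ.head c a = Γ.tail c b) a a
  connected : ∀ x y, Relation.EqvGen (fun x y => ∃ a, Γ.src a = x ∧ Γ.tgt a = y) x y

/-- `x` is 2-valent, and in the colour `c` it is the head of one edge and the tail of the other. -/
def PassesIn (Γ : Graph K v e) (c : Fin K) (x : Fin v) : Prop :=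
  Γ.valence x = 2 ∧ (∃ a, Γ.head c a = x) ∧ ∃ a, Γ.tail c a = x

/-- Passing vertices: 2-valent and passing in every colour. -/
def Passing (Γ : Graph K v e) (x : Fin v) : Prop := Γ.valence x = 2 ∧ ∀ c, Γ.PassesIn c x

end Graph

/-- The two complexes under consideration: `gc` is the part spanned by graphs that have an
at least 3-valent vertex, `circ` the part spanned by graphs with all vertices 2-valent. -/
inductive Part
  | gc
  | circ

/-- The graphs that span the two complexes: connected `K`-oriented graphs with all vertices at least
2-valent, without passing vertices, and with some at least 3-valent vertex (for `gc`), respectively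
with all vertices 2-valent (for `circ`). -/
structure Admissible (s : Part) {K v e : ℕ} (Γ : Graph K v e) : Prop where
  oriented : Γ.IsOriented
  two_le : ∀ x, 2 ≤ Γ.valence x
  not_passing : ∀ x, ¬ Γ.Passing x
  gc_or_circ : match s with
    | .gc => ∃ x, 3 ≤ Γ.valence x
    | .circ => ∀ x, Γ.valence x = 2

namespace Graph

variable {K v e w : ℕ}

/-! ### The group actions -/

/-- The action of a permutation of the vertices. -/
def permV (σ : Equiv.Perm (Fin v)) (Γ : Graph K v e) : Graph K v e where
  src a := σ (Γ.src a)
  tgt a := σ (Γ.tgt a)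
  ori := Γ.ori

/-- The action of a permutation of the edges. -/
def permE (τ : Equiv.Perm (Fin e)) (Γ : Graph K v e) : Graph K v e where
  src a := Γ.src (τ.symm a)
  tgt a := Γ.tgt (τ.symm a)
  ori c a := Γ.ori c (τ.symm a)

/-- Reversing the intrinsic orientation of the edge `b`; the coloured orientations relative to the
actual vertices do not change. -/
def flip (b : Fin e) (Γ : Graph K v e) : Graph K v e where
  src a := if a = b then Γ.tgt a else Γ.src a
  tgt a := if a = b then Γ.src a else Γ.tgt a
  ori c a := if a = b then !Γ.ori c a else Γ.ori c a

/-! ### Contraction of an edge -/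

/-- The order preserving renumbering of the vertices different from `p` (it is never applied to `p`
itself when the contracted edge is not a tadpole). -/
def renumber (p x : Fin (w + 2)) : Fin (w + 1) := (finSuccEquiv' p x).getD 0

/-- Identify the vertex `p` with the vertex `q`, and renumber. -/
def merge (p q x : Fin (w + 2)) : Fin (w + 1) := renumber p (if x = p then q else x)

/-- Contraction of the edge `t`: its head `tgt t` is removed and everything that was attached to it
is attached to `src t`; the remaining vertices and edges keep their order. -/
def contract (Γ : Graph K (w + 2) (e + 1)) (t : Fin (e + 1)) : Graph K (w + 1) e where
  src a := merge (Γ.tgt t) (Γ.src t) (Γ.src (t.succAbove a))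
  tgt a := merge (Γ.tgt t) (Γ.src t) (Γ.tgt (t.succAbove a))
  ori c a := Γ.ori c (t.succAbove a)

/-- The sign of making the edge `t` the last edge (for `n` even, where edges are odd), respectively
of making its head the last vertex (for `n` odd, where vertices are odd). -/
def contractSign (n : ℤ) (Γ : Graph K (w + 2) (e + 1)) (t : Fin (e + 1)) : ℤˣ :=
  if Even n then (-1) ^ (e - (t : ℕ)) else (-1) ^ (w + 1 - (Γ.tgt t : ℕ))

end Graph

/-! ### Chains and coinvariants -/

section Chains

variable (𝕂 : Type*) [Field 𝕂] (n : ℤ) (s : Part) (K : ℕ)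

/-- Labelled admissible graphs with `v` vertices and `e` edges, for all `v` and `e`. -/
abbrev Gen : Type := Σ p : ℕ × ℕ, {Γ : Graph K p.1 p.2 // Admissible s Γ}

/-- Formal linear combinations of labelled graphs. -/
abbrev Labelled : Type _ := Gen s K →₀ 𝕂

/-- The degree `(v - 1) n + (1 - n) e`. -/
def degree {s : Part} {K : ℕ} (g : Gen s K) : ℤ := (g.1.1 - 1) * n + (1 - n) * g.1.2

variable {K} in
/-- The basis vector of a graph, where the graphs that are not admissible are put to zero. -/
def toChain {v e : ℕ} (Γ : Graph K v e) : Labelled 𝕂 s K :=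
  if h : Admissible s Γ then Finsupp.single ⟨(v, e), ⟨Γ, h⟩⟩ 1 else 0

/-- The parity of a permutation of vertices: vertices are odd for `n` odd. -/
def signV {v : ℕ} (σ : Equiv.Perm (Fin v)) : ℤˣ := if Even n then 1 else Equiv.Perm.sign σ

/-- The parity of a permutation of edges: edges are odd for `n` even. -/
def signE {e : ℕ} (τ : Equiv.Perm (Fin e)) : ℤˣ := if Even n then Equiv.Perm.sign τ else 1

/-- The parity of an intrinsic orientation: it is odd for `n` odd. -/
def signFlip : ℤˣ := if Even n then 1 else -1

/-- The relations `g · Γ = sign(g) Γ`, for `g` in `S_v`, in `S_e`, and in one of the `e` copies of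
`S_2`. As these groups generate `S_v × (S_e ⋉ S_2^e)`, the quotient is the space of coinvariants. -/
def relations : Submodule 𝕂 (Labelled 𝕂 s K) :=
  Submodule.span 𝕂
    ({x | ∃ (v e : ℕ) (Γ : Graph K v e) (σ : Equiv.Perm (Fin v)),
        x = toChain 𝕂 s (Γ.permV σ) - signV n σ • toChain 𝕂 s Γ} ∪
     {x | ∃ (v e : ℕ) (Γ : Graph K v e) (τ : Equiv.Perm (Fin e)),
        x = toChain 𝕂 s (Γ.permE τ) - signE n τ • toChain 𝕂 s Γ} ∪
     {x | ∃ (v e : ℕ) (Γ : Graph K v e) (a : Fin e),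
        x = toChain 𝕂 s (Γ.flip a) - signFlip n • toChain 𝕂 s Γ})

/-- The sum of all contractions of edges of a labelled graph, with signs. Contractions with a
coloured cycle (in particular with a tadpole) are zero, and so are those with a passing vertex.
All vertices being at least 2-valent, there are no 1-valent vertices to delete, and a graph with
at most one vertex has no edge. -/
def boundaryGen : Gen s K → Labelled 𝕂 s K
  | ⟨(_ + 2, _ + 1), Γ⟩ => ∑ t, Γ.1.contractSign n t • toChain 𝕂 s (Γ.1.contract t)
  | _ => 0

/-- The differential on linear combinations of labelled graphs. -/
def boundary : Labelled 𝕂 s K →ₗ[𝕂] Labelled 𝕂 s K :=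
  Finsupp.lift (Labelled 𝕂 s K) 𝕂 (Gen s K) (boundaryGen 𝕂 n s K)

end Chains


/-! ### The differential is well defined on coinvariants -/

section WellDefined

namespace Graph

variable {K v e w : ℕ}

/-- `Γ'` is obtained from `Γ` by renaming the vertices by `σ`, the edges by `τ`, and reversing some
intrinsic orientations. -/
structure Renames (σ : Equiv.Perm (Fin v)) (τ : Equiv.Perm (Fin e)) (Γ Γ' : Graph K v e) :
    Prop where
  ends : ∀ a, (Γ'.src (τ a) = σ (Γ.src a) ∧ Γ'.tgt (τ a) = σ (Γ.tgt a)) ∨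
    (Γ'.src (τ a) = σ (Γ.tgt a) ∧ Γ'.tgt (τ a) = σ (Γ.src a))
  head : ∀ c a, Γ'.head c (τ a) = σ (Γ.head c a)
  tail : ∀ c a, Γ'.tail c (τ a) = σ (Γ.tail c a)

variable {σ : Equiv.Perm (Fin v)} {τ : Equiv.Perm (Fin e)} {Γ Γ' : Graph K v e}

theorem Renames.symm (h : Renames σ τ Γ Γ') : Renames σ.symm τ.symm Γ' Γ where
  ends a := by
    rcases h.ends (τ.symm a) with h1 | h1 <;> simp at h1 <;> simp [h1]
  head c a := by have := h.head c (τ.symm a); simp at this; simp [this]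
  tail c a := by have := h.tail c (τ.symm a); simp at this; simp [this]

theorem Renames.inc (h : Renames σ τ Γ Γ') (x a) : Γ'.Inc (σ x) (τ a) ↔ Γ.Inc x a := by
  rcases h.ends a with h1 | h1 <;> simp [Inc, h1, or_comm]

theorem Renames.valence (h : Renames σ τ Γ Γ') (x) : Γ'.valence (σ x) = Γ.valence x := by
  symm
  refine Finset.card_equiv τ fun a => ?_
  simp [h.inc]

theorem Renames.passing (h : Renames σ τ Γ Γ') {x} (hx : Γ.Passing x) : Γ'.Passing (σ x) := by
  refine ⟨by rw [h.valence]; exact hx.1, fun c => ⟨by rw [h.valence]; exact hx.1, ?_, ?_⟩⟩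
  · obtain ⟨a, ha⟩ := (hx.2 c).2.1
    exact ⟨τ a, by rw [h.head, ha]⟩
  · obtain ⟨a, ha⟩ := (hx.2 c).2.2
    exact ⟨τ a, by rw [h.tail, ha]⟩

theorem Renames.oriented (h : Renames σ τ Γ Γ') (hΓ : Γ.IsOriented) : Γ'.IsOriented where
  pos := hΓ.pos
  no_tadpole a := by
    have := hΓ.no_tadpole (τ.symm a)
    rcases h.ends (τ.symm a) with h1 | h1 <;> simp at h1 <;> simp [h1, this, Ne.symm this]
  no_cycle c a ha := by
    refine hΓ.no_cycle c (τ.symm a) ?_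
    have key : ∀ b, Relation.TransGen (fun a b => Γ'.head c a = Γ'.tail c b) a b →
        Relation.TransGen (fun a b => Γ.head c a = Γ.tail c b) (τ.symm a) (τ.symm b) := by
      intro b hb
      induction hb with
      | single hab => exact .single (by rw [h.symm.head, h.symm.tail, hab])
      | tail _ hbc ih => exact .tail ih (by rw [h.symm.head, h.symm.tail, hbc])
    exact key a ha
  connected x y := by
    have key : ∀ x y, Relation.EqvGen (fun x y => ∃ a, Γ.src a = x ∧ Γ.tgt a = y) x y →
        Relation.EqvGen (fun x y => ∃ a, Γ'.src a = x ∧ Γ'.tgt a = y) (σ x) (σ y) := by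
      intro x y hxy
      induction hxy with
      | rel x y hxy =>
        obtain ⟨a, rfl, rfl⟩ := hxy
        rcases h.ends a with h1 | h1
        · exact .rel _ _ ⟨τ a, h1.1, h1.2⟩
        · exact .symm _ _ (.rel _ _ ⟨τ a, h1.1, h1.2⟩)
      | refl x => exact .refl _
      | symm x y _ ih => exact .symm _ _ ih
      | trans x y z _ _ ih1 ih2 => exact .trans _ _ _ ih1 ih2
    simpa using key _ _ (hΓ.connected (σ.symm x) (σ.symm y))

theorem Renames.admissible {s : Part} (h : Renames σ τ Γ Γ') (hΓ : Admissible s Γ) :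
    Admissible s Γ' where
  oriented := h.oriented hΓ.oriented
  two_le x := by have := hΓ.two_le (σ.symm x); rwa [h.symm.valence] at this
  not_passing x hx := hΓ.not_passing _ (h.symm.passing hx)
  gc_or_circ := by
    have := hΓ.gc_or_circ
    cases s with
    | gc =>
      obtain ⟨x, hx⟩ := this
      exact ⟨σ x, by rwa [h.valence]⟩
    | circ => exact fun x => by rw [← this (σ.symm x), h.symm.valence]

theorem renames_permV (σ : Equiv.Perm (Fin v)) (Γ : Graph K v e) :
    Renames σ 1 Γ (Γ.permV σ) where
  ends a := Or.inl ⟨rfl, rfl⟩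
  head c a := by by_cases h : Γ.ori c a <;> simp [Graph.head, permV, h]
  tail c a := by by_cases h : Γ.ori c a <;> simp [Graph.tail, permV, h]

theorem renames_permE (τ : Equiv.Perm (Fin e)) (Γ : Graph K v e) :
    Renames 1 τ Γ (Γ.permE τ) where
  ends a := by simp [permE]
  head c a := by simp [Graph.head, permE]
  tail c a := by simp [Graph.tail, permE]

theorem renames_flip (b : Fin e) (Γ : Graph K v e) : Renames 1 1 Γ (Γ.flip b) where
  ends a := by by_cases h : a = b <;> simp [flip, h]
  head c a := by
    by_cases h : a = b <;> by_cases h2 : Γ.ori c a <;> simp_all [Graph.head, flip]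
  tail c a := by
    by_cases h : a = b <;> by_cases h2 : Γ.ori c a <;> simp_all [Graph.tail, flip]

theorem Renames.admissible_iff {s : Part} (h : Renames σ τ Γ Γ') :
    Admissible s Γ' ↔ Admissible s Γ :=
  ⟨h.symm.admissible, h.admissible⟩

end Graph

/-- A permutation that sends `p` to `σ p` permutes the remaining elements. -/
theorem exists_perm_succAbove {m : ℕ} (σ : Equiv.Perm (Fin (m + 1))) (p : Fin (m + 1)) :
    ∃ σ' : Equiv.Perm (Fin m), (∀ i, σ (p.succAbove i) = (σ p).succAbove (σ' i)) ∧
      Equiv.Perm.sign σ' = Equiv.Perm.sign σ * (-1) ^ ((p : ℕ) + (σ p : ℕ)) := by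
  obtain ⟨⟨q, σ'⟩, hρ⟩ := Equiv.Perm.decomposeFin.symm.surjective
    ((σ p).cycleRange * σ * p.cycleRange.symm)
  have h0 : q = 0 := by
    have := congrArg (fun f => f 0) hρ
    simpa [Fin.cycleRange_symm_zero] using this
  subst h0
  refine ⟨σ', fun i => ?_, ?_⟩
  · apply (σ p).cycleRange.injective
    rw [Fin.cycleRange_succAbove]
    have := congrArg (fun f => f i.succ) hρ
    simp only [Equiv.Perm.decomposeFin_symm_apply_succ, Equiv.swap_self, Equiv.refl_apply,
      Equiv.Perm.mul_apply, Fin.cycleRange_symm_succ] at this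
    exact this.symm
  · have := congrArg Equiv.Perm.sign hρ
    rw [Equiv.Perm.decomposeFin.symm_sign] at this
    simp only [if_true, one_mul, map_mul, Equiv.Perm.sign_symm, Fin.sign_cycleRange] at this
    rw [this, pow_add, mul_comm ((-1) ^ (σ p : ℕ)) (Equiv.Perm.sign σ), mul_assoc,
      mul_comm ((-1 : ℤˣ) ^ (σ p : ℕ))]

namespace Graph

variable {K v e w : ℕ}

theorem renumber_succAbove (p : Fin (w + 2)) (i : Fin (w + 1)) :
    renumber p (p.succAbove i) = i := by
  simp [renumber]

theorem renumber_perm {σ : Equiv.Perm (Fin (w + 2))} {σ' : Equiv.Perm (Fin (w + 1))}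
    {p : Fin (w + 2)} (h : ∀ i, σ (p.succAbove i) = (σ p).succAbove (σ' i)) {y : Fin (w + 2)}
    (hy : y ≠ p) : renumber (σ p) (σ y) = σ' (renumber p y) := by
  obtain ⟨i, rfl⟩ := Fin.exists_succAbove_eq hy
  rw [h, renumber_succAbove, renumber_succAbove]

theorem merge_perm {σ : Equiv.Perm (Fin (w + 2))} {σ' : Equiv.Perm (Fin (w + 1))}
    {p q : Fin (w + 2)} (h : ∀ i, σ (p.succAbove i) = (σ p).succAbove (σ' i)) (hq : q ≠ p)
    (x : Fin (w + 2)) : merge (σ p) (σ q) (σ x) = σ' (merge p q x) := by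
  by_cases hx : x = p
  · simp [merge, hx, renumber_perm h hq]
  · simp [merge, hx, renumber_perm h hx]

theorem contract_permV {σ : Equiv.Perm (Fin (w + 2))} {σ' : Equiv.Perm (Fin (w + 1))}
    {Γ : Graph K (w + 2) (e + 1)} {t : Fin (e + 1)} (ht : Γ.src t ≠ Γ.tgt t)
    (h : ∀ i, σ ((Γ.tgt t).succAbove i) = (σ (Γ.tgt t)).succAbove (σ' i)) :
    (Γ.permV σ).contract t = (Γ.contract t).permV σ' := by
  ext a
  · exact congrArg Fin.val (merge_perm h ht _)
  · exact congrArg Fin.val (merge_perm h ht _)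
  · rfl

theorem contract_permE {τ : Equiv.Perm (Fin (e + 1))} {τ' : Equiv.Perm (Fin e)}
    {Γ : Graph K (w + 2) (e + 1)} {t : Fin (e + 1)}
    (h : ∀ i, τ (t.succAbove i) = (τ t).succAbove (τ' i)) :
    (Γ.permE τ).contract (τ t) = (Γ.contract t).permE τ' := by
  have h' : ∀ a, τ.symm ((τ t).succAbove a) = t.succAbove (τ'.symm a) := by
    intro a
    rw [Equiv.symm_apply_eq, h]; simp
  ext a <;> simp [permE, contract, h']

theorem contract_flip_ne (Γ : Graph K (w + 2) (e + 1)) (t : Fin (e + 1)) (b : Fin e) :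
    (Γ.flip (t.succAbove b)).contract t = (Γ.contract t).flip b := by
  ext i j
  · by_cases h : i = b <;> simp [flip, contract, h, (Fin.succAbove_ne t b).symm]
  · by_cases h : i = b <;> simp [flip, contract, h, (Fin.succAbove_ne t b).symm]
  · by_cases h : j = b <;> simp [flip, contract, h]

theorem contract_flip_self (Γ : Graph K (w + 2) (e + 1)) (t : Fin (e + 1))
    (ht : Γ.src t ≠ Γ.tgt t) :
    ((Γ.flip t).permV (Equiv.swap (Γ.src t) (Γ.tgt t))).contract t = Γ.contract t := by
  have key : ∀ x, merge (Γ.tgt t) (Γ.src t) (Equiv.swap (Γ.src t) (Γ.tgt t) x) =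
      merge (Γ.tgt t) (Γ.src t) x := by
    intro x
    by_cases h1 : x = Γ.src t
    · subst h1; simp [merge, ht]
    · by_cases h2 : x = Γ.tgt t
      · subst h2; simp [merge, ht]
      · rw [Equiv.swap_apply_of_ne_of_ne h1 h2]
  ext a
  all_goals
    simp [flip, contract, permV, Fin.succAbove_ne, key]

end Graph

variable (𝕂 : Type*) [Field 𝕂] (n : ℤ) (s : Part) {K v e w : ℕ}

theorem mkQ_unit_smul (u : ℤˣ) (x : Labelled 𝕂 s K) :
    (relations 𝕂 n s K).mkQ (u • x) = u • (relations 𝕂 n s K).mkQ x := by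
  rw [Units.smul_def, map_zsmul, Units.smul_def]

theorem mkQ_permV (Γ : Graph K v e) (σ : Equiv.Perm (Fin v)) :
    (relations 𝕂 n s K).mkQ (toChain 𝕂 s (Γ.permV σ)) =
      signV n σ • (relations 𝕂 n s K).mkQ (toChain 𝕂 s Γ) := by
  rw [← mkQ_unit_smul, ← sub_eq_zero, ← map_sub, Submodule.mkQ_apply,
    Submodule.Quotient.mk_eq_zero]
  exact Submodule.subset_span (Or.inl (Or.inl ⟨v, e, Γ, σ, rfl⟩))

theorem mkQ_permE (Γ : Graph K v e) (τ : Equiv.Perm (Fin e)) :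
    (relations 𝕂 n s K).mkQ (toChain 𝕂 s (Γ.permE τ)) =
      signE n τ • (relations 𝕂 n s K).mkQ (toChain 𝕂 s Γ) := by
  rw [← mkQ_unit_smul, ← sub_eq_zero, ← map_sub, Submodule.mkQ_apply,
    Submodule.Quotient.mk_eq_zero]
  exact Submodule.subset_span (Or.inl (Or.inr ⟨v, e, Γ, τ, rfl⟩))

theorem mkQ_flip (Γ : Graph K v e) (a : Fin e) :
    (relations 𝕂 n s K).mkQ (toChain 𝕂 s (Γ.flip a)) =
      signFlip n • (relations 𝕂 n s K).mkQ (toChain 𝕂 s Γ) := by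
  rw [← mkQ_unit_smul, ← sub_eq_zero, ← map_sub, Submodule.mkQ_apply,
    Submodule.Quotient.mk_eq_zero]
  exact Submodule.subset_span (Or.inr ⟨v, e, Γ, a, rfl⟩)

theorem boundary_toChain_of_not {Γ : Graph K v e} (h : ¬ Admissible s Γ) :
    boundary 𝕂 n s K (toChain 𝕂 s Γ) = 0 := by
  simp [toChain, h]

theorem boundary_toChain {Γ : Graph K (w + 2) (e + 1)} (h : Admissible s Γ) :
    boundary 𝕂 n s K (toChain 𝕂 s Γ) =
      ∑ t, Γ.contractSign n t • toChain 𝕂 s (Γ.contract t) := by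
  simp [toChain, h, boundary, boundaryGen]

theorem boundary_toChain_small (Γ : Graph K v e) (h : v < 2 ∨ e < 1) :
    boundary 𝕂 n s K (toChain 𝕂 s Γ) = 0 := by
  by_cases hΓ : Admissible s Γ
  · rcases v with _ | _ | v <;> rcases e with _ | e <;>
      first | omega | simp [toChain, hΓ, boundary, boundaryGen]
  · exact boundary_toChain_of_not 𝕂 n s hΓ

theorem neg_one_pow_tsub {a b : ℕ} (h : b ≤ a) : (-1 : ℤˣ) ^ (a - b) = (-1) ^ (a + b) := by
  obtain ⟨c, rfl⟩ := Nat.exists_eq_add_of_le h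
  rw [Nat.add_sub_cancel_left, show b + c + b = c + 2 * b by ring, pow_add, pow_mul]
  simp

theorem mkQ_boundary_permV (Γ : Graph K (w + 2) (e + 1)) (h : Admissible s Γ)
    (σ : Equiv.Perm (Fin (w + 2))) (t : Fin (e + 1)) :
    (Γ.permV σ).contractSign n t •
        (relations 𝕂 n s K).mkQ (toChain 𝕂 s ((Γ.permV σ).contract t)) =
      signV n σ • Γ.contractSign n t • (relations 𝕂 n s K).mkQ (toChain 𝕂 s (Γ.contract t)) := by
  obtain ⟨σ', h1, h2⟩ := exists_perm_succAbove σ (Γ.tgt t)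
  rw [Graph.contract_permV (h.oriented.no_tadpole t) h1, mkQ_permV, smul_smul, smul_smul]
  congr 1
  by_cases hn : Even n
  · simp [Graph.contractSign, signV, hn]
  · simp only [Graph.contractSign, signV, hn, if_false, h2, Graph.permV]
    rw [neg_one_pow_tsub (by omega), neg_one_pow_tsub (by omega)]
    simp only [pow_add]
    rcases neg_one_pow_eq_or ℤˣ (σ (Γ.tgt t) : ℕ) with h3 | h3 <;>
      rcases neg_one_pow_eq_or ℤˣ (Γ.tgt t : ℕ) with h4 | h4 <;> simp [h3, h4, mul_comm]

theorem mkQ_boundary_permE (Γ : Graph K (w + 2) (e + 1))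
    (τ : Equiv.Perm (Fin (e + 1))) (t : Fin (e + 1)) :
    (Γ.permE τ).contractSign n (τ t) •
        (relations 𝕂 n s K).mkQ (toChain 𝕂 s ((Γ.permE τ).contract (τ t))) =
      signE n τ • Γ.contractSign n t • (relations 𝕂 n s K).mkQ (toChain 𝕂 s (Γ.contract t)) := by
  obtain ⟨τ', h1, h2⟩ := exists_perm_succAbove τ t
  rw [Graph.contract_permE h1, mkQ_permE, smul_smul, smul_smul]
  congr 1
  by_cases hn : Even n
  · simp only [Graph.contractSign, signE, hn, if_true, h2]
    rw [neg_one_pow_tsub (by omega), neg_one_pow_tsub (by omega)]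
    simp only [pow_add]
    rcases neg_one_pow_eq_or ℤˣ (τ t : ℕ) with h3 | h3 <;>
      rcases neg_one_pow_eq_or ℤˣ (t : ℕ) with h4 | h4 <;> simp [h3, h4, mul_comm]
  · simp [Graph.contractSign, signE, hn, Graph.permE]

theorem mkQ_boundary_flip (Γ : Graph K (w + 2) (e + 1)) (h : Admissible s Γ)
    (a t : Fin (e + 1)) :
    (Γ.flip a).contractSign n t •
        (relations 𝕂 n s K).mkQ (toChain 𝕂 s ((Γ.flip a).contract t)) =
      signFlip n • Γ.contractSign n t • (relations 𝕂 n s K).mkQ (toChain 𝕂 s (Γ.contract t)) := by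
  by_cases hat : a = t
  · subst hat
    have ht := h.oriented.no_tadpole a
    obtain ⟨σ', h1, h2⟩ :=
      exists_perm_succAbove (Equiv.swap (Γ.src a) (Γ.tgt a)) ((Γ.flip a).tgt a)
    have h3 : (Γ.flip a).src a ≠ (Γ.flip a).tgt a := by simpa [Graph.flip] using ht.symm
    rw [← Graph.contract_flip_self Γ a ht, Graph.contract_permV h3 h1, mkQ_permV, smul_smul,
      smul_smul]
    congr 1
    by_cases hn : Even n
    · simp [Graph.contractSign, signV, signFlip, hn]
    · simp only [Graph.contractSign, signV, signFlip, hn, if_false, h2, Graph.flip, if_true,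
        Equiv.swap_apply_left, Equiv.Perm.sign_swap ht]
      rw [neg_one_pow_tsub (by omega), neg_one_pow_tsub (by omega)]
      simp only [pow_add]
      rcases neg_one_pow_eq_or ℤˣ (Γ.src a : ℕ) with h3 | h3 <;>
        rcases neg_one_pow_eq_or ℤˣ (Γ.tgt a : ℕ) with h4 | h4 <;> simp [h3, h4]
  · obtain ⟨b, rfl⟩ := Fin.exists_succAbove_eq hat
    rw [Graph.contract_flip_ne, mkQ_flip, smul_smul, smul_smul, mul_comm]
    congr 2
    simp [Graph.contractSign, Graph.flip, (Fin.succAbove_ne t b).symm]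

theorem mkQ_boundary_of_rel {Γ Γ' : Graph K v e} {σ : Equiv.Perm (Fin v)}
    {τ : Equiv.Perm (Fin e)} (h : Graph.Renames σ τ Γ Γ') (ε : ℤˣ)
    (H : 2 ≤ v ∧ 1 ≤ e → Admissible s Γ →
      (relations 𝕂 n s K).mkQ (boundary 𝕂 n s K (toChain 𝕂 s Γ')) =
        ε • (relations 𝕂 n s K).mkQ (boundary 𝕂 n s K (toChain 𝕂 s Γ))) :
    boundary 𝕂 n s K (toChain 𝕂 s Γ' - ε • toChain 𝕂 s Γ) ∈ relations 𝕂 n s K := by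
  rw [← Submodule.Quotient.mk_eq_zero, ← Submodule.mkQ_apply, map_sub, map_sub, Units.smul_def,
    map_zsmul, map_zsmul, ← Units.smul_def, sub_eq_zero]
  by_cases hv : 2 ≤ v ∧ 1 ≤ e
  · by_cases hΓ : Admissible s Γ
    · exact H hv hΓ
    · rw [boundary_toChain_of_not 𝕂 n s hΓ,
        boundary_toChain_of_not 𝕂 n s (fun h' => hΓ (h.admissible_iff.1 h'))]
      simp
  · have hv' : v < 2 ∨ e < 1 := by omega
    rw [boundary_toChain_small 𝕂 n s Γ hv', boundary_toChain_small 𝕂 n s Γ' hv']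
    simp

/-- The differential is compatible with passing to coinvariants. -/
theorem relations_le_comap (K : ℕ) :
    relations 𝕂 n s K ≤ (relations 𝕂 n s K).comap (boundary 𝕂 n s K) := by
  conv_lhs => rw [relations]
  rw [Submodule.span_le]
  rintro x ((⟨v, e, Γ, σ, rfl⟩ | ⟨v, e, Γ, τ, rfl⟩) | ⟨v, e, Γ, a, rfl⟩)
  · refine mkQ_boundary_of_rel 𝕂 n s (Γ.renames_permV σ) _ fun hv hΓ => ?_
    obtain ⟨w, rfl⟩ := Nat.exists_eq_add_of_le' hv.1
    obtain ⟨e, rfl⟩ := Nat.exists_eq_add_of_le' hv.2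
    rw [boundary_toChain 𝕂 n s hΓ, boundary_toChain 𝕂 n s ((Γ.renames_permV σ).admissible hΓ)]
    simp only [map_sum, mkQ_unit_smul, Finset.smul_sum]
    exact Finset.sum_congr rfl fun t _ => mkQ_boundary_permV 𝕂 n s Γ hΓ σ t
  · refine mkQ_boundary_of_rel 𝕂 n s (Γ.renames_permE τ) _ fun hv hΓ => ?_
    obtain ⟨w, rfl⟩ := Nat.exists_eq_add_of_le' hv.1
    obtain ⟨e, rfl⟩ := Nat.exists_eq_add_of_le' hv.2
    rw [boundary_toChain 𝕂 n s hΓ, boundary_toChain 𝕂 n s ((Γ.renames_permE τ).admissible hΓ)]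
    simp only [map_sum, mkQ_unit_smul, Finset.smul_sum]
    rw [← Equiv.sum_comp τ]
    exact Finset.sum_congr rfl fun t _ => mkQ_boundary_permE 𝕂 n s Γ τ t
  · refine mkQ_boundary_of_rel 𝕂 n s (Γ.renames_flip a) _ fun hv hΓ => ?_
    obtain ⟨w, rfl⟩ := Nat.exists_eq_add_of_le' hv.1
    obtain ⟨e, rfl⟩ := Nat.exists_eq_add_of_le' hv.2
    rw [boundary_toChain 𝕂 n s hΓ, boundary_toChain 𝕂 n s ((Γ.renames_flip a).admissible hΓ)]
    simp only [map_sum, mkQ_unit_smul, Finset.smul_sum]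
    exact Finset.sum_congr rfl fun t _ => mkQ_boundary_flip 𝕂 n s Γ hΓ a t

end WellDefined

/-! ### The complexes -/

section Complexes

variable (𝕂 : Type*) [Field 𝕂] (n : ℤ) (s : Part) (K : ℕ)

/-- The graph complex (for `K` colours), as a vector space: the coinvariants. -/
abbrev GraphComplex : Type _ := Labelled 𝕂 s K ⧸ relations 𝕂 n s K

variable {K} in
/-- The class of a labelled graph (zero if the graph is not admissible). -/
def cls {v e : ℕ} (Γ : Graph K v e) : GraphComplex 𝕂 n s K :=
  (relations 𝕂 n s K).mkQ (toChain 𝕂 s Γ)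

/-- The differential of the graph complex. -/
def differential : GraphComplex 𝕂 n s K →ₗ[𝕂] GraphComplex 𝕂 n s K :=
  (relations 𝕂 n s K).mapQ (relations 𝕂 n s K) (boundary 𝕂 n s K) (relations_le_comap 𝕂 n s K)

/-- The part of degree `i` of the graph complex. -/
def homogeneous (i : ℤ) : Submodule 𝕂 (GraphComplex 𝕂 n s K) :=
  (Submodule.span 𝕂 {x | ∃ g : Gen s K, degree n g = i ∧ x = Finsupp.single g 1}).map
    (relations 𝕂 n s K).mkQ

end Complexes

/-! ### Homology -/

section Homology

variable {𝕂 M M' : Type*} [Field 𝕂] [AddCommGroup M] [Module 𝕂 M] [AddCommGroup M'] [Module 𝕂 M']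

/-- `d` is a differential of degree `-1`, where `A i` is the part of degree `i`. -/
def IsDifferential (A : ℤ → Submodule 𝕂 M) (d : M →ₗ[𝕂] M) : Prop :=
  d ∘ₗ d = 0 ∧ ∀ i, ∀ x ∈ A i, d x ∈ A (i - 1)

/-- The homology in degree `i`: cycles of degree `i` modulo boundaries of chains of degree `i + 1`. -/
abbrev Homology (A : ℤ → Submodule 𝕂 M) (d : M →ₗ[𝕂] M) (i : ℤ) : Type _ :=
  ↥(A i ⊓ LinearMap.ker d) ⧸ ((A (i + 1)).map d).submoduleOf (A i ⊓ LinearMap.ker d)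

/-- `f` is a map of complexes that induces an isomorphism on the homology in every degree. -/
def IsQuasiIso (A : ℤ → Submodule 𝕂 M) (d : M →ₗ[𝕂] M) (A' : ℤ → Submodule 𝕂 M')
    (d' : M' →ₗ[𝕂] M') (f : M →ₗ[𝕂] M') : Prop :=
  (∀ i, ∀ x ∈ A i, f x ∈ A' i) ∧ f ∘ₗ d = d' ∘ₗ f ∧
    ∀ i, ∃ φ : Homology A d i ≃ₗ[𝕂] Homology A' d' i,
      ∀ (x : ↥(A i ⊓ LinearMap.ker d)) (y : ↥(A' i ⊓ LinearMap.ker d')), f x = y →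
        φ (Submodule.Quotient.mk x) = Submodule.Quotient.mk y

/-- The grading induced on a subspace. -/
def gradingOn (A : ℤ → Submodule 𝕂 M) (S : Submodule 𝕂 M) (i : ℤ) : Submodule 𝕂 S :=
  (A i).submoduleOf S

/-- The map induced by `d` on `S`, when `S` is identified with the quotient by a complement `D`. -/
def inducedOn (d : M →ₗ[𝕂] M) (S D : Submodule 𝕂 M) (h : IsCompl S D) : S →ₗ[𝕂] S :=
  S.projectionOnto D h ∘ₗ d ∘ₗ S.subtype

end Homology

/-! ### Skeleton edges, and the special part -/

namespace Graph

variable {k v e : ℕ}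

/-- Weakly passing vertices of a graph with `k + 1` colours: 2-valent, passing in the first `k`
colours and not passing in the last one. All other vertices are the skeleton vertices. -/
def WeaklyPassing (Γ : Graph (k + 1) v e) (x : Fin v) : Prop :=
  Γ.valence x = 2 ∧ (∀ c : Fin k, Γ.PassesIn c.castSucc x) ∧ ¬ Γ.PassesIn (Fin.last k) x

/-- The skeleton edge that contains the edge `a`: the edges that are reached from `a` by going
repeatedly from an edge to another edge through a common weakly passing vertex. -/
def skeletonEdge (Γ : Graph (k + 1) v e) (a : Fin e) : Finset (Fin e) :=
  Finset.univ.filter fun b =>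
    Relation.EqvGen (fun a b => ∃ z, Γ.WeaklyPassing z ∧ Γ.Inc z a ∧ Γ.Inc z b) a b

/-- The length of the skeleton edge that contains `a`. -/
def skeletonLength (Γ : Graph (k + 1) v e) (a : Fin e) : ℕ := (Γ.skeletonEdge a).card

/-- The middle vertices of the skeleton edges of length 2. -/
def middles (Γ : Graph (k + 1) v e) : Finset (Fin v) :=
  Finset.univ.filter fun z => Γ.WeaklyPassing z ∧ ∀ a, Γ.Inc z a → Γ.skeletonLength a = 2

/-- Reverse the last colour on all edges at vertices in `S`. For a middle vertex `z` of a skeleton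
edge of length 2 this interchanges `→ z ←` and `← z →`. -/
def reverseLast (S : Finset (Fin v)) (Γ : Graph (k + 1) v e) : Graph (k + 1) v e where
  src := Γ.src
  tgt := Γ.tgt
  ori c a := if c = Fin.last k ∧ ∃ z ∈ S, Γ.Inc z a then !Γ.ori c a else Γ.ori c a

end Graph

section Special

variable (𝕂 : Type*) [Field 𝕂] (n : ℤ) (s : Part) {k v e : ℕ}

/-- The graph `Γ` where each skeleton edge of length 2 is replaced by the dotted edge
`½ (→ z ← - ← z →)` if its middle vertex `z` is in `T`, and by the crossed edge
`½ (→ z ← + ← z →)` if not. In the dotted edge the labels, and the last colour as the intrinsic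
orientation, are meant to be the same in both terms up to the reversal of the two edges. Here the
intrinsic orientations are kept instead, which is the same in the coinvariants as reversing an
intrinsic orientation twice has sign `+1`. -/
def decorated (Γ : Graph (k + 1) v e) (T : Finset (Fin v)) : GraphComplex 𝕂 n s (k + 1) :=
  (2⁻¹ : 𝕂) ^ Γ.middles.card •
    ∑ S ∈ Γ.middles.powerset, (-1 : 𝕂) ^ (S ∩ T).card • cls 𝕂 n s (Γ.reverseLast S)

variable (k)

/-- The special part: spanned by the graphs all of whose skeleton edges are single edges or
dotted edges. -/
def special : Submodule 𝕂 (GraphComplex 𝕂 n s (k + 1)) :=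
  Submodule.span 𝕂 {x | ∃ (v e : ℕ) (Γ : Graph (k + 1) v e), Admissible s Γ ∧
    (∀ a, Γ.skeletonLength a ≤ 2) ∧ x = decorated 𝕂 n s Γ Γ.middles}

/-- The complementary part: spanned by the graphs with at least one skeleton edge that is neither a
single edge nor a dotted edge, so that it is a crossed edge or has length at least 3. -/
def dagger : Submodule 𝕂 (GraphComplex 𝕂 n s (k + 1)) :=
  Submodule.span 𝕂 {x | ∃ (v e : ℕ) (Γ : Graph (k + 1) v e) (T : Finset (Fin v)),
    Admissible s Γ ∧ T ⊆ Γ.middles ∧ ((∃ a, 3 ≤ Γ.skeletonLength a) ∨ T ≠ Γ.middles) ∧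
    x = decorated 𝕂 n s Γ T}

end Special

end OGC

end

/-! The square of the differential vanishes because two edges can be contracted in either order,
with opposite signs (`cterm₂_swap`). The rules that put contractions to zero do no harm: a coloured
cycle survives every further contraction, and at a passing vertex the contractions of its two edges
cancel (`differential_cls_of_pre`).

Call a vertex straight if it is 2-valent and passes in all colours but possibly the last. In an
admissible graph these are the weakly passing vertices. At the middle of a skeleton edge of length
2, reversing the last colour is an involution; the dotted edge is its eigenvector for `-1`, the
crossed edge for `+1`. Decorated graphs are thus the Fourier components of a graph with respect to
these reversals, which gives the splitting into `special` and `dagger`. In a longer skeleton edge,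
reversing at a straight vertex makes a straight neighbour passing, so the result is zero. Hence
`dagger` is also the span `cross` of all sums of a graph and its reversal at a straight vertex
(`dagger_eq_cross`). In this form it is easily seen to be stable under the differential and under
the homotopy.

The homotopy `extend` subdivides every edge with exactly one straight end, next to the other end;
these edges are the ends of the skeleton edges of length at least 2. In the commutator `laplacian`
of the differential and `extend`, each such end contributes the graph twice over: once by
contracting the new edge, and once by contracting the old end `t` and comparing subdivisions after
and before. The second copy is the graph itself if the skeleton edge has length at least 3, and its
reversal at the middle vertex if the length is 2 (`sum_defect_of_isEnd`). On a decorated graph a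
dotted edge therefore contributes 0, while each end of a crossed or longer skeleton edge contributes
2 (`laplacian_decorated`). The error terms come from contracting an edge between two vertices that
are not straight, which may create a straight vertex; they have fewer skeleton vertices.

On the generators of `dagger` the leading coefficient is not zero. By induction on the number of
skeleton vertices, every element of `dagger` is annihilated by a polynomial in `laplacian` with
nonzero constant term (`dagger_le_killed`), and this suffices to write cycles as boundaries
(`exists_boundary_of_killed`). The statements on `special` follow by linear algebra, as its
complement is acyclic. For `k = 0` there are no error terms: `laplacian` vanishes on `special`, is
injective on `dagger` and commutes with the differential, which therefore preserves `special`. -/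

noncomputable section

namespace OGC

/-! ### Ends of edges, heads and tails -/

namespace Graph

variable {K k v e w : ℕ}

/-- The end of an edge: its intrinsic head for `true`, its intrinsic tail for `false`. -/
def endAt (Γ : Graph K v e) (s : Bool) (a : Fin e) : Fin v := if s then Γ.tgt a else Γ.src a

@[simp] theorem endAt_true (Γ : Graph K v e) (a : Fin e) : Γ.endAt true a = Γ.tgt a := rfl

@[simp] theorem endAt_false (Γ : Graph K v e) (a : Fin e) : Γ.endAt false a = Γ.src a := rfl

theorem head_eq_endAt (Γ : Graph K v e) (c : Fin K) (a : Fin e) :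
    Γ.head c a = Γ.endAt (Γ.ori c a) a := rfl

theorem tail_eq_endAt (Γ : Graph K v e) (c : Fin K) (a : Fin e) :
    Γ.tail c a = Γ.endAt (!Γ.ori c a) a := by
  cases h : Γ.ori c a <;> simp [tail, h]

theorem inc_iff_endAt {Γ : Graph K v e} {x : Fin v} {a : Fin e} :
    Γ.Inc x a ↔ ∃ s, Γ.endAt s a = x := by simp [Inc]

theorem inc_endAt (Γ : Graph K v e) (s : Bool) (a : Fin e) : Γ.Inc (Γ.endAt s a) a :=
  inc_iff_endAt.2 ⟨s, rfl⟩

theorem inc_src (Γ : Graph K v e) (a : Fin e) : Γ.Inc (Γ.src a) a := Or.inl rfl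

theorem inc_tgt (Γ : Graph K v e) (a : Fin e) : Γ.Inc (Γ.tgt a) a := Or.inr rfl

theorem inc_iff_head_or_tail {Γ : Graph K v e} (c : Fin K) {x : Fin v} {a : Fin e} :
    Γ.Inc x a ↔ Γ.head c a = x ∨ Γ.tail c a = x := by
  cases h : Γ.ori c a <;> simp [Inc, head, tail, h, or_comm]

theorem head_ne_tail {Γ : Graph K v e} {a : Fin e} (h : Γ.src a ≠ Γ.tgt a) (c : Fin K) :
    Γ.head c a ≠ Γ.tail c a := by
  cases h' : Γ.ori c a <;> simp [head, tail, h', h, h.symm]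

theorem head_eq_iff {Γ : Graph K v e} {a : Fin e} (h : Γ.src a ≠ Γ.tgt a) (c : Fin K)
    {x : Fin v} (hx : Γ.Inc x a) : Γ.head c a = x ↔ Γ.tail c a ≠ x := by
  have := head_ne_tail h c
  rcases (inc_iff_head_or_tail c).1 hx with rfl | rfl
  · simp [this.symm]
  · simp [this]

/-! ### Rank functions -/

/-- The vertices can be ranked such that all edges increase the rank in the colour `c`. -/
def Ranked (Γ : Graph K v e) (c : Fin K) : Prop :=
  ∃ f : Fin v → ℤ, ∀ a, f (Γ.tail c a) < f (Γ.head c a)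

theorem Ranked.no_cycle {Γ : Graph K v e} {c : Fin K} (h : Γ.Ranked c) (a : Fin e) :
    ¬ Relation.TransGen (fun a b => Γ.head c a = Γ.tail c b) a a := by
  obtain ⟨f, hf⟩ := h
  have key : ∀ b, Relation.TransGen (fun a b => Γ.head c a = Γ.tail c b) a b →
      f (Γ.head c a) < f (Γ.head c b) := by
    intro b hb
    induction hb with
    | single hab => rw [hab]; exact hf _
    | tail _ hbc ih => exact ih.trans (by rw [hbc]; exact hf _)
  exact fun ha => lt_irrefl _ (key a ha)

/-- The rank of `x` counts the edges from which an edge with head `x` can be reached. Along `a`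
nothing is lost, and `a` itself is new at its head, since otherwise it would lie on a cycle. Rank
functions are used in place of the absence of cycles because they are easily carried through
contractions, subdivisions and reversals. -/
theorem ranked_of_no_cycle {Γ : Graph K v e} {c : Fin K}
    (h : ∀ a, ¬ Relation.TransGen (fun a b => Γ.head c a = Γ.tail c b) a a) : Γ.Ranked c := by
  let R : Fin e → Fin e → Prop := fun a b => Γ.head c a = Γ.tail c b
  refine ⟨fun x => ((Finset.univ.filter fun b =>
    ∃ a, Γ.head c a = x ∧ Relation.ReflTransGen R b a).card : ℤ), fun a => ?_⟩
  rw [Nat.cast_lt]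
  apply Finset.card_lt_card
  rw [Finset.ssubset_iff_of_subset]
  · refine ⟨a, by simpa using ⟨a, rfl, .refl⟩, ?_⟩
    simp only [Finset.mem_filter, Finset.mem_univ, true_and, not_exists, not_and]
    intro a' ha' hr
    exact h a (Relation.TransGen.tail' hr ha')
  · intro b
    simp only [Finset.mem_filter, Finset.mem_univ, true_and]
    rintro ⟨a', ha', hr⟩
    exact ⟨a, rfl, hr.tail ha'⟩

/-- A vertex that is a source or a sink can be ignored when ranking. -/
theorem ranked_of_extremal {Γ : Graph K v e} {c : Fin K} (z : Fin v)
    (hz : (∀ a, Γ.head c a ≠ z) ∨ ∀ a, Γ.tail c a ≠ z)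
    (h : ∃ f : Fin v → ℤ, ∀ a, ¬ Γ.Inc z a → f (Γ.tail c a) < f (Γ.head c a)) : Γ.Ranked c := by
  obtain ⟨f, hf⟩ := h
  -- A strict bound for all ranks: a source can be given the rank `-m`, a sink the rank `m`.
  obtain ⟨m, hm⟩ : ∃ m : ℤ, ∀ x, |f x| < m :=
    ⟨∑ x, |f x| + 1, fun x => Int.lt_add_one_of_le
      (Finset.single_le_sum (f := fun x => |f x|) (fun _ _ => abs_nonneg _) (Finset.mem_univ x))⟩
  rcases hz with hz | hz
  · refine ⟨Function.update f z (-m), fun a => ?_⟩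
    rw [Function.update_of_ne (hz a)]
    by_cases ha : Γ.tail c a = z
    · rw [ha, Function.update_self]; exact (abs_lt.1 (hm _)).1
    · rw [Function.update_of_ne ha]
      exact hf a (by simp [inc_iff_head_or_tail c, hz a, ha])
  · refine ⟨Function.update f z m, fun a => ?_⟩
    rw [Function.update_of_ne (hz a)]
    by_cases ha : Γ.head c a = z
    · rw [ha, Function.update_self]; exact (abs_lt.1 (hm _)).2
    · rw [Function.update_of_ne ha]
      exact hf a (by simp [inc_iff_head_or_tail c, hz a, ha])

theorem IsOriented.ranked {Γ : Graph K v e} (h : Γ.IsOriented) (c : Fin K) : Γ.Ranked c :=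
  ranked_of_no_cycle (h.no_cycle c)

/-! ### Vertices of valence two -/

/-- The edges at `z` are `a` and `b`, and these are different. -/
def EdgePair (Γ : Graph K v e) (z : Fin v) (a b : Fin e) : Prop :=
  a ≠ b ∧ ∀ i, Γ.Inc z i ↔ i = a ∨ i = b

theorem EdgePair.symm {Γ : Graph K v e} {z : Fin v} {a b : Fin e} (h : Γ.EdgePair z a b) :
    Γ.EdgePair z b a := ⟨h.1.symm, fun i => by rw [h.2, or_comm]⟩

theorem EdgePair.left {Γ : Graph K v e} {z : Fin v} {a b : Fin e} (h : Γ.EdgePair z a b) :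
    Γ.Inc z a := (h.2 a).2 (Or.inl rfl)

theorem EdgePair.right {Γ : Graph K v e} {z : Fin v} {a b : Fin e} (h : Γ.EdgePair z a b) :
    Γ.Inc z b := (h.2 b).2 (Or.inr rfl)

theorem EdgePair.valence {Γ : Graph K v e} {z : Fin v} {a b : Fin e} (h : Γ.EdgePair z a b) :
    Γ.valence z = 2 := by
  rw [Graph.valence, ← Finset.card_pair h.1]
  congr 1
  ext i
  simp [h.2]

theorem exists_edgePair {Γ : Graph K v e} {z : Fin v} (h : Γ.valence z = 2) :
    ∃ a b, Γ.EdgePair z a b := by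
  obtain ⟨a, b, hab, h⟩ := Finset.card_eq_two.1 h
  refine ⟨a, b, hab, fun i => ?_⟩
  simpa using congrArg (i ∈ ·) h

theorem exists_edgePair_of_inc {Γ : Graph K v e} {z : Fin v} (h : Γ.valence z = 2) {a : Fin e}
    (ha : Γ.Inc z a) : ∃ b, Γ.EdgePair z a b := by
  obtain ⟨b, c, hbc⟩ := exists_edgePair h
  rcases (hbc.2 a).1 ha with rfl | rfl
  exacts [⟨c, hbc⟩, ⟨b, hbc.symm⟩]

/-- An edge at `z` that is not a tadpole has `z` either as head or as tail, so passing is a single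
comparison of the two edges. -/
theorem EdgePair.passesIn {Γ : Graph K v e} {z : Fin v} {a b : Fin e} (h : Γ.EdgePair z a b)
    (h0 : ∀ a, Γ.src a ≠ Γ.tgt a) (c : Fin K) :
    Γ.PassesIn c z ↔ (Γ.head c a = z ↔ Γ.tail c b = z) := by
  have ha := head_eq_iff (h0 a) c h.left
  have hb := head_eq_iff (h0 b) c h.right
  rw [PassesIn, and_iff_right h.valence]
  have h1 : (∃ i, Γ.head c i = z) ↔ Γ.head c a = z ∨ Γ.head c b = z := by
    constructor
    · rintro ⟨i, hi⟩
      rcases (h.2 i).1 ((inc_iff_head_or_tail c).2 (Or.inl hi)) with rfl | rfl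
      exacts [Or.inl hi, Or.inr hi]
    · rintro (h | h)
      exacts [⟨a, h⟩, ⟨b, h⟩]
  have h2 : (∃ i, Γ.tail c i = z) ↔ Γ.tail c a = z ∨ Γ.tail c b = z := by
    constructor
    · rintro ⟨i, hi⟩
      rcases (h.2 i).1 ((inc_iff_head_or_tail c).2 (Or.inr hi)) with rfl | rfl
      exacts [Or.inl hi, Or.inr hi]
    · rintro (h | h)
      exacts [⟨a, h⟩, ⟨b, h⟩]
  rw [h1, h2]
  tauto

/-- A 2-valent vertex that does not pass is a source or a sink, so no cycle goes through it. This is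
the input of `ranked_of_extremal`. -/
theorem not_passesIn_iff {Γ : Graph K v e} {z : Fin v} (h : Γ.valence z = 2)
    (c : Fin K) :
    ¬ Γ.PassesIn c z ↔ (∀ a, Γ.head c a ≠ z) ∨ ∀ a, Γ.tail c a ≠ z := by
  simp only [PassesIn, h, true_and]
  push Not
  constructor
  · intro h1
    by_cases h2 : ∃ a, Γ.head c a = z
    · exact Or.inr (h1 h2)
    · exact Or.inl (by simpa using h2)
  · rintro (h1 | h1) ⟨a, ha⟩
    exacts [absurd ha (h1 a), h1]

/-! ### Straight vertices -/

/-- 2-valent vertices that pass in all colours but possibly the last one. -/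
def Straight (Γ : Graph (k + 1) v e) (x : Fin v) : Prop :=
  Γ.valence x = 2 ∧ ∀ c : Fin k, Γ.PassesIn c.castSucc x

theorem Passing.straight {Γ : Graph (k + 1) v e} {x : Fin v} (h : Γ.Passing x) : Γ.Straight x :=
  ⟨h.1, fun _ => h.2 _⟩

theorem Straight.passing_iff {Γ : Graph (k + 1) v e} {x : Fin v} (h : Γ.Straight x) :
    Γ.Passing x ↔ Γ.PassesIn (Fin.last k) x := by
  refine ⟨fun h' => h'.2 _, fun h' => ⟨h.1, fun c => ?_⟩⟩
  induction c using Fin.lastCases with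
  | last => exact h'
  | cast c => exact h.2 c

/-- Passing vertices are excluded, so the condition on the last colour is automatic. `Straight` does
not mention the last colour and is therefore not affected by reversing it. -/
theorem weaklyPassing_iff {s : Part} {Γ : Graph (k + 1) v e} (hΓ : Admissible s Γ) (x : Fin v) :
    Γ.WeaklyPassing x ↔ Γ.Straight x := by
  refine ⟨fun h => ⟨h.1, h.2.1⟩, fun h => ⟨h.1, h.2, fun h' => ?_⟩⟩
  exact hΓ.not_passing x (h.passing_iff.2 h')

theorem Straight.not_passesIn_last {s : Part} {Γ : Graph (k + 1) v e} {x : Fin v}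
    (h : Γ.Straight x) (hΓ : Admissible s Γ) : ¬ Γ.PassesIn (Fin.last k) x :=
  fun h' => hΓ.not_passing x (h.passing_iff.2 h')

variable {σ : Equiv.Perm (Fin v)} {τ : Equiv.Perm (Fin e)}

theorem Renames.passesIn_iff {Γ Γ' : Graph K v e} (h : Renames σ τ Γ Γ') (c : Fin K) (x : Fin v) :
    Γ'.PassesIn c (σ x) ↔ Γ.PassesIn c x := by
  have h1 : (∃ a, Γ'.head c a = σ x) ↔ ∃ a, Γ.head c a = x := by
    rw [← τ.exists_congr_right]; simp only [h.head, EmbeddingLike.apply_eq_iff_eq]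
  have h2 : (∃ a, Γ'.tail c a = σ x) ↔ ∃ a, Γ.tail c a = x := by
    rw [← τ.exists_congr_right]; simp only [h.tail, EmbeddingLike.apply_eq_iff_eq]
  rw [PassesIn, PassesIn, h.valence, h1, h2]

theorem Renames.straight_iff {Γ Γ' : Graph (k + 1) v e} (h : Renames σ τ Γ Γ') (x : Fin v) :
    Γ'.Straight (σ x) ↔ Γ.Straight x := by
  simp only [Straight, h.valence, h.passesIn_iff]

end Graph

/-! ### Renaming in the coinvariants -/

section Rename

variable (𝕂 : Type*) [Field 𝕂] (n : ℤ) (s : Part) {K v e w : ℕ}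

theorem cls_of_not {Γ : Graph K v e} (h : ¬ Admissible s Γ) : cls 𝕂 n s Γ = 0 := by
  simp [cls, toChain, h]

theorem cls_permV (Γ : Graph K v e) (σ : Equiv.Perm (Fin v)) :
    cls 𝕂 n s (Γ.permV σ) = signV n σ • cls 𝕂 n s Γ := mkQ_permV 𝕂 n s Γ σ

theorem cls_permE (Γ : Graph K v e) (τ : Equiv.Perm (Fin e)) :
    cls 𝕂 n s (Γ.permE τ) = signE n τ • cls 𝕂 n s Γ := mkQ_permE 𝕂 n s Γ τ

theorem cls_flip (Γ : Graph K v e) (a : Fin e) :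
    cls 𝕂 n s (Γ.flip a) = signFlip n • cls 𝕂 n s Γ := mkQ_flip 𝕂 n s Γ a

theorem cls_flipSet (Γ : Graph K v e) (B : Finset (Fin e)) :
    ∀ Γ' : Graph K v e, (∀ a, Γ'.src a = if a ∈ B then Γ.tgt a else Γ.src a) →
      (∀ a, Γ'.tgt a = if a ∈ B then Γ.src a else Γ.tgt a) →
      (∀ c a, Γ'.ori c a = if a ∈ B then !Γ.ori c a else Γ.ori c a) →
      cls 𝕂 n s Γ' = signFlip n ^ B.card • cls 𝕂 n s Γ := by
  induction B using Finset.induction_on with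
  | empty =>
    intro Γ' h1 h2 h3
    have : Γ' = Γ := by ext <;> simp_all
    simp [this]
  | insert b B hb ih =>
    intro Γ' h1 h2 h3
    have h := ih (Γ'.flip b) ?_ ?_ ?_
    · rw [Finset.card_insert_of_notMem hb, pow_succ', mul_smul, ← h, cls_flip, smul_smul]
      have : signFlip n * signFlip n = 1 := Int.units_mul_self _
      rw [this, one_smul]
    all_goals
      intros
      simp only [Graph.flip, h1, h2, h3, Finset.mem_insert]
      split_ifs <;> simp_all

/-- Renaming vertices by `σ`, edges by `τ`, and reversing the intrinsic orientations in `B`. -/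
theorem cls_rename {Γ Γ' : Graph K v e} (σ : Equiv.Perm (Fin v)) (τ : Equiv.Perm (Fin e))
    (B : Finset (Fin e)) (h1 : ∀ a, Γ'.src (τ a) = σ (if a ∈ B then Γ.tgt a else Γ.src a))
    (h2 : ∀ a, Γ'.tgt (τ a) = σ (if a ∈ B then Γ.src a else Γ.tgt a))
    (h3 : ∀ c a, Γ'.ori c (τ a) = if a ∈ B then !Γ.ori c a else Γ.ori c a) :
    cls 𝕂 n s Γ' = (signV n σ * signE n τ * signFlip n ^ B.card) • cls 𝕂 n s Γ := by
  let Γ₁ : Graph K v e :=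
    ⟨fun a => if a ∈ B then Γ.tgt a else Γ.src a, fun a => if a ∈ B then Γ.src a else Γ.tgt a,
      fun c a => if a ∈ B then !Γ.ori c a else Γ.ori c a⟩
  have h : Γ' = (Γ₁.permV σ).permE τ := by
    ext a b
    · have := h1 (τ.symm a); simp only [Equiv.apply_symm_apply] at this
      rw [this]; rfl
    · have := h2 (τ.symm a); simp only [Equiv.apply_symm_apply] at this
      rw [this]; rfl
    · have := h3 a (τ.symm b); simp only [Equiv.apply_symm_apply] at this
      rw [this]; rfl
  rw [h, cls_permE, cls_permV, cls_flipSet 𝕂 n s Γ B Γ₁ (fun _ => rfl) (fun _ => rfl)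
    (fun _ _ => rfl), smul_smul, smul_smul, mul_comm (signE n τ), mul_assoc]

theorem span_cls : Submodule.span 𝕂 {x | ∃ (v e : ℕ) (Γ : Graph K v e), Admissible s Γ ∧
    x = cls 𝕂 n s Γ} = ⊤ := by
  rw [eq_top_iff]
  rintro x -
  obtain ⟨x, rfl⟩ := (relations 𝕂 n s K).mkQ_surjective x
  induction x using Finsupp.induction_linear with
  | zero => simp
  | add f g hf hg => rw [map_add]; exact add_mem hf hg
  | single g a =>
    have : Finsupp.single g a = a • toChain 𝕂 s g.2.1 := by
      simp [toChain, g.2.2]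
    rw [this, map_smul]
    exact Submodule.smul_mem _ _ (Submodule.subset_span ⟨_, _, g.2.1, g.2.2, rfl⟩)

/-- A linear map from the graph complex is given by a function of graphs that transforms in the
right way under the group actions. -/
theorem exists_descend {M : Type*} [AddCommGroup M] [Module 𝕂 M]
    (F : ∀ {v e : ℕ}, Graph K v e → M)
    (hV : ∀ {v e : ℕ} (Γ : Graph K v e) (σ : Equiv.Perm (Fin v)), Admissible s Γ →
      F (Γ.permV σ) = signV n σ • F Γ)
    (hE : ∀ {v e : ℕ} (Γ : Graph K v e) (τ : Equiv.Perm (Fin e)), Admissible s Γ →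
      F (Γ.permE τ) = signE n τ • F Γ)
    (hF : ∀ {v e : ℕ} (Γ : Graph K v e) (a : Fin e), Admissible s Γ →
      F (Γ.flip a) = signFlip n • F Γ) :
    ∃ f : GraphComplex 𝕂 n s K →ₗ[𝕂] M, ∀ {v e : ℕ} (Γ : Graph K v e), Admissible s Γ →
      f (cls 𝕂 n s Γ) = F Γ := by
  let f₀ : Labelled 𝕂 s K →ₗ[𝕂] M := Finsupp.lift M 𝕂 (Gen s K) fun g => F g.2.1
  have h0 : ∀ {v e : ℕ} (Γ : Graph K v e), Admissible s Γ → f₀ (toChain 𝕂 s Γ) = F Γ := by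
    intro v e Γ h
    simp [f₀, toChain, h]
  have h1 : ∀ {v e : ℕ} (Γ : Graph K v e), ¬ Admissible s Γ → f₀ (toChain 𝕂 s Γ) = 0 := by
    intro v e Γ h
    simp [toChain, h]
  have h2 : ∀ (u : ℤˣ) x, f₀ (u • x) = u • f₀ x := by
    intro u x
    rw [Units.smul_def, map_zsmul, Units.smul_def]
  have h : relations 𝕂 n s K ≤ LinearMap.ker f₀ := by
    rw [relations, Submodule.span_le]
    rintro x ((⟨v, e, Γ, σ, rfl⟩ | ⟨v, e, Γ, τ, rfl⟩) | ⟨v, e, Γ, a, rfl⟩)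
    · by_cases hΓ : Admissible s Γ
      · simp [h2, h0 Γ hΓ, h0 _ ((Γ.renames_permV σ).admissible hΓ), hV Γ σ hΓ]
      · simp [h2, h1 Γ hΓ, h1 _ (fun h => hΓ ((Γ.renames_permV σ).admissible_iff.1 h))]
    · by_cases hΓ : Admissible s Γ
      · simp [h2, h0 Γ hΓ, h0 _ ((Γ.renames_permE τ).admissible hΓ), hE Γ τ hΓ]
      · simp [h2, h1 Γ hΓ, h1 _ (fun h => hΓ ((Γ.renames_permE τ).admissible_iff.1 h))]
    · by_cases hΓ : Admissible s Γ
      · simp [h2, h0 Γ hΓ, h0 _ ((Γ.renames_flip a).admissible hΓ), hF Γ a hΓ]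
      · simp [h2, h1 Γ hΓ, h1 _ (fun h => hΓ ((Γ.renames_flip a).admissible_iff.1 h))]
  refine ⟨(relations 𝕂 n s K).liftQ f₀ h, fun {v e} Γ hΓ => ?_⟩
  rw [cls, Submodule.mkQ_apply, Submodule.liftQ_apply, h0 Γ hΓ]

theorem map_unit_smul {M M' : Type*} [AddCommGroup M] [Module 𝕂 M] [AddCommGroup M'] [Module 𝕂 M']
    (f : M →ₗ[𝕂] M') (u : ℤˣ) (x : M) : f (u • x) = u • f x := by
  rw [Units.smul_def, map_zsmul, Units.smul_def]

theorem differential_cls {Γ : Graph K (w + 2) (e + 1)} (h : Admissible s Γ) :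
    differential 𝕂 n s K (cls 𝕂 n s Γ) =
      ∑ t, Γ.contractSign n t • cls 𝕂 n s (Γ.contract t) := by
  rw [cls, differential, Submodule.mkQ_apply, Submodule.mapQ_apply, boundary_toChain 𝕂 n s h,
    ← Submodule.mkQ_apply, map_sum]
  exact Finset.sum_congr rfl fun t _ => mkQ_unit_smul 𝕂 n s _ _

/-- A vertex of valence at least 2 has an edge, and this edge has two different ends. Hence the
default case of `boundaryGen` does not occur for admissible graphs. -/
theorem Admissible.exists_size {s : Part} {Γ : Graph K v e} (h : Admissible s Γ) :
    ∃ w' e', v = w' + 2 ∧ e = e' + 1 := by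
  have x : Fin v := ⟨0, h.oriented.pos⟩
  have h1 : 0 < Γ.valence x := lt_of_lt_of_le (by norm_num) (h.two_le x)
  obtain ⟨a, -⟩ := Finset.card_pos.1 h1
  have h2 := h.oriented.no_tadpole a
  have h3 : 2 ≤ v := by
    have h5 := (Γ.src a).2
    have h6 := (Γ.tgt a).2
    by_contra hv
    exact h2 (Fin.ext (by omega))
  have := a.2
  exact ⟨v - 2, e - 1, by omega, by omega⟩

end Rename

end OGC

namespace OGC

namespace Graph

variable {K k v e w : ℕ}

/-! ### Contractions -/

theorem merge_of_ne {p q x : Fin (w + 2)} (hx : x ≠ p) : merge p q x = renumber p x := by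
  simp [merge, hx]

theorem renumber_inj {p x y : Fin (w + 2)} (hx : x ≠ p) (hy : y ≠ p) :
    renumber p x = renumber p y ↔ x = y := by
  obtain ⟨i, rfl⟩ := Fin.exists_succAbove_eq hx
  obtain ⟨j, rfl⟩ := Fin.exists_succAbove_eq hy
  simp [renumber_succAbove]

theorem merge_eq_iff {p q : Fin (w + 2)} (hq : q ≠ p) (x y : Fin (w + 2)) :
    merge p q x = merge p q y ↔ x = y ∨ (x = q ∨ x = p) ∧ (y = q ∨ y = p) := by
  unfold merge
  by_cases hx : x = p <;> by_cases hy : y = p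
  · simp [hx, hy]
  · simp only [hx, hy, if_true, if_false, renumber_inj hq hy]
    simp [Ne.symm hy, eq_comm]
  · simp only [hx, hy, if_true, if_false, renumber_inj hx hq]
    simp
  · simp only [hx, hy, if_false, renumber_inj hx hy, or_false]
    constructor
    · exact Or.inl
    · rintro (h | ⟨rfl, rfl⟩) <;> trivial

theorem merge_surjective (p q : Fin (w + 2)) : Function.Surjective (merge p q) := by
  intro i
  refine ⟨p.succAbove i, ?_⟩
  rw [merge_of_ne (Fin.succAbove_ne p i), renumber_succAbove]

/-- The map of vertices of the contraction of an edge. -/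
def proj (Γ : Graph K (w + 2) e) (t : Fin e) : Fin (w + 2) → Fin (w + 1) :=
  merge (Γ.tgt t) (Γ.src t)

variable {Γ : Graph K (w + 2) (e + 1)} {t : Fin (e + 1)}

theorem proj_surjective (Γ : Graph K (w + 2) e) (t : Fin e) : Function.Surjective (Γ.proj t) :=
  merge_surjective _ _

theorem proj_eq_iff {Γ : Graph K (w + 2) e} {t : Fin e} (ht : Γ.src t ≠ Γ.tgt t)
    (x y : Fin (w + 2)) :
    Γ.proj t x = Γ.proj t y ↔ x = y ∨ Γ.Inc x t ∧ Γ.Inc y t := by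
  rw [proj, merge_eq_iff ht]
  simp only [Inc, eq_comm]

theorem endAt_contract (s : Bool) (i : Fin e) :
    (Γ.contract t).endAt s i = Γ.proj t (Γ.endAt s (t.succAbove i)) := by
  cases s <;> rfl

theorem src_contract (i : Fin e) : (Γ.contract t).src i = Γ.proj t (Γ.src (t.succAbove i)) := rfl

theorem tgt_contract (i : Fin e) : (Γ.contract t).tgt i = Γ.proj t (Γ.tgt (t.succAbove i)) := rfl

theorem head_contract (c : Fin K) (i : Fin e) :
    (Γ.contract t).head c i = Γ.proj t (Γ.head c (t.succAbove i)) := by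
  rw [head_eq_endAt, endAt_contract]; rfl

theorem tail_contract (c : Fin K) (i : Fin e) :
    (Γ.contract t).tail c i = Γ.proj t (Γ.tail c (t.succAbove i)) := by
  rw [tail_eq_endAt, tail_eq_endAt, endAt_contract]; rfl

theorem proj_eq_of_not_inc {Γ : Graph K (w + 2) e} {t : Fin e} (ht : Γ.src t ≠ Γ.tgt t)
    {y : Fin (w + 2)} (hy : ¬ Γ.Inc y t) (x : Fin (w + 2)) :
    Γ.proj t x = Γ.proj t y ↔ x = y := by
  simp [proj_eq_iff ht, hy]

theorem proj_eq_of_inc {Γ : Graph K (w + 2) e} {t : Fin e} (ht : Γ.src t ≠ Γ.tgt t)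
    {y : Fin (w + 2)} (hy : Γ.Inc y t) (x : Fin (w + 2)) :
    Γ.proj t x = Γ.proj t y ↔ Γ.Inc x t := by
  simp only [proj_eq_iff ht, hy, and_true, or_iff_right_iff_imp]
  rintro rfl; exact hy

theorem inc_contract_of_not_inc (ht : Γ.src t ≠ Γ.tgt t) {y : Fin (w + 2)} (hy : ¬ Γ.Inc y t)
    (i : Fin e) : (Γ.contract t).Inc (Γ.proj t y) i ↔ Γ.Inc y (t.succAbove i) := by
  simp only [Inc, src_contract, tgt_contract, proj_eq_of_not_inc ht hy]

theorem inc_contract_of_inc (ht : Γ.src t ≠ Γ.tgt t) {y : Fin (w + 2)} (hy : Γ.Inc y t)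
    (i : Fin e) : (Γ.contract t).Inc (Γ.proj t y) i ↔
      Γ.Inc (Γ.src t) (t.succAbove i) ∨ Γ.Inc (Γ.tgt t) (t.succAbove i) := by
  simp only [Inc, src_contract, tgt_contract, proj_eq_of_inc ht hy]
  simp only [eq_comm]
  tauto

theorem valence_eq_of_map {e' v' : ℕ} {Γ : Graph K v e} {Γ' : Graph K v' e'} {x : Fin v}
    {y : Fin v'} (f : Fin e' → Fin e) (hf : Function.Injective f)
    (h : ∀ i, Γ'.Inc y i ↔ Γ.Inc x (f i)) (h' : ∀ a, Γ.Inc x a → ∃ i, f i = a) :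
    Γ'.valence y = Γ.valence x := by
  refine Finset.card_bij (fun i _ => f i) (by simp [h]) (fun _ _ _ _ h => hf h) ?_
  intro a ha
  obtain ⟨i, rfl⟩ := h' a (by simpa using ha)
  exact ⟨i, by simpa [h] using ha, rfl⟩

theorem valence_contract_of_not_inc (ht : Γ.src t ≠ Γ.tgt t) {y : Fin (w + 2)}
    (hy : ¬ Γ.Inc y t) : (Γ.contract t).valence (Γ.proj t y) = Γ.valence y := by
  refine valence_eq_of_map t.succAbove Fin.succAbove_right_injective
    (inc_contract_of_not_inc ht hy) fun a ha => ?_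
  exact Fin.exists_succAbove_eq (fun h => hy (h ▸ ha))

/-- No other edge joins the ends of `t`. -/
def NoParallel (Γ : Graph K v e) (t : Fin e) : Prop :=
  ∀ i, i ≠ t → ¬ (Γ.Inc (Γ.src t) i ∧ Γ.Inc (Γ.tgt t) i)

theorem tadpole_contract_iff (h0 : ∀ a, Γ.src a ≠ Γ.tgt a) (i : Fin e) :
    (Γ.contract t).src i = (Γ.contract t).tgt i ↔
      Γ.Inc (Γ.src t) (t.succAbove i) ∧ Γ.Inc (Γ.tgt t) (t.succAbove i) := by
  rw [src_contract, tgt_contract, proj_eq_iff (h0 t)]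
  have h1 := h0 (t.succAbove i)
  have h2 := h0 t
  simp only [Inc]
  grind

theorem noParallel_iff (h0 : ∀ a, Γ.src a ≠ Γ.tgt a) :
    Γ.NoParallel t ↔ ∀ i, (Γ.contract t).src i ≠ (Γ.contract t).tgt i := by
  simp only [Ne, tadpole_contract_iff h0]
  constructor
  · intro h i
    exact h _ (Fin.succAbove_ne t i)
  · intro h i hi
    obtain ⟨j, rfl⟩ := Fin.exists_succAbove_eq hi
    exact h j

/-- Each end of `t` loses the edge `t`, and no other edge is at both ends. -/
theorem valence_contract_of_inc (ht : Γ.src t ≠ Γ.tgt t) (hp : Γ.NoParallel t)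
    {y : Fin (w + 2)} (hy : Γ.Inc y t) :
    (Γ.contract t).valence (Γ.proj t y) + 2 = Γ.valence (Γ.src t) + Γ.valence (Γ.tgt t) := by
  have h1 : ∀ x, Γ.Inc x t → Γ.valence x =
      (Finset.univ.filter fun i => Γ.Inc x (t.succAbove i)).card + 1 := by
    intro x hx
    have h2 : (Finset.univ.filter fun a => Γ.Inc x a) =
        insert t ((Finset.univ.filter fun i => Γ.Inc x (t.succAbove i)).map t.succAboveEmb) := by
      ext a
      by_cases ha : a = t
      · subst ha; simp [hx]
      · obtain ⟨i, rfl⟩ := Fin.exists_succAbove_eq ha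
        simp [Fin.succAbove_ne]
    rw [valence, h2, Finset.card_insert_of_notMem, Finset.card_map]
    simp [Fin.succAbove_ne]
  rw [h1 _ (Γ.inc_src t), h1 _ (Γ.inc_tgt t), valence]
  have h3 : (Finset.univ.filter fun i => (Γ.contract t).Inc (Γ.proj t y) i) =
      (Finset.univ.filter fun i => Γ.Inc (Γ.src t) (t.succAbove i)) ∪
      (Finset.univ.filter fun i => Γ.Inc (Γ.tgt t) (t.succAbove i)) := by
    ext i
    simp [inc_contract_of_inc ht hy]
  rw [h3, Finset.card_union_of_disjoint]
  · ring
  · rw [Finset.disjoint_filter]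
    exact fun i _ h4 h5 => hp _ (Fin.succAbove_ne t i) ⟨h4, h5⟩

theorem passesIn_contract_of_not_inc (ht : Γ.src t ≠ Γ.tgt t) {y : Fin (w + 2)}
    (hy : ¬ Γ.Inc y t) (c : Fin K) :
    (Γ.contract t).PassesIn c (Γ.proj t y) ↔ Γ.PassesIn c y := by
  have h1 : ∀ a, (Γ.head c a = y → ∃ i, t.succAbove i = a) := by
    intro a ha
    exact Fin.exists_succAbove_eq
      (fun h => hy (h ▸ (inc_iff_head_or_tail c).2 (Or.inl ha)))
  have h2 : ∀ a, (Γ.tail c a = y → ∃ i, t.succAbove i = a) := by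
    intro a ha
    exact Fin.exists_succAbove_eq
      (fun h => hy (h ▸ (inc_iff_head_or_tail c).2 (Or.inr ha)))
  rw [PassesIn, PassesIn, valence_contract_of_not_inc ht hy]
  simp only [head_contract, tail_contract, proj_eq_of_not_inc ht hy]
  refine and_congr_right fun _ => and_congr ?_ ?_
  · constructor
    · rintro ⟨i, hi⟩; exact ⟨_, hi⟩
    · rintro ⟨a, ha⟩; obtain ⟨i, rfl⟩ := h1 a ha; exact ⟨i, ha⟩
  · constructor
    · rintro ⟨i, hi⟩; exact ⟨_, hi⟩
    · rintro ⟨a, ha⟩; obtain ⟨i, rfl⟩ := h2 a ha; exact ⟨i, ha⟩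

theorem passing_contract_of_not_inc (ht : Γ.src t ≠ Γ.tgt t) {y : Fin (w + 2)}
    (hy : ¬ Γ.Inc y t) : (Γ.contract t).Passing (Γ.proj t y) ↔ Γ.Passing y := by
  simp only [Passing, valence_contract_of_not_inc ht hy, passesIn_contract_of_not_inc ht hy]

theorem straight_contract_of_not_inc {Γ : Graph (k + 1) (w + 2) (e + 1)}
    {t : Fin (e + 1)} (ht : Γ.src t ≠ Γ.tgt t) {y : Fin (w + 2)}
    (hy : ¬ Γ.Inc y t) : (Γ.contract t).Straight (Γ.proj t y) ↔ Γ.Straight y := by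
  simp only [Straight, valence_contract_of_not_inc ht hy, passesIn_contract_of_not_inc ht hy]

/-- Merging two 2-valent vertices. -/
theorem edgePair_contract {x z : Fin (w + 2)} {b d : Fin e} (hxz : x ≠ z)
    (h0 : ∀ a, Γ.src a ≠ Γ.tgt a) (hz : Γ.EdgePair z t (t.succAbove b))
    (hx : Γ.EdgePair x t (t.succAbove d)) (hbd : b ≠ d) :
    (Γ.contract t).EdgePair (Γ.proj t z) b d := by
  refine ⟨hbd, fun i => ?_⟩
  rw [inc_contract_of_inc (h0 t) hz.left]
  have h1 : Γ.Inc (Γ.src t) (t.succAbove i) ∨ Γ.Inc (Γ.tgt t) (t.succAbove i) ↔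
      Γ.Inc z (t.succAbove i) ∨ Γ.Inc x (t.succAbove i) := by
    have h2 := hz.left
    have h3 := hx.left
    have h4 := h0 t
    unfold Inc at h2 h3
    rcases h2 with h2 | h2 <;> rcases h3 with h3 | h3
    · exact absurd (h3.symm.trans h2) hxz
    · rw [h2, h3]
    · rw [h2, h3, or_comm]
    · exact absurd (h3.symm.trans h2) hxz
  rw [h1, hz.2, hx.2]
  simp [Fin.succAbove_ne]

/-- With the sign `+1` for passing and `-1` for not passing, merging two 2-valent vertices
multiplies the signs: the direction of `t` enters in both factors and cancels. -/
theorem passesIn_contract_of_inc {x z : Fin (w + 2)} {b d : Fin e} (hxz : x ≠ z)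
    (h0 : ∀ a, Γ.src a ≠ Γ.tgt a) (hz : Γ.EdgePair z t (t.succAbove b))
    (hx : Γ.EdgePair x t (t.succAbove d)) (hbd : b ≠ d)
    (h0' : ∀ a, (Γ.contract t).src a ≠ (Γ.contract t).tgt a) (c : Fin K) :
    (Γ.contract t).PassesIn c (Γ.proj t z) ↔ (Γ.PassesIn c z ↔ Γ.PassesIn c x) := by
  rw [(edgePair_contract hxz h0 hz hx hbd).passesIn h0', hz.symm.passesIn h0, hx.passesIn h0,
    head_contract, tail_contract, proj_eq_of_inc (h0 t) hz.left, proj_eq_of_inc (h0 t) hz.left]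
  have h1 : ∀ y, Γ.Inc y t ↔ y = z ∨ y = x := by
    intro y
    have h2 := hz.left
    have h3 := hx.left
    have h4 := h0 t
    unfold Inc at *
    grind
  have h2 : ¬ Γ.Inc x (t.succAbove b) := by
    rw [hx.2]; simp [Fin.succAbove_ne, hbd]
  have h3 : ¬ Γ.Inc z (t.succAbove d) := by
    rw [hz.2]; simp [Fin.succAbove_ne, hbd.symm]
  have h4 : Γ.head c (t.succAbove b) ≠ x := fun h =>
    h2 ((inc_iff_head_or_tail c).2 (Or.inl h))
  have h5 : Γ.tail c (t.succAbove d) ≠ z := fun h =>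
    h3 ((inc_iff_head_or_tail c).2 (Or.inr h))
  have h6 := head_eq_iff (h0 t) c hx.left
  have h7 := head_eq_iff (h0 t) c hz.left
  have h8 := (h1 (Γ.tail c t)).1 ((inc_iff_head_or_tail c).2 (Or.inr rfl))
  rw [h1, h1, h6]
  simp only [h4, h5, or_false, false_or]
  rcases h8 with h8 | h8
  · simp [h8, hxz.symm]
  · simp [h8, hxz]
    tauto

/-! ### Connectedness and cycles -/

/-- Any two vertices are joined by a string of edges. -/
def Connected (Γ : Graph K v e) : Prop :=
  ∀ x y, Relation.EqvGen (fun x y => ∃ a, Γ.src a = x ∧ Γ.tgt a = y) x y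

theorem Connected.contract (h : Γ.Connected) : (Γ.contract t).Connected := by
  have key : ∀ x y, Relation.EqvGen (fun x y => ∃ a, Γ.src a = x ∧ Γ.tgt a = y) x y →
      Relation.EqvGen (fun x y => ∃ a, (Γ.contract t).src a = x ∧ (Γ.contract t).tgt a = y)
        (Γ.proj t x) (Γ.proj t y) := by
    intro x y hxy
    induction hxy with
    | rel x y hxy =>
      obtain ⟨a, rfl, rfl⟩ := hxy
      by_cases ha : a = t
      · subst ha
        have : Γ.proj a (Γ.src a) = Γ.proj a (Γ.tgt a) := by
          by_cases h : Γ.src a = Γ.tgt a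
          · rw [h]
          · rw [proj_eq_iff h]; exact Or.inr ⟨Γ.inc_src a, Γ.inc_tgt a⟩
        rw [this]; exact .refl _
      · obtain ⟨i, rfl⟩ := Fin.exists_succAbove_eq ha
        exact .rel _ _ ⟨i, rfl, rfl⟩
    | refl x => exact .refl _
    | symm x y _ ih => exact .symm _ _ ih
    | trans x y z _ _ ih1 ih2 => exact .trans _ _ _ ih1 ih2
  intro x y
  obtain ⟨x, rfl⟩ := proj_surjective Γ t x
  obtain ⟨y, rfl⟩ := proj_surjective Γ t y
  exact key _ _ (h x y)

theorem Connected.of_contract (ht : Γ.src t ≠ Γ.tgt t) (h : (Γ.contract t).Connected) :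
    Γ.Connected := by
  set R := fun x y => ∃ a, Γ.src a = x ∧ Γ.tgt a = y with hR
  have h1 : ∀ x, Γ.Inc x t → Relation.EqvGen R (Γ.src t) x := by
    rintro x (rfl | rfl)
    exacts [.refl _, .rel _ _ ⟨t, rfl, rfl⟩]
  have h2 : ∀ x y, Γ.proj t x = Γ.proj t y → Relation.EqvGen R x y := by
    intro x y hxy
    rcases (proj_eq_iff ht x y).1 hxy with rfl | ⟨hx, hy⟩
    exacts [.refl _, .trans _ _ _ (.symm _ _ (h1 x hx)) (h1 y hy)]
  have key : ∀ x' y', Relation.EqvGen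
      (fun x y => ∃ a, (Γ.contract t).src a = x ∧ (Γ.contract t).tgt a = y) x' y' →
      ∀ x y, Γ.proj t x = x' → Γ.proj t y = y' → Relation.EqvGen R x y := by
    intro x' y' hxy
    induction hxy with
    | rel x' y' hxy =>
      obtain ⟨a, rfl, rfl⟩ := hxy
      intro x y hx hy
      exact .trans _ _ _ (h2 _ _ hx) (.trans _ _ _ (.rel _ _ ⟨t.succAbove a, rfl, rfl⟩)
        (h2 _ _ hy.symm))
    | refl x' => intro x y hx hy; exact h2 _ _ (hx.trans hy.symm)
    | symm x' y' _ ih => intro x y hx hy; exact .symm _ _ (ih y x hy hx)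
    | trans x' y' z' _ _ ih1 ih2 =>
      intro x z hx hz
      obtain ⟨y, hy⟩ := proj_surjective Γ t y'
      exact .trans _ _ _ (ih1 x y hx hy) (ih2 y z hy hz)
  exact fun x y => key _ _ (h _ _) x y rfl rfl

/-- Doubling the pulled back rank leaves room to raise the head of `t` by one without disturbing the
strict inequalities along the other edges. In contrapositive form, a coloured cycle survives
contractions. -/
theorem Ranked.of_contract (ht : Γ.src t ≠ Γ.tgt t) {c : Fin K} (h : (Γ.contract t).Ranked c) :
    Γ.Ranked c := by
  obtain ⟨f, hf⟩ := h
  refine ⟨fun x => 2 * f (Γ.proj t x) + if x = Γ.head c t then 1 else 0, fun a => ?_⟩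
  by_cases ha : a = t
  · subst ha
    have h1 : Γ.proj a (Γ.tail c a) = Γ.proj a (Γ.head c a) := by
      rw [proj_eq_iff ht]
      exact Or.inr ⟨(inc_iff_head_or_tail c).2 (Or.inr rfl),
        (inc_iff_head_or_tail c).2 (Or.inl rfl)⟩
    simp [h1, (head_ne_tail ht c).symm]
  · obtain ⟨i, rfl⟩ := Fin.exists_succAbove_eq ha
    have := hf i
    rw [head_contract, tail_contract] at this
    dsimp only
    split_ifs <;> omega

end Graph

/-! ### Contractions in the coinvariants -/

section Cterm

variable (𝕂 : Type*) [Field 𝕂] (n : ℤ) (s : Part) {K v e w : ℕ}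

/-- The summand of the differential that is given by the contraction of `t`. -/
def cterm (Γ : Graph K (w + 2) (e + 1)) (t : Fin (e + 1)) : GraphComplex 𝕂 n s K :=
  Γ.contractSign n t • cls 𝕂 n s (Γ.contract t)

theorem cterm_of_not {Γ : Graph K (w + 2) (e + 1)} {t : Fin (e + 1)}
    (h : ¬ Admissible s (Γ.contract t)) : cterm 𝕂 n s Γ t = 0 := by
  rw [cterm, cls_of_not 𝕂 n s h, smul_zero]

theorem contract_permV_sign (Γ : Graph K (w + 2) (e + 1)) {t : Fin (e + 1)}
    (ht : Γ.src t ≠ Γ.tgt t) (σ : Equiv.Perm (Fin (w + 2))) :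
    ∃ σ', (Γ.permV σ).contract t = (Γ.contract t).permV σ' ∧
      (Γ.permV σ).contractSign n t * signV n σ' = signV n σ * Γ.contractSign n t := by
  obtain ⟨σ', h1, h2⟩ := exists_perm_succAbove σ (Γ.tgt t)
  refine ⟨σ', Graph.contract_permV ht h1, ?_⟩
  by_cases hn : Even n
  · simp [Graph.contractSign, signV, hn]
  · simp only [Graph.contractSign, signV, hn, if_false, h2, Graph.permV]
    rw [neg_one_pow_tsub (by omega), neg_one_pow_tsub (by omega)]
    simp only [pow_add]
    rcases neg_one_pow_eq_or ℤˣ (σ (Γ.tgt t) : ℕ) with h3 | h3 <;>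
      rcases neg_one_pow_eq_or ℤˣ (Γ.tgt t : ℕ) with h4 | h4 <;> simp [h3, h4, mul_comm]

theorem cterm_permV (Γ : Graph K (w + 2) (e + 1)) {t : Fin (e + 1)}
    (ht : Γ.src t ≠ Γ.tgt t) (σ : Equiv.Perm (Fin (w + 2))) :
    cterm 𝕂 n s (Γ.permV σ) t = signV n σ • cterm 𝕂 n s Γ t := by
  obtain ⟨σ', h1, h2⟩ := contract_permV_sign n Γ ht σ
  rw [cterm, h1, cls_permV, smul_smul, h2, ← smul_smul]; rfl

theorem contract_flip_sign (Γ : Graph K (w + 2) (e + 1)) {t : Fin (e + 1)}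
    (ht : Γ.src t ≠ Γ.tgt t) :
    ∃ σ', (Γ.flip t).contract t = (Γ.contract t).permV σ' ∧
      (Γ.flip t).contractSign n t * signV n σ' = signFlip n * Γ.contractSign n t := by
  obtain ⟨σ', h1, h2⟩ :=
    exists_perm_succAbove (Equiv.swap (Γ.src t) (Γ.tgt t)) ((Γ.flip t).tgt t)
  have h3 : (Γ.flip t).src t ≠ (Γ.flip t).tgt t := by simpa [Graph.flip] using ht.symm
  refine ⟨σ'⁻¹, ?_, ?_⟩
  · rw [← Graph.contract_flip_self Γ t ht, Graph.contract_permV h3 h1]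
    ext <;> simp [Graph.permV]
  by_cases hn : Even n
  · simp [Graph.contractSign, signV, signFlip, hn]
  · simp only [Graph.contractSign, signV, signFlip, hn, if_false, h2, Graph.flip, if_true,
      Equiv.swap_apply_left, Equiv.Perm.sign_swap ht, Equiv.Perm.sign_inv]
    rw [neg_one_pow_tsub (by omega), neg_one_pow_tsub (by omega)]
    simp only [pow_add]
    rcases neg_one_pow_eq_or ℤˣ (Γ.src t : ℕ) with h3 | h3 <;>
      rcases neg_one_pow_eq_or ℤˣ (Γ.tgt t : ℕ) with h4 | h4 <;> simp [h3, h4]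

theorem contractSign_flip_of_ne (Γ : Graph K (w + 2) (e + 1)) {a t : Fin (e + 1)} (hat : t ≠ a) :
    (Γ.flip a).contractSign n t = Γ.contractSign n t := by
  simp [Graph.contractSign, Graph.flip, hat]

theorem cterm_flip (Γ : Graph K (w + 2) (e + 1)) {t : Fin (e + 1)}
    (ht : Γ.src t ≠ Γ.tgt t) (a : Fin (e + 1)) :
    cterm 𝕂 n s (Γ.flip a) t = signFlip n • cterm 𝕂 n s Γ t := by
  by_cases hat : a = t
  · subst hat
    obtain ⟨σ', h1, h2⟩ := contract_flip_sign n Γ ht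
    rw [cterm, h1, cls_permV, smul_smul, h2, ← smul_smul]; rfl
  · rw [cterm, contractSign_flip_of_ne n Γ (Ne.symm hat)]
    obtain ⟨b, rfl⟩ := Fin.exists_succAbove_eq hat
    rw [Graph.contract_flip_ne, cls_flip, smul_smul, mul_comm, ← smul_smul]; rfl

theorem inc_flip (Γ : Graph K v e) (b : Fin e) (x : Fin v) (a : Fin e) :
    (Γ.flip b).Inc x a ↔ Γ.Inc x a := by
  simpa using (Γ.renames_flip b).inc x a

theorem head_flip (Γ : Graph K v e) (b : Fin e) (c : Fin K) (a : Fin e) :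
    (Γ.flip b).head c a = Γ.head c a := by
  simpa using (Γ.renames_flip b).head c a

theorem tail_flip (Γ : Graph K v e) (b : Fin e) (c : Fin K) (a : Fin e) :
    (Γ.flip b).tail c a = Γ.tail c a := by
  simpa using (Γ.renames_flip b).tail c a

theorem src_ne_tgt_flip {Γ : Graph K v e} {a : Fin e} (h : Γ.src a ≠ Γ.tgt a) (b : Fin e) :
    (Γ.flip b).src a ≠ (Γ.flip b).tgt a := by
  by_cases hab : a = b
  · simpa [Graph.flip, hab, eq_comm] using h
  · simpa [Graph.flip, hab] using h

theorem unit_smul_neg_cancel {M : Type*} [AddCommGroup M] (u : ℤˣ) {x y : M}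
    (h : u • x = -(u • y)) : x = -y := by
  rw [← smul_neg] at h
  simpa [smul_smul] using congrArg (u⁻¹ • ·) h

theorem neg_one_pow_tsub' {a b : ℕ} (h : b ≤ a) : (-1 : ℤˣ) ^ (a - b) = (-1) ^ a * (-1) ^ b := by
  rw [neg_one_pow_tsub h, pow_add]

/-- Either contraction removes `z` and leaves one edge between its neighbours: `b` in one case, `a`
in the other. The two survivors have opposite intrinsic orientations and exchanged labels. For `n`
odd the first gives the sign, for `n` even the second. -/
theorem cterm_pair_of_tgt {Γ Γ' : Graph K (w + 2) (e + 1)} {z : Fin (w + 2)} {a b : Fin (e + 1)}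
    (hsrc : Γ'.src = Γ.src) (htgt : Γ'.tgt = Γ.tgt) (h : Γ.EdgePair z a b)
    (h0 : ∀ a, Γ.src a ≠ Γ.tgt a)
    (hori : ∀ c i, i ≠ a → i ≠ b → Γ'.ori c i = Γ.ori c i)
    (hab : ∀ c, Γ.head c b = z ↔ Γ'.tail c a = z) (ha : Γ.tgt a = z) (hb : Γ.tgt b = z) :
    cterm 𝕂 n s Γ a = -cterm 𝕂 n s Γ' b := by
  obtain ⟨b', rfl⟩ := Fin.exists_succAbove_eq h.1.symm
  set b := a.succAbove b' with hbdef
  have hsa : Γ.src a ≠ z := by rw [← ha]; exact h0 a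
  have hsb : Γ.src b ≠ z := by rw [← hb]; exact h0 b
  obtain ⟨τ, h1, h2⟩ := exists_perm_succAbove (Equiv.swap a b) a
  rw [Equiv.swap_apply_left] at h1 h2
  have hτb : b.succAbove (τ b') = a := by rw [← h1, ← hbdef, Equiv.swap_apply_right]
  have hτ : ∀ i, i ≠ b' → b.succAbove (τ i) = a.succAbove i := by
    intro i hi
    rw [← h1, Equiv.swap_apply_of_ne_of_ne (Fin.succAbove_ne a i)]
    exact fun h => hi (Fin.succAbove_right_injective h)
  have hz : ∀ i, i ≠ b' → Γ.src (a.succAbove i) ≠ z ∧ Γ.tgt (a.succAbove i) ≠ z := by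
    intro i hi
    have : ¬ Γ.Inc z (a.succAbove i) := by
      rw [h.2, not_or]
      exact ⟨Fin.succAbove_ne a i, fun h => hi (Fin.succAbove_right_injective h)⟩
    simpa [Graph.Inc] using this
  have hp : ∀ x, x ≠ z → Γ.proj a x = Graph.renumber z x := by
    intro x hx
    rw [Graph.proj, ha, Graph.merge_of_ne hx]
  have hp' : ∀ x, x ≠ z → Γ'.proj b x = Graph.renumber z x := by
    intro x hx
    rw [Graph.proj, htgt, hb, Graph.merge_of_ne hx]
  have hpz : Γ.proj a z = Graph.renumber z (Γ.src a) := by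
    simp [Graph.proj, ha, Graph.merge]
  have hpz' : Γ'.proj b z = Graph.renumber z (Γ.src b) := by
    simp [Graph.proj, htgt, hb, Graph.merge, hsrc]
  -- The surviving edge is the only one whose intrinsic orientation differs; `τ` moves its label and
  -- leaves the order of the others.
  have key := cls_rename 𝕂 n s (Γ := Γ.contract a) (Γ' := Γ'.contract b) 1 τ {b'} ?_ ?_ ?_
  · rw [cterm, cterm, key, smul_smul, ← Units.neg_smul]
    congr 1
    by_cases hn : Even n
    · simp only [Graph.contractSign, signV, signE, signFlip, hn, if_true, h2, one_pow, mul_one,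
        one_mul, Equiv.Perm.sign_swap h.1]
      rw [neg_one_pow_tsub' (by omega), neg_one_pow_tsub' (by omega), pow_add]
      rcases neg_one_pow_eq_or ℤˣ (a : ℕ) with h3 | h3 <;>
        rcases neg_one_pow_eq_or ℤˣ (b : ℕ) with h4 | h4 <;> simp [h3, h4]
    · simp [Graph.contractSign, signV, signE, signFlip, hn, htgt, ha, hb]
  · intro i
    by_cases hi : i = b'
    · subst hi
      simp [Graph.src_contract, Graph.tgt_contract, hτb, hsrc, hp' _ hsa, ← hbdef, hb, hpz]
    · simp [Graph.src_contract, hi, hτ i hi, hsrc, hp _ (hz i hi).1, hp' _ (hz i hi).1]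
  · intro i
    by_cases hi : i = b'
    · subst hi
      simp [Graph.src_contract, Graph.tgt_contract, hτb, htgt, ha, hpz', ← hbdef, hp _ hsb]
    · simp [Graph.tgt_contract, hi, hτ i hi, htgt, hp _ (hz i hi).2, hp' _ (hz i hi).2]
  · intro c i
    by_cases hi : i = b'
    · subst hi
      have := hab c
      simp only [Graph.contract, hτb, Finset.mem_singleton, if_true, ← hbdef]
      simp only [Graph.head, Graph.tail, hsrc, htgt] at this
      cases h3 : Γ.ori c b <;> cases h4 : Γ'.ori c a <;> simp_all
    · simp only [Graph.contract, Finset.mem_singleton, hi, if_false, hτ i hi]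
      exact hori c _ (Fin.succAbove_ne a i) fun h => hi (Fin.succAbove_right_injective h)

/-- A vertex `z` of valence two can be contracted into either of its neighbours. The graphs `Γ` and
`Γ'` differ only in the colours at `z`. -/
theorem cterm_pair {Γ Γ' : Graph K (w + 2) (e + 1)} {z : Fin (w + 2)} {a b : Fin (e + 1)}
    (hsrc : Γ'.src = Γ.src) (htgt : Γ'.tgt = Γ.tgt) (h : Γ.EdgePair z a b)
    (h0 : ∀ a, Γ.src a ≠ Γ.tgt a)
    (hori : ∀ c i, i ≠ a → i ≠ b → Γ'.ori c i = Γ.ori c i)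
    (hab : ∀ c, Γ.head c b = z ↔ Γ'.tail c a = z) :
    cterm 𝕂 n s Γ a = -cterm 𝕂 n s Γ' b := by
  -- A flip changes both sides by the same sign, so both edges may be assumed to point intrinsically
  -- to `z`.
  have key : ∀ (Γ Γ' : Graph K (w + 2) (e + 1)) (i : Fin (e + 1)), Γ'.src = Γ.src →
      Γ'.tgt = Γ.tgt → (∀ a, Γ.src a ≠ Γ.tgt a) → (Γ.EdgePair z a b) →
      (∀ c i, i ≠ a → i ≠ b → Γ'.ori c i = Γ.ori c i) →
      (∀ c, Γ.head c b = z ↔ Γ'.tail c a = z) →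
      (Γ'.flip i).src = (Γ.flip i).src ∧ (Γ'.flip i).tgt = (Γ.flip i).tgt ∧
      (∀ a, (Γ.flip i).src a ≠ (Γ.flip i).tgt a) ∧ (Γ.flip i).EdgePair z a b ∧
      (∀ c j, j ≠ a → j ≠ b → (Γ'.flip i).ori c j = (Γ.flip i).ori c j) ∧
      (∀ c, (Γ.flip i).head c b = z ↔ (Γ'.flip i).tail c a = z) ∧
      (cterm 𝕂 n s (Γ.flip i) a = -cterm 𝕂 n s (Γ'.flip i) b →
        cterm 𝕂 n s Γ a = -cterm 𝕂 n s Γ' b) := by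
    intro Γ Γ' i hsrc htgt h0 h hori hab
    refine ⟨by simp [Graph.flip, hsrc, htgt], by simp [Graph.flip, hsrc, htgt],
      fun a => src_ne_tgt_flip (h0 a) i, ⟨h.1, fun j => by rw [inc_flip, h.2]⟩,
      fun c j h1 h2 => by simp [Graph.flip, hori c j h1 h2],
      fun c => by rw [head_flip, tail_flip, hab], fun h1 => ?_⟩
    rw [cterm_flip 𝕂 n s Γ (h0 a), cterm_flip 𝕂 n s Γ' (by rw [hsrc, htgt]; exact h0 b)] at h1
    exact unit_smul_neg_cancel _ h1
  have main : ∀ (Γ Γ' : Graph K (w + 2) (e + 1)), Γ'.src = Γ.src →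
      Γ'.tgt = Γ.tgt → (∀ a, Γ.src a ≠ Γ.tgt a) → (Γ.EdgePair z a b) →
      (∀ c i, i ≠ a → i ≠ b → Γ'.ori c i = Γ.ori c i) →
      (∀ c, Γ.head c b = z ↔ Γ'.tail c a = z) → Γ.tgt a = z →
      cterm 𝕂 n s Γ a = -cterm 𝕂 n s Γ' b := by
    intro Γ Γ' hsrc htgt h0 h hori hab ha
    rcases h.right with hb | hb
    · obtain ⟨h1, h2, h3, h4, h5, h6, h7⟩ := key Γ Γ' b hsrc htgt h0 h hori hab
      refine h7 (cterm_pair_of_tgt 𝕂 n s h1 h2 h4 h3 h5 h6 ?_ ?_)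
      · simp [Graph.flip, h.1, ha]
      · simp [Graph.flip, hb]
    · exact cterm_pair_of_tgt 𝕂 n s hsrc htgt h h0 hori hab ha hb
  rcases h.left with ha | ha
  · obtain ⟨h1, h2, h3, h4, h5, h6, h7⟩ := key Γ Γ' a hsrc htgt h0 h hori hab
    exact h7 (main _ _ h1 h2 h3 h4 h5 h6 (by simp [Graph.flip, ha]))
  · exact main _ _ hsrc htgt h0 h hori hab ha

end Cterm

end OGC

namespace OGC

/-! ### The square of the differential -/

namespace Graph

variable {K k v e w : ℕ}

/-- The conditions on admissible graphs that do not involve the colours. -/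
structure Pre (s : Part) (Γ : Graph K v e) : Prop where
  no_tadpole : ∀ a, Γ.src a ≠ Γ.tgt a
  connected : Γ.Connected
  two_le : ∀ x, 2 ≤ Γ.valence x
  gc_or_circ : match s with
    | .gc => ∃ x, 3 ≤ Γ.valence x
    | .circ => ∀ x, Γ.valence x = 2

theorem _root_.OGC.Admissible.pre {s : Part} {Γ : Graph K v e} (h : Admissible s Γ) : Γ.Pre s :=
  ⟨h.oriented.no_tadpole, h.oriented.connected, h.two_le, h.gc_or_circ⟩

theorem Pre.admissible {s : Part} {Γ : Graph K (w + 1) e} (h : Γ.Pre s) (hr : ∀ c, Γ.Ranked c)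
    (hp : ∀ x, ¬ Γ.Passing x) : Admissible s Γ :=
  ⟨⟨Nat.succ_pos _, h.no_tadpole, fun c => (hr c).no_cycle, h.connected⟩, h.two_le, hp,
    h.gc_or_circ⟩

theorem Pre.contract {s : Part} {Γ : Graph K (w + 2) (e + 1)} {t : Fin (e + 1)} (h : Γ.Pre s)
    (hp : Γ.NoParallel t) : (Γ.contract t).Pre s := by
  have ht := h.no_tadpole t
  refine ⟨(noParallel_iff h.no_tadpole).1 hp, h.connected.contract, fun x => ?_, ?_⟩
  · obtain ⟨x, rfl⟩ := proj_surjective Γ t x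
    by_cases hx : Γ.Inc x t
    · have h1 := valence_contract_of_inc ht hp hx
      have h2 := h.two_le (Γ.src t)
      have h3 := h.two_le (Γ.tgt t)
      omega
    · rw [valence_contract_of_not_inc ht hx]; exact h.two_le x
  · have h4 := h.gc_or_circ
    cases s with
    | gc =>
      obtain ⟨x, h4⟩ := h4
      refine ⟨Γ.proj t x, ?_⟩
      by_cases hx : Γ.Inc x t
      · have h1 := valence_contract_of_inc ht hp hx
        have h2 := h.two_le (Γ.src t)
        have h3 := h.two_le (Γ.tgt t)
        rcases hx with rfl | rfl <;> omega
      · rw [valence_contract_of_not_inc ht hx]; exact h4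
    | circ =>
      intro x
      obtain ⟨x, rfl⟩ := proj_surjective Γ t x
      by_cases hx : Γ.Inc x t
      · have h1 := valence_contract_of_inc ht hp hx
        rw [h4, h4] at h1
        omega
      · rw [valence_contract_of_not_inc ht hx]; exact h4 x

theorem noParallel_of_admissible {s : Part} {Γ : Graph K (w + 2) (e + 1)} {t : Fin (e + 1)}
    (h0 : ∀ a, Γ.src a ≠ Γ.tgt a) (h : Admissible s (Γ.contract t)) : Γ.NoParallel t :=
  (noParallel_iff h0).2 h.oriented.no_tadpole

end Graph

section Square

variable (𝕂 : Type*) [Field 𝕂] (n : ℤ) (s : Part) {K v e w : ℕ}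

/-- The contraction formula remains true for graphs that are zero because of their colours. A
coloured cycle survives all contractions. A passing vertex survives all contractions except those of
its two edges, and these two cancel by `cterm_pair`. Therefore the square can be expanded without
asking which single contractions are admissible. -/
theorem differential_cls_of_pre {Γ : Graph K (w + 2) (e + 1)} (h : Γ.Pre s) :
    differential 𝕂 n s K (cls 𝕂 n s Γ) = ∑ t, cterm 𝕂 n s Γ t := by
  by_cases hΓ : Admissible s Γ
  · exact differential_cls 𝕂 n s hΓ
  rw [cls_of_not 𝕂 n s hΓ, map_zero]
  by_cases hr : ∀ c, Γ.Ranked c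
  · obtain ⟨z, hz⟩ : ∃ z, Γ.Passing z := by
      by_contra hp
      push Not at hp
      exact hΓ (h.admissible hr hp)
    obtain ⟨a, b, hab⟩ := Graph.exists_edgePair hz.1
    rw [Finset.sum_eq_add_of_mem a b (Finset.mem_univ _) (Finset.mem_univ _) hab.1,
      cterm_pair 𝕂 n s rfl rfl hab h.no_tadpole (fun _ _ _ _ => rfl), neg_add_cancel]
    · intro c
      have := (hab.symm.passesIn h.no_tadpole c).1 (hz.2 c)
      exact this
    · intro t _ ht
      refine cterm_of_not 𝕂 n s fun h' => h'.not_passing (Γ.proj t z) ?_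
      rw [Graph.passing_contract_of_not_inc (h.no_tadpole t)]
      · exact hz
      · rw [hab.2, not_or]; exact ht
  · rw [Finset.sum_eq_zero]
    intro t _
    refine cterm_of_not 𝕂 n s fun h' => hr fun c => ?_
    exact (h'.oriented.ranked c).of_contract (h.no_tadpole t)

/-- When two elements are removed one after the other, the larger one is shifted by one exactly if
it is removed second. So the two orders give opposite signs. -/
theorem sign_removal_swap {m : ℕ} (i : Fin (m + 2)) (j : Fin (m + 1)) :
    (-1 : ℤˣ) ^ (m + 1 - (i : ℕ)) * (-1) ^ (m - (j : ℕ)) =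
      -((-1) ^ (m + 1 - (i.succAbove j : ℕ)) * (-1) ^ (m - (j.predAbove i : ℕ))) := by
  rw [neg_one_pow_tsub' (by omega), neg_one_pow_tsub' (by omega), neg_one_pow_tsub' (by omega),
    neg_one_pow_tsub' (by omega)]
  rcases Fin.lt_or_le j.castSucc i with h | h
  · rw [Fin.succAbove_of_castSucc_lt _ _ h, Fin.predAbove_of_castSucc_lt _ _ h]
    obtain ⟨i, rfl⟩ := Fin.exists_succ_eq.2 (Fin.ne_zero_of_lt h)
    simp only [Fin.val_succ, Fin.pred_succ, Fin.val_castSucc, pow_succ]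
    rcases neg_one_pow_eq_or ℤˣ (i : ℕ) with h3 | h3 <;>
      rcases neg_one_pow_eq_or ℤˣ (j : ℕ) with h4 | h4 <;> simp [h3, h4]
  · rw [Fin.succAbove_of_le_castSucc _ _ h, Fin.predAbove_of_le_castSucc _ _ h]
    simp only [Fin.val_succ, Fin.coe_castPred, pow_succ]
    rcases neg_one_pow_eq_or ℤˣ (i : ℕ) with h3 | h3 <;>
      rcases neg_one_pow_eq_or ℤˣ (j : ℕ) with h4 | h4 <;> simp [h3, h4]

theorem renumber_renumber {p y : Fin (w + 3)} {q : Fin (w + 2)} (hp : y ≠ p)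
    (hq : y ≠ p.succAbove q) :
    Graph.renumber (q.predAbove p) (Graph.renumber (p.succAbove q) y) =
      Graph.renumber q (Graph.renumber p y) := by
  obtain ⟨y, rfl⟩ := Fin.exists_succAbove_eq hp
  have hy : y ≠ q := fun h => hq (by rw [h])
  obtain ⟨y, rfl⟩ := Fin.exists_succAbove_eq hy
  rw [Graph.renumber_succAbove, Graph.renumber_succAbove,
    ← Fin.succAbove_succAbove_succAbove_predAbove, Graph.renumber_succAbove,
    Graph.renumber_succAbove]

/-- The summand of the square of the differential for two successive contractions. -/
def cterm₂ (Γ : Graph K (w + 3) (e + 2)) (i : Fin (e + 2)) (j : Fin (e + 1)) :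
    GraphComplex 𝕂 n s K :=
  Γ.contractSign n i • cterm 𝕂 n s (Γ.contract i) j

theorem cterm₂_flip {Γ : Graph K (w + 3) (e + 2)} {i : Fin (e + 2)} {j : Fin (e + 1)}
    (hi : Γ.src i ≠ Γ.tgt i) (hj : (Γ.contract i).src j ≠ (Γ.contract i).tgt j)
    (a : Fin (e + 2)) :
    cterm₂ 𝕂 n s (Γ.flip a) i j = signFlip n • cterm₂ 𝕂 n s Γ i j := by
  unfold cterm₂
  by_cases hai : a = i
  · subst hai
    obtain ⟨σ', h1, h2⟩ := contract_flip_sign n Γ hi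
    rw [h1, cterm_permV 𝕂 n s _ hj, smul_smul, h2, ← smul_smul]
  · rw [contractSign_flip_of_ne n Γ (Ne.symm hai)]
    obtain ⟨b, rfl⟩ := Fin.exists_succAbove_eq hai
    rw [Graph.contract_flip_ne, cterm_flip 𝕂 n s _ hj, smul_smul, mul_comm, ← smul_smul]

/-- Under these hypotheses the two contractions remove different vertices, and neither of these is
the vertex into which the other is merged. The two results are then equal as labelled graphs, so
only the signs have to be compared. -/
theorem cterm₂_swap_of_disjoint {Γ : Graph K (w + 3) (e + 2)} {i : Fin (e + 2)}
    {j : Fin (e + 1)} (h0 : ∀ a, Γ.src a ≠ Γ.tgt a)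
    (h1 : Γ.tgt i ≠ Γ.tgt (i.succAbove j)) (h2 : Γ.src i ≠ Γ.tgt (i.succAbove j))
    (h3 : Γ.src (i.succAbove j) ≠ Γ.tgt i) :
    cterm₂ 𝕂 n s Γ i j = -cterm₂ 𝕂 n s Γ (i.succAbove j) (j.predAbove i) := by
  set p := Γ.tgt i with hp
  obtain ⟨q, hq⟩ := Fin.exists_succAbove_eq h1.symm
  have hij : (i.succAbove j).succAbove (j.predAbove i) = i := Fin.succAbove_succAbove_predAbove i j
  have hpq : (p.succAbove q).succAbove (q.predAbove p) = p := Fin.succAbove_succAbove_predAbove p q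
  have ht1 : (Γ.contract i).tgt j = q := by
    rw [Graph.tgt_contract, ← hq, Graph.proj, ← hp, Graph.merge_of_ne (Fin.succAbove_ne p q),
      Graph.renumber_succAbove]
  have ht2 : (Γ.contract (i.succAbove j)).tgt (j.predAbove i) = q.predAbove p := by
    rw [Graph.tgt_contract, hij, Graph.proj, ← hq, ← hp, Graph.merge_of_ne (by rw [hq]; exact h1)]
    have := Graph.renumber_succAbove (p.succAbove q) (q.predAbove p)
    rwa [hpq] at this
  have hs1 : (Γ.contract i).src j = Graph.renumber p (Γ.src (i.succAbove j)) := by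
    rw [Graph.src_contract, Graph.proj, ← hp, Graph.merge_of_ne h3]
  have hs2 : (Γ.contract (i.succAbove j)).src (j.predAbove i) =
      Graph.renumber (p.succAbove q) (Γ.src i) := by
    rw [Graph.src_contract, hij, Graph.proj, ← hq, Graph.merge_of_ne (by rw [hq]; exact h2)]
  have hproj : ∀ x, (Γ.contract i).proj j (Γ.proj i x) =
      (Γ.contract (i.succAbove j)).proj (j.predAbove i) (Γ.proj (i.succAbove j) x) := by
    have hpq' : p.succAbove q ≠ p := Fin.succAbove_ne p q
    have hr1 : Graph.renumber p (p.succAbove q) = q := Graph.renumber_succAbove p q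
    have hr2 : Graph.renumber (p.succAbove q) p = q.predAbove p := by
      have := Graph.renumber_succAbove (p.succAbove q) (q.predAbove p)
      rwa [hpq] at this
    have e1 : ∀ y, y ≠ p → y ≠ p.succAbove q → Graph.renumber p y ≠ q := by
      intro y h4 h5 h6
      rw [← hr1, Graph.renumber_inj h4 hpq'] at h6
      exact h5 h6
    have e2 : ∀ y, y ≠ p → y ≠ p.succAbove q →
        Graph.renumber (p.succAbove q) y ≠ q.predAbove p := by
      intro y h4 h5 h6
      rw [← hr2, Graph.renumber_inj h5 hpq'.symm] at h6
      exact h4 h6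
    intro x
    have hq2 : Γ.src i ≠ p.succAbove q := by rw [hq]; exact h2
    have hq1 : Γ.src i ≠ p := h0 i
    have hq3 : Γ.src (i.succAbove j) ≠ p.succAbove q := by rw [hq]; exact h0 _
    simp only [Graph.proj, ht1, ht2, hs1, hs2, ← hq, ← hp]
    by_cases hx1 : x = p
    · subst hx1
      rw [Graph.merge_of_ne hpq'.symm, hr2]
      simp only [Graph.merge, if_true, if_neg (e1 _ hq1 hq2)]
      exact (renumber_renumber hq1 hq2).symm
    by_cases hx2 : x = p.succAbove q
    · subst hx2
      rw [Graph.merge_of_ne hpq', hr1]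
      simp only [Graph.merge, if_true, if_neg (e2 _ h3 hq3)]
      exact (renumber_renumber h3 hq3).symm
    · rw [Graph.merge_of_ne hx1, Graph.merge_of_ne hx2, Graph.merge_of_ne (e1 x hx1 hx2),
        Graph.merge_of_ne (e2 x hx1 hx2)]
      exact (renumber_renumber hx1 hx2).symm
  have hgr : (Γ.contract i).contract j =
      (Γ.contract (i.succAbove j)).contract (j.predAbove i) := by
    have h4 := Fin.succAbove_succAbove_succAbove_predAbove i j
    ext a b
    · simp only [Graph.src_contract, h4, hproj]
    · simp only [Graph.tgt_contract, h4, hproj]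
    · simp only [Graph.contract, h4]
  rw [cterm₂, cterm₂, cterm, cterm, hgr, smul_smul, smul_smul, ← Units.neg_smul]
  congr 1
  by_cases hn : Even n
  · simp only [Graph.contractSign, hn, if_true]
    exact sign_removal_swap i j
  · simp only [Graph.contractSign, hn, if_false, ht1, ht2, ← hq]
    exact sign_removal_swap p q

/-- Flips change both sides by the same sign. If the two edges share a vertex, orient both away from
it; their other ends differ because the edges are not parallel. This reduces everything to
`cterm₂_swap_of_disjoint`. -/
theorem cterm₂_swap {Γ : Graph K (w + 3) (e + 2)} {i : Fin (e + 2)}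
    {j : Fin (e + 1)} (h0 : ∀ a, Γ.src a ≠ Γ.tgt a)
    (hj : (Γ.contract i).src j ≠ (Γ.contract i).tgt j) :
    cterm₂ 𝕂 n s Γ i j = -cterm₂ 𝕂 n s Γ (i.succAbove j) (j.predAbove i) := by
  have hij : (i.succAbove j).succAbove (j.predAbove i) = i := Fin.succAbove_succAbove_predAbove i j
  have hne : i.succAbove j ≠ i := Fin.succAbove_ne i j
  have key : ∀ (Γ : Graph K (w + 3) (e + 2)) (a : Fin (e + 2)), (∀ a, Γ.src a ≠ Γ.tgt a) →
      (Γ.contract i).src j ≠ (Γ.contract i).tgt j →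
      cterm₂ 𝕂 n s (Γ.flip a) i j =
        -cterm₂ 𝕂 n s (Γ.flip a) (i.succAbove j) (j.predAbove i) →
      cterm₂ 𝕂 n s Γ i j = -cterm₂ 𝕂 n s Γ (i.succAbove j) (j.predAbove i) := by
    intro Γ a h0 hj h
    have hj' : (Γ.contract (i.succAbove j)).src (j.predAbove i) ≠
        (Γ.contract (i.succAbove j)).tgt (j.predAbove i) := by
      rw [Ne, Graph.tadpole_contract_iff h0] at hj ⊢
      rw [hij]
      have h1 := h0 i
      have h2 := h0 (i.succAbove j)
      simp only [Graph.Inc] at *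
      grind
    rw [cterm₂_flip 𝕂 n s (h0 i) hj, cterm₂_flip 𝕂 n s (h0 _) hj'] at h
    exact unit_smul_neg_cancel _ h
  have hfl : ∀ (Γ : Graph K (w + 3) (e + 2)) (a : Fin (e + 2)), (∀ a, Γ.src a ≠ Γ.tgt a) →
      (Γ.contract i).src j ≠ (Γ.contract i).tgt j →
      (∀ b, (Γ.flip a).src b ≠ (Γ.flip a).tgt b) ∧
      ((Γ.flip a).contract i).src j ≠ ((Γ.flip a).contract i).tgt j := by
    intro Γ a h0 hj
    have h0' := fun b => src_ne_tgt_flip (h0 b) a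
    refine ⟨h0', ?_⟩
    rw [Ne, Graph.tadpole_contract_iff h0] at hj
    rw [Ne, Graph.tadpole_contract_iff h0', inc_flip, inc_flip]
    by_cases ha : i = a
    · simpa [Graph.flip, ha, and_comm] using hj
    · simpa [Graph.flip, ha] using hj
  have main : ∀ (Γ : Graph K (w + 3) (e + 2)), (∀ a, Γ.src a ≠ Γ.tgt a) →
      (Γ.contract i).src j ≠ (Γ.contract i).tgt j → Γ.Inc (Γ.src i) (i.succAbove j) →
      cterm₂ 𝕂 n s Γ i j = -cterm₂ 𝕂 n s Γ (i.succAbove j) (j.predAbove i) := by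
    intro Γ h0 hj hx
    have main' : ∀ (Γ : Graph K (w + 3) (e + 2)), (∀ a, Γ.src a ≠ Γ.tgt a) →
        (Γ.contract i).src j ≠ (Γ.contract i).tgt j → Γ.src (i.succAbove j) = Γ.src i →
        cterm₂ 𝕂 n s Γ i j = -cterm₂ 𝕂 n s Γ (i.succAbove j) (j.predAbove i) := by
      intro Γ h0 hj hx
      rw [Ne, Graph.tadpole_contract_iff h0] at hj
      have h1 := h0 i
      have h2 := h0 (i.succAbove j)
      refine cterm₂_swap_of_disjoint 𝕂 n s h0 ?_ ?_ ?_
      · intro h; exact hj ⟨Or.inl hx, Or.inr h.symm⟩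
      · rw [← hx]; exact h2
      · rw [hx]; exact h1
    rcases hx with hx | hx
    · exact main' Γ h0 hj hx
    · obtain ⟨h1, h2⟩ := hfl Γ (i.succAbove j) h0 hj
      exact key Γ (i.succAbove j) h0 hj (main' _ h1 h2 (by simp [Graph.flip, hx, hne.symm]))
  by_cases hs : Γ.Inc (Γ.src i) (i.succAbove j)
  · exact main Γ h0 hj hs
  by_cases ht : Γ.Inc (Γ.tgt i) (i.succAbove j)
  · obtain ⟨h1, h2⟩ := hfl Γ i h0 hj
    exact key Γ i h0 hj (main _ h1 h2 (by rw [inc_flip]; simpa [Graph.flip] using ht))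
  · simp only [Graph.Inc, not_or] at hs ht
    exact cterm₂_swap_of_disjoint 𝕂 n s h0 (Ne.symm ht.2) (Ne.symm hs.2) ht.1

/-- If some edge is parallel to `i`, the contraction of `i` has a tadpole and is zero. This tadpole
survives the contraction of every other edge, so the summands on the right vanish as well. -/
theorem differential_cls_contract {Γ : Graph K (w + 3) (e + 2)} (h : Γ.Pre s) (i : Fin (e + 2)) :
    Γ.contractSign n i • differential 𝕂 n s K (cls 𝕂 n s (Γ.contract i)) =
      ∑ j, if (Γ.contract i).src j = (Γ.contract i).tgt j then 0 else cterm₂ 𝕂 n s Γ i j := by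
  by_cases hi : Γ.NoParallel i
  · rw [differential_cls_of_pre 𝕂 n s (h.contract hi), Finset.smul_sum]
    refine Finset.sum_congr rfl fun j _ => ?_
    rw [if_neg ((Graph.noParallel_iff h.no_tadpole).1 hi j)]; rfl
  · rw [cls_of_not 𝕂 n s fun h' => hi (Graph.noParallel_of_admissible h.no_tadpole h'), map_zero,
      smul_zero]
    rw [Graph.noParallel_iff h.no_tadpole] at hi
    push Not at hi
    obtain ⟨l, hl⟩ := hi
    symm
    refine Finset.sum_eq_zero fun j _ => ?_
    split_ifs with hj
    · rfl
    have hlj : l ≠ j := fun h => hj (h ▸ hl)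
    obtain ⟨l, rfl⟩ := Fin.exists_succAbove_eq hlj
    rw [cterm₂, cterm_of_not, smul_zero]
    intro h'
    refine h'.oriented.no_tadpole l ?_
    rw [Graph.src_contract, Graph.tgt_contract, hl]

theorem differential_comp_differential :
    differential 𝕂 n s K ∘ₗ differential 𝕂 n s K = 0 := by
  refine LinearMap.ext_on (span_cls 𝕂 n s) ?_
  rintro x ⟨v, e, Γ, hΓ, rfl⟩
  obtain ⟨w, e, rfl, rfl⟩ := hΓ.exists_size
  rw [LinearMap.comp_apply, LinearMap.zero_apply, differential_cls 𝕂 n s hΓ, map_sum]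
  simp only [map_unit_smul]
  by_cases hwe : ∃ w' e', w = w' + 1 ∧ e = e' + 1
  · obtain ⟨w, e, rfl, rfl⟩ := hwe
    simp only [differential_cls_contract 𝕂 n s hΓ.pre]
    rw [← Fintype.sum_prod_type' (f :=
      fun i j => if (Γ.contract i).src j = (Γ.contract i).tgt j then 0 else cterm₂ 𝕂 n s Γ i j)]
    have hij : ∀ (i : Fin (e + 2)) (j : Fin (e + 1)),
      (i.succAbove j).succAbove (j.predAbove i) = i := Fin.succAbove_succAbove_predAbove
    have h0 := hΓ.oriented.no_tadpole
    have hsymm : ∀ (i : Fin (e + 2)) (j : Fin (e + 1)),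
        (Γ.contract (i.succAbove j)).src (j.predAbove i) =
        (Γ.contract (i.succAbove j)).tgt (j.predAbove i) ↔
        (Γ.contract i).src j = (Γ.contract i).tgt j := by
      intro i j
      rw [Graph.tadpole_contract_iff h0, Graph.tadpole_contract_iff h0, hij]
      have h1 := h0 i
      have h2 := h0 (i.succAbove j)
      simp only [Graph.Inc]
      grind
    -- The involution exchanges the order of the two contractions.
    refine Finset.sum_involution (fun p _ => (p.1.succAbove p.2, p.2.predAbove p.1)) ?_ ?_ ?_ ?_
    · rintro ⟨i, j⟩ -
      simp only [hsymm]
      split_ifs with h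
      · simp
      · rw [cterm₂_swap 𝕂 n s h0 h, neg_add_cancel]
    · rintro ⟨i, j⟩ - - h
      exact Fin.succAbove_ne i j (congrArg Prod.fst h)
    · simp
    · rintro ⟨i, j⟩ -
      have h1 := hij i j
      refine Prod.ext h1 ?_
      have h2 := hij (i.succAbove j) (j.predAbove i)
      simp only at h1 h2 ⊢
      rw [h1] at h2
      exact Fin.succAbove_right_injective h2
  · refine Finset.sum_eq_zero fun i _ => ?_
    have : ¬ Admissible s (Γ.contract i) := by
      intro h
      obtain ⟨w', e', h1, h2⟩ := h.exists_size
      exact hwe ⟨w', e', by omega, h2⟩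
    rw [cls_of_not 𝕂 n s this, map_zero, smul_zero]

theorem cls_mem_homogeneous (Γ : Graph K v e) (i : ℤ) (h : ((v : ℤ) - 1) * n + (1 - n) * e = i) :
    cls 𝕂 n s Γ ∈ homogeneous 𝕂 n s K i := by
  by_cases hΓ : Admissible s Γ
  · refine Submodule.mem_map_of_mem (Submodule.subset_span ?_)
    exact ⟨⟨(v, e), Γ, hΓ⟩, h, by simp [toChain, hΓ]⟩
  · rw [cls_of_not 𝕂 n s hΓ]; exact zero_mem _

theorem homogeneous_eq_span (i : ℤ) : homogeneous 𝕂 n s K i = Submodule.span 𝕂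
    {x | ∃ (v e : ℕ) (Γ : Graph K v e), Admissible s Γ ∧ ((v : ℤ) - 1) * n + (1 - n) * e = i ∧
      x = cls 𝕂 n s Γ} := by
  apply le_antisymm
  · rw [homogeneous, Submodule.map_span_le]
    rintro x ⟨g, hg, rfl⟩
    refine Submodule.subset_span ⟨_, _, g.2.1, g.2.2, hg, ?_⟩
    simp [cls, toChain, g.2.2]
  · rw [Submodule.span_le]
    rintro x ⟨v, e, Γ, -, h, rfl⟩
    exact cls_mem_homogeneous 𝕂 n s Γ i h

theorem unit_smul_mem {M : Type*} [AddCommGroup M] [Module 𝕂 M] {N : Submodule 𝕂 M} (u : ℤˣ)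
    {x : M} (h : x ∈ N) : u • x ∈ N := by
  rcases Int.units_eq_one_or u with rfl | rfl <;> simpa using h

theorem isDifferential : IsDifferential (homogeneous 𝕂 n s K) (differential 𝕂 n s K) := by
  refine ⟨differential_comp_differential 𝕂 n s, fun i x hx => ?_⟩
  rw [homogeneous_eq_span] at hx
  induction hx using Submodule.span_induction with
  | zero => rw [map_zero]; exact zero_mem _
  | add x y _ _ hx hy => rw [map_add]; exact add_mem hx hy
  | smul c x _ hx => rw [map_smul]; exact Submodule.smul_mem _ c hx
  | mem x hx =>
    obtain ⟨v, e, Γ, hΓ, hi, rfl⟩ := hx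
    obtain ⟨w, e, rfl, rfl⟩ := hΓ.exists_size
    rw [differential_cls 𝕂 n s hΓ]
    refine sum_mem fun t _ => unit_smul_mem 𝕂 _ (cls_mem_homogeneous 𝕂 n s _ _ ?_)
    rw [← hi]; push_cast; ring

end Square

end OGC

namespace OGC

namespace Graph

variable {K k v e w : ℕ}

/-! ### Reversing the last colour -/

section ReverseLast

variable (S : Finset (Fin v)) (Γ : Graph (k + 1) v e)

theorem inc_reverseLast (x : Fin v) (a : Fin e) : (Γ.reverseLast S).Inc x a ↔ Γ.Inc x a := Iff.rfl

theorem valence_reverseLast (x : Fin v) : (Γ.reverseLast S).valence x = Γ.valence x := rfl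

theorem ori_castSucc_reverseLast (c : Fin k) (a : Fin e) :
    (Γ.reverseLast S).ori c.castSucc a = Γ.ori c.castSucc a := by
  simp [reverseLast, (Fin.castSucc_lt_last c).ne]

theorem ori_last_reverseLast (a : Fin e) :
    (Γ.reverseLast S).ori (Fin.last k) a =
      if ∃ z ∈ S, Γ.Inc z a then !Γ.ori (Fin.last k) a else Γ.ori (Fin.last k) a := by
  simp [reverseLast]

theorem head_castSucc_reverseLast (c : Fin k) (a : Fin e) :
    (Γ.reverseLast S).head c.castSucc a = Γ.head c.castSucc a := by
  simp only [head, ori_castSucc_reverseLast]; rfl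

theorem tail_castSucc_reverseLast (c : Fin k) (a : Fin e) :
    (Γ.reverseLast S).tail c.castSucc a = Γ.tail c.castSucc a := by
  simp only [tail, ori_castSucc_reverseLast]; rfl

variable {S Γ}

theorem head_last_reverseLast_of_inc {a : Fin e} (h : ∃ z ∈ S, Γ.Inc z a) :
    (Γ.reverseLast S).head (Fin.last k) a = Γ.tail (Fin.last k) a := by
  simp only [head, tail, ori_last_reverseLast, if_pos h]
  cases Γ.ori (Fin.last k) a <;> rfl

theorem tail_last_reverseLast_of_inc {a : Fin e} (h : ∃ z ∈ S, Γ.Inc z a) :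
    (Γ.reverseLast S).tail (Fin.last k) a = Γ.head (Fin.last k) a := by
  simp only [head, tail, ori_last_reverseLast, if_pos h]
  cases Γ.ori (Fin.last k) a <;> rfl

theorem head_reverseLast_of_not_inc {a : Fin e} (h : ¬ ∃ z ∈ S, Γ.Inc z a) (c : Fin (k + 1)) :
    (Γ.reverseLast S).head c a = Γ.head c a := by
  simp only [head, reverseLast, h, and_false, if_false]

theorem tail_reverseLast_of_not_inc {a : Fin e} (h : ¬ ∃ z ∈ S, Γ.Inc z a) (c : Fin (k + 1)) :
    (Γ.reverseLast S).tail c a = Γ.tail c a := by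
  simp only [tail, reverseLast, h, and_false, if_false]

theorem passesIn_castSucc_reverseLast (c : Fin k) (x : Fin v) :
    (Γ.reverseLast S).PassesIn c.castSucc x ↔ Γ.PassesIn c.castSucc x := by
  simp only [PassesIn, head_castSucc_reverseLast, tail_castSucc_reverseLast, valence_reverseLast]

theorem straight_reverseLast (x : Fin v) : (Γ.reverseLast S).Straight x ↔ Γ.Straight x := by
  simp only [Straight, passesIn_castSucc_reverseLast, valence_reverseLast]

theorem Pre.reverseLast {s : Part} (h : Γ.Pre s) : (Γ.reverseLast S).Pre s :=
  ⟨h.no_tadpole, h.connected, h.two_le, h.gc_or_circ⟩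

theorem reverseLast_comm (S S' : Finset (Fin v)) (Γ : Graph (k + 1) v e) :
    (Γ.reverseLast S).reverseLast S' = (Γ.reverseLast S').reverseLast S := by
  ext c a
  · rfl
  · rfl
  · induction c using Fin.lastCases with
    | last =>
      simp only [ori_last_reverseLast, inc_reverseLast]
      by_cases h3 : ∃ z ∈ S, Γ.Inc z a <;> by_cases h4 : ∃ z ∈ S', Γ.Inc z a <;> simp [h3, h4]
    | cast c => simp only [ori_castSucc_reverseLast]

theorem reverseLast_self (S : Finset (Fin v)) (Γ : Graph (k + 1) v e) :
    (Γ.reverseLast S).reverseLast S = Γ := by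
  ext c a
  · rfl
  · rfl
  · induction c using Fin.lastCases with
    | last =>
      simp only [ori_last_reverseLast, inc_reverseLast]
      by_cases h3 : ∃ z ∈ S, Γ.Inc z a <;> simp [h3]
    | cast c => simp only [ori_castSucc_reverseLast]

theorem reverseLast_empty (Γ : Graph (k + 1) v e) : Γ.reverseLast ∅ = Γ := by
  ext c a
  · rfl
  · rfl
  · simp [reverseLast]

end ReverseLast

/-- Straight vertices whose neighbours are not straight. -/
def Isolated (Γ : Graph (k + 1) v e) (z : Fin v) : Prop :=
  Γ.Straight z ∧ ∀ a y, Γ.Inc z a → Γ.Inc y a → Γ.Straight y → y = z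

/-- Some edge joins two straight vertices. -/
def HasInner (Γ : Graph (k + 1) v e) : Prop := ∃ a, Γ.Straight (Γ.src a) ∧ Γ.Straight (Γ.tgt a)

theorem isolated_reverseLast {S : Finset (Fin v)} {Γ : Graph (k + 1) v e} (x : Fin v) :
    (Γ.reverseLast S).Isolated x ↔ Γ.Isolated x := by
  simp only [Isolated, straight_reverseLast, inc_reverseLast]

theorem hasInner_reverseLast {S : Finset (Fin v)} {Γ : Graph (k + 1) v e} :
    (Γ.reverseLast S).HasInner ↔ Γ.HasInner := by
  simp only [HasInner, straight_reverseLast]; rfl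

theorem Straight.isolated {Γ : Graph (k + 1) v e} {z : Fin v} (h : Γ.Straight z)
    (hΓ : ¬ Γ.HasInner) : Γ.Isolated z := by
  refine ⟨h, fun a y hz hy hy' => ?_⟩
  by_contra hne
  refine hΓ ⟨a, ?_⟩
  rcases hz with rfl | rfl <;> rcases hy with rfl | rfl
  · exact absurd rfl hne
  · exact ⟨h, hy'⟩
  · exact ⟨hy', h⟩
  · exact absurd rfl hne

theorem Connected.forall_of_closed {Γ : Graph K v e} (h : Γ.Connected) (P : Fin v → Prop)
    (hP : ∀ a, P (Γ.src a) ↔ P (Γ.tgt a)) {x : Fin v} (hx : P x) (y : Fin v) : P y := by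
  have key : ∀ x y, Relation.EqvGen (fun x y => ∃ a, Γ.src a = x ∧ Γ.tgt a = y) x y →
      (P x ↔ P y) := by
    intro x y hxy
    induction hxy with
    | rel x y hxy => obtain ⟨a, rfl, rfl⟩ := hxy; exact hP a
    | refl x => rfl
    | symm x y _ ih => exact ih.symm
    | trans x y z _ _ ih1 ih2 => exact ih1.trans ih2
  exact (key x y (h x y)).1 hx

/-- If all vertices of a graph in `Part.circ` were straight, each would have an outgoing edge in the
first colour, also one of maximal rank. Here `1 ≤ k` enters: with one colour every vertex of such a
graph is straight. -/
theorem exists_not_straight {s : Part} (hs : s = Part.circ → 1 ≤ k) {Γ : Graph (k + 1) v e}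
    (hΓ : Admissible s Γ) : ∃ x, ¬ Γ.Straight x := by
  cases s with
  | gc =>
    obtain ⟨x, hx⟩ := hΓ.gc_or_circ
    exact ⟨x, fun h => by have := h.1; omega⟩
  | circ =>
    by_contra h
    push Not at h
    let c : Fin k := ⟨0, hs rfl⟩
    obtain ⟨f, hf⟩ := hΓ.oriented.ranked c.castSucc
    have : Nonempty (Fin v) := ⟨⟨0, hΓ.oriented.pos⟩⟩
    obtain ⟨x, hx⟩ := Finite.exists_max f
    obtain ⟨-, -, a, ha⟩ := (h x).2 c
    have := hf a
    rw [ha] at this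
    exact absurd (hx (Γ.head c.castSucc a)) (not_le.2 this)

/-- Two 2-valent vertices joined by two edges form a whole component, but there is a vertex that is
not straight. -/
theorem noParallel_of_straight {s : Part} (hs : s = Part.circ → 1 ≤ k) {Γ : Graph (k + 1) v e}
    (hΓ : Admissible s Γ) {t : Fin e} (h1 : Γ.Straight (Γ.src t)) (h2 : Γ.Straight (Γ.tgt t)) :
    Γ.NoParallel t := by
  rintro i hi ⟨hi1, hi2⟩
  obtain ⟨b, hb⟩ := exists_edgePair_of_inc h1.1 (Γ.inc_src t)
  obtain ⟨d, hd⟩ := exists_edgePair_of_inc h2.1 (Γ.inc_tgt t)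
  have hib : i = b := ((hb.2 i).1 hi1).resolve_left hi
  have hid : i = d := ((hd.2 i).1 hi2).resolve_left hi
  subst hib
  subst hid
  obtain ⟨x, hx⟩ := exists_not_straight hs hΓ
  have hc : Γ.Connected := hΓ.oriented.connected
  have h0 := hΓ.oriented.no_tadpole
  have := hc.forall_of_closed (fun y => y = Γ.src t ∨ y = Γ.tgt t) ?_ (Or.inl rfl) x
  · rcases this with rfl | rfl
    exacts [hx h1, hx h2]
  · intro a
    have h3 := h0 t
    have h4 := h0 i
    have h5 := h0 a
    have h6 := hb.2 a
    have h7 := hd.2 a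
    unfold Inc at *
    grind

/-- The reversal turns `t` around but not the other edge at `y`. So `y`, which did not pass in the
last colour, now does and becomes a passing vertex. -/
theorem not_admissible_reverseLast {s : Part} (hs : s = Part.circ → 1 ≤ k)
    {Γ : Graph (k + 1) v e} (hΓ : Admissible s Γ) {t : Fin e} {z y : Fin v} (hyz : y ≠ z)
    (hzt : Γ.Inc z t) (hyt : Γ.Inc y t) (hz : Γ.Straight z) (hy : Γ.Straight y) :
    ¬ Admissible s (Γ.reverseLast {z}) := by
  intro h
  have h0 := hΓ.oriented.no_tadpole
  have hp : Γ.NoParallel t := by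
    apply noParallel_of_straight hs hΓ <;>
    · rcases hzt with rfl | rfl <;> rcases hyt with rfl | rfl <;>
        first | assumption | exact absurd rfl hyz
  obtain ⟨d, hd⟩ := exists_edgePair_of_inc hy.1 hyt
  have hd' : ¬ ∃ x ∈ ({z} : Finset (Fin v)), Γ.Inc x d := by
    simp only [Finset.mem_singleton, exists_eq_left]
    intro hzd
    refine hp d hd.1.symm ?_
    have := hd.right
    rcases hzt with rfl | rfl <;> rcases hyt with rfl | rfl <;>
      first | exact ⟨hzd, this⟩ | exact ⟨this, hzd⟩ | exact absurd rfl hyz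
  have hd2 : (Γ.reverseLast {z}).EdgePair y t d := hd
  have h1 := ((straight_reverseLast (S := {z}) y).2 hy).not_passesIn_last h
  have h2 := hy.not_passesIn_last hΓ
  rw [hd2.passesIn h0, head_last_reverseLast_of_inc ⟨z, by simp, hzt⟩,
    tail_reverseLast_of_not_inc hd'] at h1
  rw [hd.passesIn h0] at h2
  have h3 := head_eq_iff (h0 t) (Fin.last k) hd.left
  tauto

/-- In the last colour `z` is a source or a sink before and after the reversal, so no cycle goes
through it. The other straight vertices lie on no reversed edge, and vertices that are not straight
cannot be passing. -/
theorem admissible_reverseLast_singleton {s : Part} {Γ : Graph (k + 1) v e}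
    (hΓ : Admissible s Γ) {z : Fin v} (hz : Γ.Isolated z) : Admissible s (Γ.reverseLast {z}) := by
  obtain ⟨w, e, rfl, rfl⟩ := hΓ.exists_size
  have h0 := hΓ.oriented.no_tadpole
  have hinc : ∀ a, (∃ x ∈ ({z} : Finset _), Γ.Inc x a) ↔ Γ.Inc z a := by simp
  have hzl : ¬ (Γ.reverseLast {z}).PassesIn (Fin.last k) z := by
    intro h
    obtain ⟨a, b, hab⟩ := exists_edgePair hz.1.1
    have h2 := hz.1.not_passesIn_last hΓ
    have hab' : (Γ.reverseLast {z}).EdgePair z a b := hab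
    rw [hab'.passesIn h0, head_last_reverseLast_of_inc ((hinc a).2 hab.left),
      tail_last_reverseLast_of_inc ((hinc b).2 hab.right)] at h
    rw [hab.passesIn h0] at h2
    have h3 := head_eq_iff (h0 a) (Fin.last k) hab.left
    have h4 := head_eq_iff (h0 b) (Fin.last k) hab.right
    tauto
  refine hΓ.pre.reverseLast.admissible (fun c => ?_) (fun x hx => ?_)
  · obtain ⟨f, hf⟩ := hΓ.oriented.ranked c
    induction c using Fin.lastCases with
    | last =>
      refine ranked_of_extremal z ((not_passesIn_iff ?_ _).1 hzl) ⟨f, fun a ha => ?_⟩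
      · exact hz.1.1
      · have ha' : ¬ ∃ x ∈ ({z} : Finset _), Γ.Inc x a := by rw [hinc]; exact ha
        rw [head_reverseLast_of_not_inc ha', tail_reverseLast_of_not_inc ha']
        exact hf a
    | cast c =>
      exact ⟨f, fun a => by rw [head_castSucc_reverseLast, tail_castSucc_reverseLast]; exact hf a⟩
  · have hxs : Γ.Straight x := (straight_reverseLast x).1 hx.straight
    by_cases hxz : x = z
    · subst hxz; exact hzl (hx.2 _)
    · have hne : ∀ a, Γ.Inc x a → ¬ ∃ y ∈ ({z} : Finset _), Γ.Inc y a := by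
        intro a hxa
        rw [hinc]
        exact fun hza => hxz (hz.2 a x hza hxa hxs)
      obtain ⟨a, b, hab⟩ := exists_edgePair hxs.1
      have hab' : (Γ.reverseLast {z}).EdgePair x a b := hab
      have h1 := hx.2 (Fin.last k)
      rw [hab'.passesIn h0, head_reverseLast_of_not_inc (hne a hab.left),
        tail_reverseLast_of_not_inc (hne b hab.right)] at h1
      exact hxs.not_passesIn_last hΓ ((hab.passesIn h0 _).2 h1)

/-- For isolated vertices, the reversals of the last colour compose like symmetric differences. -/
theorem reverseLast_symmDiff {Γ : Graph (k + 1) v e} {S S' : Finset (Fin v)}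
    (h : ∀ z ∈ S, Γ.Isolated z) (h' : ∀ z ∈ S', Γ.Isolated z) :
    (Γ.reverseLast S').reverseLast S = Γ.reverseLast (symmDiff S S') := by
  -- An edge meets at most one isolated vertex, so the reversals by `S` and by `S'` add up modulo 2.
  have key : ∀ a, (∃ z ∈ symmDiff S S', Γ.Inc z a) ↔
      Xor (∃ z ∈ S, Γ.Inc z a) (∃ z ∈ S', Γ.Inc z a) := by
    intro a
    have h1 : ∀ z, Γ.Isolated z → Γ.Inc z a → ∀ y, Γ.Isolated y → Γ.Inc y a → y = z :=
      fun z hz hza y hy hya => hz.2 a y hza hya hy.1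
    simp only [Finset.mem_symmDiff, Xor]
    constructor
    · rintro ⟨z, hz | hz, hza⟩
      · refine Or.inl ⟨⟨z, hz.1, hza⟩, ?_⟩
        rintro ⟨y, hy, hya⟩
        exact hz.2 (h1 z (h z hz.1) hza y (h' y hy) hya ▸ hy)
      · refine Or.inr ⟨⟨z, hz.1, hza⟩, ?_⟩
        rintro ⟨y, hy, hya⟩
        exact hz.2 (h1 z (h' z hz.1) hza y (h y hy) hya ▸ hy)
    · rintro (⟨⟨z, hz, hza⟩, hn⟩ | ⟨⟨z, hz, hza⟩, hn⟩)
      · exact ⟨z, Or.inl ⟨hz, fun hz' => hn ⟨z, hz', hza⟩⟩, hza⟩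
      · exact ⟨z, Or.inr ⟨hz, fun hz' => hn ⟨z, hz', hza⟩⟩, hza⟩
  ext c a
  · rfl
  · rfl
  · have h2 : ∀ z, (Γ.reverseLast S').Inc z a ↔ Γ.Inc z a := fun z => Iff.rfl
    induction c using Fin.lastCases with
    | last =>
      rw [ori_last_reverseLast, ori_last_reverseLast, ori_last_reverseLast]
      simp only [h2, key, Xor]
      by_cases h3 : ∃ z ∈ S, Γ.Inc z a <;> by_cases h4 : ∃ z ∈ S', Γ.Inc z a <;> simp [h3, h4]
    | cast c => simp only [ori_castSucc_reverseLast]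

theorem admissible_reverseLast {s : Part} {Γ : Graph (k + 1) v e} (hΓ : Admissible s Γ)
    {S : Finset (Fin v)} (hS : ∀ z ∈ S, Γ.Isolated z) : Admissible s (Γ.reverseLast S) := by
  induction S using Finset.induction_on with
  | empty => rw [reverseLast_empty]; exact hΓ
  | insert z S hz ih =>
    have h1 : symmDiff {z} S = insert z S := by
      rw [(Finset.disjoint_singleton_left.2 hz).symmDiff_eq_sup]; rfl
    rw [← h1, ← reverseLast_symmDiff]
    · refine admissible_reverseLast_singleton (ih fun y hy => hS y (Finset.mem_insert_of_mem hy)) ?_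
      rw [isolated_reverseLast]
      exact hS z (Finset.mem_insert_self _ _)
    · intro y hy
      rw [Finset.mem_singleton.1 hy]
      exact hS z (Finset.mem_insert_self _ _)
    · exact fun y hy => hS y (Finset.mem_insert_of_mem hy)

/-! ### Skeleton edges of admissible graphs -/

section Skeleton

variable {s : Part} {Γ : Graph (k + 1) v e}

theorem mem_skeletonEdge (hΓ : Admissible s Γ) (a b : Fin e) : b ∈ Γ.skeletonEdge a ↔
    Relation.EqvGen (fun a b => ∃ z, Γ.Straight z ∧ Γ.Inc z a ∧ Γ.Inc z b) a b := by
  simp only [skeletonEdge, Finset.mem_filter, Finset.mem_univ, true_and, weaklyPassing_iff hΓ]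

theorem skeletonEdge_subset (hΓ : Admissible s Γ) {a : Fin e} (P : Finset (Fin e)) (ha : a ∈ P)
    (hP : ∀ z i j, Γ.Straight z → Γ.Inc z i → Γ.Inc z j → i ∈ P → j ∈ P) :
    Γ.skeletonEdge a ⊆ P := by
  intro b hb
  rw [mem_skeletonEdge hΓ] at hb
  have key : ∀ a b, Relation.EqvGen (fun a b => ∃ z, Γ.Straight z ∧ Γ.Inc z a ∧ Γ.Inc z b) a b →
      (a ∈ P ↔ b ∈ P) := by
    intro a b hab
    induction hab with
    | rel x y hxy =>
      obtain ⟨z, hz, hx, hy⟩ := hxy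
      exact ⟨hP z x y hz hx hy, hP z y x hz hy hx⟩
    | refl x => rfl
    | symm x y _ ih => exact ih.symm
    | trans x y z _ _ ih1 ih2 => exact ih1.trans ih2
  exact (key a b hb).1 ha

theorem skeletonLength_of_isolated (hΓ : Admissible s Γ) {z : Fin v} (hz : Γ.Isolated z)
    {a : Fin e} (ha : Γ.Inc z a) : Γ.skeletonLength a = 2 := by
  obtain ⟨b, hab⟩ := exists_edgePair_of_inc hz.1.1 ha
  rw [skeletonLength, ← Finset.card_pair hab.1]
  congr 1
  apply Finset.Subset.antisymm
  · refine skeletonEdge_subset hΓ _ (by simp) fun y i j hy hi hj h => ?_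
    simp only [Finset.mem_insert, Finset.mem_singleton, ← hab.2] at h ⊢
    rwa [hz.2 i y h hi hy] at hj
  · intro i hi
    rw [mem_skeletonEdge hΓ]
    simp only [Finset.mem_insert, Finset.mem_singleton, ← hab.2] at hi
    exact .rel _ _ ⟨z, hz.1, ha, hi⟩

theorem three_le_skeletonLength (hs : s = Part.circ → 1 ≤ k) (hΓ : Admissible s Γ) {a : Fin e}
    (h1 : Γ.Straight (Γ.src a)) (h2 : Γ.Straight (Γ.tgt a)) : 3 ≤ Γ.skeletonLength a := by
  obtain ⟨b, hb⟩ := exists_edgePair_of_inc h1.1 (Γ.inc_src a)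
  obtain ⟨d, hd⟩ := exists_edgePair_of_inc h2.1 (Γ.inc_tgt a)
  have hbd : b ≠ d := by
    rintro rfl
    exact noParallel_of_straight hs hΓ h1 h2 b hb.1.symm ⟨hb.right, hd.right⟩
  rw [skeletonLength, ← Finset.card_eq_three.2 ⟨a, b, d, hb.1, hd.1, hbd, rfl⟩]
  apply Finset.card_le_card
  intro i hi
  rw [mem_skeletonEdge hΓ]
  simp only [Finset.mem_insert, Finset.mem_singleton] at hi
  rcases hi with rfl | rfl | rfl
  · exact .refl _
  · exact .rel _ _ ⟨_, h1, hb.left, hb.right⟩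
  · exact .rel _ _ ⟨_, h2, hd.left, hd.right⟩

/-- An edge with two straight ends continues beyond both of them, so its skeleton edge has length at
least 3. From here on, lengths of skeleton edges are replaced by adjacency of straight vertices,
expressed by `Isolated` and `HasInner`. -/
theorem mem_middles (hs : s = Part.circ → 1 ≤ k) (hΓ : Admissible s Γ) (z : Fin v) :
    z ∈ Γ.middles ↔ Γ.Isolated z := by
  simp only [middles, Finset.mem_filter, Finset.mem_univ, true_and, weaklyPassing_iff hΓ]
  constructor
  · rintro ⟨hz, h⟩
    refine ⟨hz, fun a y hza hya hy => ?_⟩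
    by_contra hyz
    have h3 : 3 ≤ Γ.skeletonLength a := by
      apply three_le_skeletonLength hs hΓ <;>
      · rcases hza with rfl | rfl <;> rcases hya with rfl | rfl <;>
          first | assumption | exact absurd rfl hyz
    have := h a hza
    omega
  · intro hz
    exact ⟨hz.1, fun a ha => skeletonLength_of_isolated hΓ hz ha⟩

theorem exists_three_le_iff (hs : s = Part.circ → 1 ≤ k) (hΓ : Admissible s Γ) :
    (∃ a, 3 ≤ Γ.skeletonLength a) ↔ Γ.HasInner := by
  constructor
  · rintro ⟨a, ha⟩
    by_contra h
    by_cases h1 : ∃ z, Γ.Straight z ∧ Γ.Inc z a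
    · obtain ⟨z, hz, hza⟩ := h1
      have := skeletonLength_of_isolated hΓ (hz.isolated h) hza
      omega
    · have h2 : Γ.skeletonEdge a ⊆ {a} := by
        refine skeletonEdge_subset hΓ _ (by simp) fun y i j hy hi hj h => ?_
        rw [Finset.mem_singleton.1 h] at hi
        exact absurd ⟨y, hy, hi⟩ h1
      have := Finset.card_le_card h2
      rw [skeletonLength] at ha
      simp at this
      omega
  · rintro ⟨a, h1, h2⟩
    exact ⟨a, three_le_skeletonLength hs hΓ h1 h2⟩

end Skeleton

end Graph

end OGC

namespace OGC

open _root_.OGC.Graph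

/-! ### The splitting into the special and the dagger part -/

section Signs

variable (𝕂 : Type*) [Field 𝕂] {ι : Type*} [DecidableEq ι]

theorem neg_one_pow_inter (S T : Finset ι) :
    (-1 : 𝕂) ^ (S ∩ T).card = ∏ z ∈ T, if z ∈ S then -1 else 1 := by
  rw [Finset.prod_ite, Finset.prod_const, Finset.prod_const_one, mul_one,
    Finset.filter_mem_eq_inter, Finset.inter_comm]

/-- The function `S ↦ (-1) ^ (S ∩ T).card` is a character of the group of finite sets under
symmetric difference. The graph decorated by `T` is the Fourier component for this character. -/
theorem neg_one_pow_symmDiff_inter (S S' T : Finset ι) :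
    (-1 : 𝕂) ^ (symmDiff S S' ∩ T).card = (-1) ^ (S ∩ T).card * (-1) ^ (S' ∩ T).card := by
  simp only [neg_one_pow_inter, ← Finset.prod_mul_distrib]
  refine Finset.prod_congr rfl fun z _ => ?_
  by_cases h : z ∈ S <;> by_cases h' : z ∈ S' <;> simp [Finset.mem_symmDiff, h, h']

/-- Orthogonality of characters: in the product form each element of `S` gives a factor `1 - 1`. -/
theorem sum_neg_one_pow_inter {S M : Finset ι} (h : S ⊆ M) :
    ∑ T ∈ M.powerset, (-1 : 𝕂) ^ (S ∩ T).card = if S = ∅ then 2 ^ M.card else 0 := by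
  simp only [neg_one_pow_inter]
  rw [← Finset.prod_one_add]
  split_ifs with hS
  · subst hS
    simp only [Finset.notMem_empty, if_false, Finset.prod_const]
    norm_num
  · obtain ⟨z, hz⟩ := Finset.nonempty_iff_ne_empty.2 hS
    exact Finset.prod_eq_zero (h hz) (by simp [hz])

theorem neg_one_pow_mul_self (m : ℕ) : (-1 : 𝕂) ^ m * (-1) ^ m = 1 := by
  rw [← mul_pow]; simp

end Signs

section Decorated

variable (𝕂 : Type*) [Field 𝕂] (n : ℤ) (s : Part) {k v e : ℕ}

variable (k) in
/-- The subspace in which reversing the last colour at a straight vertex has the sign `-1`. -/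
def cross : Submodule 𝕂 (GraphComplex 𝕂 n s (k + 1)) :=
  Submodule.span 𝕂 {x | ∃ (v e : ℕ) (Γ : Graph (k + 1) v e) (z : Fin v), Admissible s Γ ∧
    Γ.Straight z ∧ x = cls 𝕂 n s Γ + cls 𝕂 n s (Γ.reverseLast {z})}

theorem add_mem_cross {Γ : Graph (k + 1) v e} {z : Fin v} (hz : Γ.Straight z) :
    cls 𝕂 n s Γ + cls 𝕂 n s (Γ.reverseLast {z}) ∈ cross 𝕂 n s k := by
  by_cases h : Admissible s Γ
  · exact Submodule.subset_span ⟨v, e, Γ, z, h, hz, rfl⟩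
  by_cases h' : Admissible s (Γ.reverseLast {z})
  · refine Submodule.subset_span ⟨v, e, _, z, h', (straight_reverseLast z).2 hz, ?_⟩
    rw [reverseLast_self]
    exact add_comm _ _
  · rw [cls_of_not 𝕂 n s h, cls_of_not 𝕂 n s h', add_zero]
    exact zero_mem _

/-- Reversing at one end of an inner edge gives a graph that is zero, so the generator of `cross`
reduces to the graph alone. -/
theorem cls_mem_cross (hs : s = Part.circ → 1 ≤ k) {Γ : Graph (k + 1) v e} (h : Γ.HasInner) :
    cls 𝕂 n s Γ ∈ cross 𝕂 n s k := by
  by_cases hΓ : Admissible s Γ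
  · obtain ⟨a, h1, h2⟩ := h
    have h3 := add_mem_cross 𝕂 n s h1
    rwa [cls_of_not 𝕂 n s (not_admissible_reverseLast hs hΓ
      (hΓ.oriented.no_tadpole a).symm (Γ.inc_src a) (Γ.inc_tgt a) h1 h2), add_zero] at h3
  · rw [cls_of_not 𝕂 n s hΓ]; exact zero_mem _

theorem middles_reverseLast (hs : s = Part.circ → 1 ≤ k)
    {Γ : Graph (k + 1) v e} (hΓ : Admissible s Γ) {S : Finset (Fin v)} (hS : S ⊆ Γ.middles) :
    (Γ.reverseLast S).middles = Γ.middles := by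
  ext z
  rw [mem_middles hs hΓ, mem_middles hs (admissible_reverseLast hΓ
    fun z hz => (mem_middles hs hΓ z).1 (hS hz)), isolated_reverseLast]

/-- Substituting `symmDiff S' S` for `S'` in the defining sum shows that a decorated graph is an
eigenvector of the reversals, with a factor `-1` for each dotted edge that is reversed. -/
theorem decorated_reverseLast (hs : s = Part.circ → 1 ≤ k)
    {Γ : Graph (k + 1) v e} (hΓ : Admissible s Γ)
    {S : Finset (Fin v)} (hS : S ⊆ Γ.middles) (T : Finset (Fin v)) :
    decorated 𝕂 n s (Γ.reverseLast S) T = (-1 : 𝕂) ^ (S ∩ T).card • decorated 𝕂 n s Γ T := by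
  rw [decorated, decorated, middles_reverseLast s hs hΓ hS, smul_comm ((-1 : 𝕂) ^ (S ∩ T).card)]
  congr 1
  rw [Finset.smul_sum]
  have hsd : ∀ S' ∈ Γ.middles.powerset, symmDiff S' S ∈ Γ.middles.powerset := by
    intro S' hS'
    rw [Finset.mem_powerset] at hS' ⊢
    exact symmDiff_le_sup.trans (sup_le hS' hS)
  refine Finset.sum_bij' (fun S' _ => symmDiff S' S) (fun S' _ => symmDiff S' S) hsd hsd
    (fun S' _ => by rw [symmDiff_symmDiff_cancel_right])
    (fun S' _ => by rw [symmDiff_symmDiff_cancel_right]) fun S' hS' => ?_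
  rw [Finset.mem_powerset] at hS'
  rw [reverseLast_symmDiff (fun z hz => (mem_middles hs hΓ z).1 (hS' hz))
    (fun z hz => (mem_middles hs hΓ z).1 (hS hz)), neg_one_pow_symmDiff_inter, smul_smul]
  congr 1
  rw [mul_comm, mul_assoc, neg_one_pow_mul_self, mul_one]

/-- Fourier inversion over the subsets of the middle vertices. -/
theorem sum_decorated [CharZero 𝕂] (Γ : Graph (k + 1) v e) :
    ∑ T ∈ Γ.middles.powerset, decorated 𝕂 n s Γ T = cls 𝕂 n s Γ := by
  simp only [decorated]
  rw [← Finset.smul_sum, Finset.sum_comm]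
  have : ∀ S ∈ Γ.middles.powerset, ∑ T ∈ Γ.middles.powerset,
      (-1 : 𝕂) ^ (S ∩ T).card • cls 𝕂 n s (Γ.reverseLast S) =
      if S = ∅ then (2 : 𝕂) ^ Γ.middles.card • cls 𝕂 n s Γ else 0 := by
    intro S hS
    rw [← Finset.sum_smul, sum_neg_one_pow_inter 𝕂 (Finset.mem_powerset.1 hS)]
    split_ifs with h
    · rw [h, reverseLast_empty]
    · rw [zero_smul]
  rw [Finset.sum_congr rfl this, Finset.sum_ite_eq' , if_pos (Finset.empty_mem_powerset _),
    smul_smul, ← mul_pow]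
  norm_num

/-- With a crossed edge at `z`, the decorated graph is fixed by the reversal at `z`. So twice this
graph is a combination of generators of `cross`. -/
theorem decorated_mem_cross [CharZero 𝕂] (hs : s = Part.circ → 1 ≤ k)
    {Γ : Graph (k + 1) v e} (hΓ : Admissible s Γ)
    {T : Finset (Fin v)} (hT : T ⊆ Γ.middles)
    (h : Γ.HasInner ∨ T ≠ Γ.middles) : decorated 𝕂 n s Γ T ∈ cross 𝕂 n s k := by
  by_cases h' : Γ.HasInner
  · refine Submodule.smul_mem _ _ (sum_mem fun S _ => Submodule.smul_mem _ _ ?_)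
    exact cls_mem_cross 𝕂 n s hs (hasInner_reverseLast.2 h')
  · obtain ⟨z, hzM, hzT⟩ := Finset.exists_of_ssubset
      (Finset.ssubset_iff_subset_ne.2 ⟨hT, h.resolve_left h'⟩)
    have hz : {z} ⊆ Γ.middles := Finset.singleton_subset_iff.2 hzM
    have h1 : decorated 𝕂 n s Γ T + decorated 𝕂 n s (Γ.reverseLast {z}) T ∈ cross 𝕂 n s k := by
      rw [decorated, decorated, middles_reverseLast s hs hΓ hz, ← smul_add,
        ← Finset.sum_add_distrib]
      refine Submodule.smul_mem _ _ (sum_mem fun S _ => ?_)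
      rw [← smul_add, reverseLast_comm]
      refine Submodule.smul_mem _ _ (add_mem_cross 𝕂 n s ?_)
      rw [straight_reverseLast]
      exact ((mem_middles hs hΓ z).1 hzM).1
    rw [decorated_reverseLast 𝕂 n s hs hΓ hz, Finset.singleton_inter_of_notMem hzT,
      Finset.card_empty, pow_zero, one_smul, ← two_smul 𝕂] at h1
    exact (Submodule.smul_mem_iff _ two_ne_zero).1 h1

/-- Modulo `cross` a reversal acts by `-1`, as on dotted edges. The generators of `cross` are single
pairs of graphs, without sums over all middle vertices, which makes stability under operators easy
to check. -/
theorem dagger_eq_cross [CharZero 𝕂] (hs : s = Part.circ → 1 ≤ k) :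
    dagger 𝕂 n s k = cross 𝕂 n s k := by
  apply le_antisymm
  · rw [dagger, Submodule.span_le]
    rintro x ⟨v, e, Γ, T, hΓ, hT, h, rfl⟩
    rw [exists_three_le_iff hs hΓ] at h
    exact decorated_mem_cross 𝕂 n s hs hΓ hT h
  · rw [cross, Submodule.span_le]
    rintro x ⟨v, e, Γ, z, hΓ, hz, rfl⟩
    have hd : ∀ T ∈ Γ.middles.powerset, Γ.HasInner ∨ T ≠ Γ.middles →
        decorated 𝕂 n s Γ T ∈ dagger 𝕂 n s k := fun T hT h =>
      Submodule.subset_span ⟨v, e, Γ, T, hΓ, Finset.mem_powerset.1 hT,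
        by rwa [exists_three_le_iff hs hΓ], rfl⟩
    by_cases hi : Γ.Isolated z
    · have hzM : z ∈ Γ.middles := (mem_middles hs hΓ z).2 hi
      have hz : {z} ⊆ Γ.middles := Finset.singleton_subset_iff.2 hzM
      rw [← sum_decorated 𝕂 n s Γ, ← sum_decorated 𝕂 n s (Γ.reverseLast {z}),
        middles_reverseLast s hs hΓ hz, ← Finset.sum_add_distrib]
      refine sum_mem fun T hT => ?_
      rw [decorated_reverseLast 𝕂 n s hs hΓ hz]
      by_cases hzT : z ∈ T
      · simp [Finset.singleton_inter_of_mem hzT]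
      · have := hd T hT (Or.inr fun h => hzT (h ▸ hzM))
        exact add_mem this (Submodule.smul_mem _ _ this)
    · have h1 : ∃ a y, Γ.Inc z a ∧ Γ.Inc y a ∧ Γ.Straight y ∧ y ≠ z := by
        by_contra h
        push Not at h
        exact hi ⟨hz, h⟩
      obtain ⟨a, y, hza, hya, hy, hyz⟩ := h1
      rw [cls_of_not 𝕂 n s (not_admissible_reverseLast hs hΓ hyz hza hya hz hy), add_zero,
        ← sum_decorated 𝕂 n s Γ]
      refine sum_mem fun T hT => hd T hT (Or.inl ?_)
      by_contra hn
      exact hi (hz.isolated hn)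

theorem decorated_middles_of_equivariant {Γ Γ' : Graph (k + 1) v e} (σ : Equiv.Perm (Fin v))
    (Φ : Graph (k + 1) v e → Graph (k + 1) v e) (ε : ℤˣ) (hΦ : ∀ Γ,
      cls 𝕂 n s (Φ Γ) = ε • cls 𝕂 n s Γ)
    (hM : Γ'.middles = Γ.middles.map σ.toEmbedding)
    (hr : ∀ S, Γ'.reverseLast (S.map σ.toEmbedding) = Φ (Γ.reverseLast S)) :
    decorated 𝕂 n s Γ' Γ'.middles = ε • decorated 𝕂 n s Γ Γ.middles := by
  rw [decorated, decorated, hM, Finset.card_map, smul_comm ε]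
  congr 1
  rw [Finset.smul_sum]
  symm
  refine Finset.sum_bij (fun S _ => S.map σ.toEmbedding) ?_ ?_ ?_ ?_
  · intro S hS
    rw [Finset.mem_powerset] at hS ⊢
    exact Finset.map_subset_map.2 hS
  · intro S _ S' _ h
    exact Finset.map_injective _ h
  · intro S hS
    refine ⟨S.map σ.symm.toEmbedding, ?_, ?_⟩
    · rw [Finset.mem_powerset] at hS ⊢
      have := Finset.map_subset_map (f := σ.symm.toEmbedding).2 hS
      simpa [Finset.map_map] using this
    · simp [Finset.map_map]
  · intro S _
    rw [hr, hΦ, ← Finset.map_inter, Finset.card_map, smul_comm]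

theorem Renames.isolated_iff {σ : Equiv.Perm (Fin v)} {τ : Equiv.Perm (Fin e)}
    {Γ Γ' : Graph (k + 1) v e} (h : Renames σ τ Γ Γ') (z : Fin v) :
    Γ'.Isolated (σ z) ↔ Γ.Isolated z := by
  have key : ∀ {σ : Equiv.Perm (Fin v)} {τ : Equiv.Perm (Fin e)} {Γ Γ' : Graph (k + 1) v e}
      (_ : Renames σ τ Γ Γ') (z : Fin v), Γ.Isolated z → Γ'.Isolated (σ z) := by
    intro σ τ Γ Γ' h z hz
    refine ⟨(h.straight_iff z).2 hz.1, fun a y hza hya hy => ?_⟩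
    obtain ⟨a, rfl⟩ := τ.surjective a
    obtain ⟨y, rfl⟩ := σ.surjective y
    rw [h.inc] at hza hya
    rw [hz.2 a y hza hya ((h.straight_iff y).1 hy)]
  refine ⟨fun h' => ?_, key h z⟩
  simpa using key h.symm _ h'

theorem Renames.hasInner_iff {σ : Equiv.Perm (Fin v)} {τ : Equiv.Perm (Fin e)}
    {Γ Γ' : Graph (k + 1) v e} (h : Renames σ τ Γ Γ') : Γ'.HasInner ↔ Γ.HasInner := by
  rw [HasInner, ← τ.exists_congr_right]
  refine exists_congr fun a => ?_
  rcases h.ends a with h1 | h1 <;> rw [h1.1, h1.2, h.straight_iff, h.straight_iff]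
  rw [and_comm]

theorem Renames.middles_eq (hs : s = Part.circ → 1 ≤ k)
    {σ : Equiv.Perm (Fin v)} {τ : Equiv.Perm (Fin e)}
    {Γ Γ' : Graph (k + 1) v e} (h : Renames σ τ Γ Γ') (hΓ : Admissible s Γ) :
    Γ'.middles = Γ.middles.map σ.toEmbedding := by
  ext z
  obtain ⟨z, rfl⟩ := σ.surjective z
  rw [mem_middles hs (h.admissible hΓ), Renames.isolated_iff h, ← mem_middles hs hΓ]
  simp

/-- The projection onto the special part. -/
theorem exists_specialProj (hs : s = Part.circ → 1 ≤ k) :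
    ∃ f : GraphComplex 𝕂 n s (k + 1) →ₗ[𝕂] GraphComplex 𝕂 n s (k + 1),
    ∀ {v e : ℕ} (Γ : Graph (k + 1) v e), Admissible s Γ → f (cls 𝕂 n s Γ) =
      if Γ.HasInner then 0 else decorated 𝕂 n s Γ Γ.middles := by
  refine exists_descend 𝕂 n s (fun Γ => if Γ.HasInner then 0 else decorated 𝕂 n s Γ Γ.middles)
    ?_ ?_ ?_
  · intro v e Γ σ hΓ
    rw [Renames.hasInner_iff (Γ.renames_permV σ), smul_ite, smul_zero]
    congr 1
    refine decorated_middles_of_equivariant 𝕂 n s σ (permV σ) _ (fun Γ => cls_permV 𝕂 n s Γ σ)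
      (Renames.middles_eq s hs (Γ.renames_permV σ) hΓ) fun S => ?_
    ext c a
    · rfl
    · rfl
    · have h1 : (∃ z ∈ S.map σ.toEmbedding, (Γ.permV σ).Inc z a) ↔ ∃ z ∈ S, Γ.Inc z a := by
        rw [← σ.exists_congr_right]
        simp [Inc, permV]
      simp only [reverseLast, h1]
      rfl
  · intro v e Γ τ hΓ
    rw [Renames.hasInner_iff (Γ.renames_permE τ), smul_ite, smul_zero]
    congr 1
    refine decorated_middles_of_equivariant 𝕂 n s 1 (permE τ) _ (fun Γ => cls_permE 𝕂 n s Γ τ)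
      (Renames.middles_eq s hs (Γ.renames_permE τ) hΓ) fun S => ?_
    ext c a
    · rfl
    · rfl
    · have hS : S.map (1 : Equiv.Perm (Fin v)).toEmbedding = S := by
        ext; simp [Equiv.Perm.one_def]
      rw [hS]
      rfl
  · intro v e Γ b hΓ
    rw [Renames.hasInner_iff (Γ.renames_flip b), smul_ite, smul_zero]
    congr 1
    refine decorated_middles_of_equivariant 𝕂 n s 1 (Graph.flip b) _ (fun Γ => cls_flip 𝕂 n s Γ b)
      (Renames.middles_eq s hs (Γ.renames_flip b) hΓ) fun S => ?_
    ext c a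
    · rfl
    · rfl
    · have hS : S.map (1 : Equiv.Perm (Fin v)).toEmbedding = S := by
        ext; simp [Equiv.Perm.one_def]
      rw [hS]
      have h1 := inc_flip Γ b
      induction c using Fin.lastCases with
      | last =>
        have h2 : ∀ (X : Graph (k + 1) v e), (X.flip b).ori (Fin.last k) a =
          if a = b then !X.ori (Fin.last k) a else X.ori (Fin.last k) a := fun _ => rfl
        rw [ori_last_reverseLast, h2, h2, ori_last_reverseLast]
        simp only [h1]
        split_ifs <;> rfl
      | cast c =>
        rw [ori_castSucc_reverseLast]
        simp only [Graph.flip, ori_castSucc_reverseLast]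

variable (k) in
/-- The projection onto the special part, along the dagger part. -/
def specialProj (hs : s = Part.circ → 1 ≤ k) :
    GraphComplex 𝕂 n s (k + 1) →ₗ[𝕂] GraphComplex 𝕂 n s (k + 1) :=
  (exists_specialProj 𝕂 n s hs).choose

theorem specialProj_cls (hs : s = Part.circ → 1 ≤ k) {Γ : Graph (k + 1) v e}
    (hΓ : Admissible s Γ) : specialProj 𝕂 n s k hs (cls 𝕂 n s Γ) =
      if Γ.HasInner then 0 else decorated 𝕂 n s Γ Γ.middles :=
  (exists_specialProj 𝕂 n s hs).choose_spec Γ hΓ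

theorem decorated_mem_special (hs : s = Part.circ → 1 ≤ k) {Γ : Graph (k + 1) v e}
    (hΓ : Admissible s Γ) (h : ¬ Γ.HasInner) :
    decorated 𝕂 n s Γ Γ.middles ∈ special 𝕂 n s k := by
  refine Submodule.subset_span ⟨v, e, Γ, hΓ, fun a => ?_, rfl⟩
  rw [← exists_three_le_iff hs hΓ] at h
  push Not at h
  have := h a
  omega

theorem specialProj_mem (hs : s = Part.circ → 1 ≤ k) (x : GraphComplex 𝕂 n s (k + 1)) :
    specialProj 𝕂 n s k hs x ∈ special 𝕂 n s k := by
  have hx : x ∈ (⊤ : Submodule 𝕂 (GraphComplex 𝕂 n s (k + 1))) := trivial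
  rw [← span_cls] at hx
  induction hx using Submodule.span_induction with
  | zero => rw [map_zero]; exact zero_mem _
  | add x y _ _ hx hy => rw [map_add]; exact add_mem hx hy
  | smul c x _ hx => rw [map_smul]; exact Submodule.smul_mem _ c hx
  | mem x hx =>
    obtain ⟨v, e, Γ, hΓ, rfl⟩ := hx
    rw [specialProj_cls 𝕂 n s hs hΓ]
    split_ifs with h
    · exact zero_mem _
    · exact decorated_mem_special 𝕂 n s hs hΓ h

theorem decorated_mem_dagger (hs : s = Part.circ → 1 ≤ k) {Γ : Graph (k + 1) v e}
    (hΓ : Admissible s Γ) {T : Finset (Fin v)} (hT : T ⊆ Γ.middles)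
    (h : Γ.HasInner ∨ T ≠ Γ.middles) : decorated 𝕂 n s Γ T ∈ dagger 𝕂 n s k :=
  Submodule.subset_span ⟨v, e, Γ, T, hΓ, hT, by rwa [exists_three_le_iff hs hΓ], rfl⟩

/-- The complement of the projection is a sum of graphs with a bad skeleton edge. -/
theorem cls_sub_specialProj [CharZero 𝕂] (hs : s = Part.circ → 1 ≤ k) {Γ : Graph (k + 1) v e}
    (hΓ : Admissible s Γ) : cls 𝕂 n s Γ - specialProj 𝕂 n s k hs (cls 𝕂 n s Γ) =
      ∑ T ∈ Γ.middles.powerset.filter fun T => Γ.HasInner ∨ T ≠ Γ.middles,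
        decorated 𝕂 n s Γ T := by
  rw [specialProj_cls 𝕂 n s hs hΓ]
  split_ifs with h
  · rw [sub_zero, ← sum_decorated 𝕂 n s Γ, Finset.filter_true_of_mem fun _ _ => Or.inl h]
  · rw [sub_eq_iff_eq_add, ← sum_decorated 𝕂 n s Γ,
      ← Finset.sum_filter_add_sum_filter_not _ fun T => Γ.HasInner ∨ T ≠ Γ.middles]
    congr 1
    rw [Finset.sum_filter, Finset.sum_eq_single Γ.middles]
    · simp [h]
    · intro T _ hT
      simp [hT]
    · simp

theorem sub_specialProj_mem [CharZero 𝕂] (hs : s = Part.circ → 1 ≤ k)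
    (x : GraphComplex 𝕂 n s (k + 1)) : x - specialProj 𝕂 n s k hs x ∈ dagger 𝕂 n s k := by
  have hx : x ∈ (⊤ : Submodule 𝕂 (GraphComplex 𝕂 n s (k + 1))) := trivial
  rw [← span_cls] at hx
  induction hx using Submodule.span_induction with
  | zero => rw [map_zero, sub_zero]; exact zero_mem _
  | add x y _ _ hx hy => rw [map_add, add_sub_add_comm]; exact add_mem hx hy
  | smul c x _ hx => rw [map_smul, ← smul_sub]; exact Submodule.smul_mem _ c hx
  | mem x hx =>
    obtain ⟨v, e, Γ, hΓ, rfl⟩ := hx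
    rw [cls_sub_specialProj 𝕂 n s hs hΓ]
    refine sum_mem fun T hT => ?_
    rw [Finset.mem_filter, Finset.mem_powerset] at hT
    exact decorated_mem_dagger 𝕂 n s hs hΓ hT.1 hT.2

theorem specialProj_of_mem_special [CharZero 𝕂] (hs : s = Part.circ → 1 ≤ k)
    {x : GraphComplex 𝕂 n s (k + 1)} (hx : x ∈ special 𝕂 n s k) :
    specialProj 𝕂 n s k hs x = x := by
  induction hx using Submodule.span_induction with
  | zero => rw [map_zero]
  | add x y _ _ hx hy => rw [map_add, hx, hy]
  | smul c x _ hx => rw [map_smul, hx]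
  | mem x hx =>
    obtain ⟨v, e, Γ, hΓ, hl, rfl⟩ := hx
    have h : ¬ Γ.HasInner := by
      rw [← exists_three_le_iff hs hΓ]
      rintro ⟨a, ha⟩
      have := hl a
      omega
    conv_lhs => rw [decorated]
    rw [map_smul, map_sum]
    have : ∀ S ∈ Γ.middles.powerset, specialProj 𝕂 n s k hs
        ((-1 : 𝕂) ^ (S ∩ Γ.middles).card • cls 𝕂 n s (Γ.reverseLast S)) =
        decorated 𝕂 n s Γ Γ.middles := by
      intro S hS
      rw [Finset.mem_powerset] at hS
      rw [map_smul, specialProj_cls 𝕂 n s hs (admissible_reverseLast hΓ fun z hz =>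
        (mem_middles hs hΓ z).1 (hS hz)), if_neg (by rwa [hasInner_reverseLast]),
        middles_reverseLast s hs hΓ hS, decorated_reverseLast 𝕂 n s hs hΓ hS, smul_smul,
        neg_one_pow_mul_self, one_smul]
    -- The eigenvalue of the reversal cancels the coefficient, so all `2 ^ Γ.middles.card` summands
    -- agree and compensate the normalising factor.
    rw [Finset.sum_congr rfl this, Finset.sum_const, Finset.card_powerset,
      ← Nat.cast_smul_eq_nsmul 𝕂,
      smul_smul]
    push_cast
    rw [← mul_pow]
    norm_num

/-- It suffices to look at the generators of `cross`, where the images of the two graphs cancel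
because the fully dotted graph changes sign under the reversal at `z`. -/
theorem specialProj_of_mem_dagger [CharZero 𝕂] (hs : s = Part.circ → 1 ≤ k)
    {x : GraphComplex 𝕂 n s (k + 1)} (hx : x ∈ dagger 𝕂 n s k) :
    specialProj 𝕂 n s k hs x = 0 := by
  rw [dagger_eq_cross 𝕂 n s hs] at hx
  induction hx using Submodule.span_induction with
  | zero => rw [map_zero]
  | add x y _ _ hx hy => rw [map_add, hx, hy, add_zero]
  | smul c x _ hx => rw [map_smul, hx, smul_zero]
  | mem x hx =>
    obtain ⟨v, e, Γ, z, hΓ, hz, rfl⟩ := hx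
    rw [map_add, specialProj_cls 𝕂 n s hs hΓ]
    by_cases h : Γ.HasInner
    · rw [if_pos h, zero_add]
      by_cases hr : Admissible s (Γ.reverseLast {z})
      · rw [specialProj_cls 𝕂 n s hs hr, if_pos (hasInner_reverseLast.2 h)]
      · rw [cls_of_not 𝕂 n s hr, map_zero]
    · have hi := hz.isolated h
      have hzM : {z} ⊆ Γ.middles := Finset.singleton_subset_iff.2 ((mem_middles hs hΓ z).2 hi)
      rw [if_neg h, specialProj_cls 𝕂 n s hs (admissible_reverseLast_singleton hΓ hi),
        if_neg (by rwa [hasInner_reverseLast]), middles_reverseLast s hs hΓ hzM,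
        decorated_reverseLast 𝕂 n s hs hΓ hzM, Finset.inter_eq_left.2 hzM]
      simp

theorem isCompl_special_dagger [CharZero 𝕂] (hs : s = Part.circ → 1 ≤ k) :
    IsCompl (special 𝕂 n s k) (dagger 𝕂 n s k) := by
  constructor
  · rw [Submodule.disjoint_def]
    intro x hx hx'
    rw [← specialProj_of_mem_special 𝕂 n s hs hx, specialProj_of_mem_dagger 𝕂 n s hs hx']
  · rw [codisjoint_iff, eq_top_iff]
    rintro x -
    rw [← add_sub_cancel (specialProj 𝕂 n s k hs x) x]
    exact Submodule.add_mem_sup (specialProj_mem 𝕂 n s hs x) (sub_specialProj_mem 𝕂 n s hs x)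

theorem projectionOnto_eq_specialProj [CharZero 𝕂] (hs : s = Part.circ → 1 ≤ k)
    (h : IsCompl (special 𝕂 n s k) (dagger 𝕂 n s k)) (x : GraphComplex 𝕂 n s (k + 1)) :
    ((special 𝕂 n s k).projectionOnto (dagger 𝕂 n s k) h x : GraphComplex 𝕂 n s (k + 1)) =
      specialProj 𝕂 n s k hs x := by
  conv_lhs => rw [← add_sub_cancel (specialProj 𝕂 n s k hs x) x, map_add]
  rw [Submodule.projectionOnto_apply_of_mem_right h (sub_specialProj_mem 𝕂 n s hs x), add_zero]
  exact congrArg Subtype.val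
    (Submodule.projectionOnto_apply_left h ⟨_, specialProj_mem 𝕂 n s hs x⟩)

end Decorated

end OGC

namespace OGC

namespace Graph

variable {k v e w : ℕ}

/-! ### Subdividing an edge next to one of its ends -/

/-- Subdivide the edge `a` next to its end `s`. The new vertex and the new edge are the last ones,
the new edge points intrinsically to the new vertex, and the new vertex passes in all colours but
the last one. -/
def ins (Γ : Graph (k + 1) v e) (a : Fin e) (s : Bool) : Graph (k + 1) (v + 1) (e + 1) where
  src := Fin.lastCases (Γ.endAt s a).castSucc
    fun i => if i = a ∧ s = false then Fin.last v else (Γ.src i).castSucc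
  tgt := Fin.lastCases (Fin.last v)
    fun i => if i = a ∧ s = true then Fin.last v else (Γ.tgt i).castSucc
  ori c := Fin.lastCases (if c = Fin.last k then Γ.ori c a == s else Γ.ori c a != s)
    fun i => Γ.ori c i

section Ins

variable (Γ : Graph (k + 1) v e) (a : Fin e) (s : Bool)

theorem src_ins_last : (Γ.ins a s).src (Fin.last e) = (Γ.endAt s a).castSucc := by simp [ins]

theorem tgt_ins_last : (Γ.ins a s).tgt (Fin.last e) = Fin.last v := by simp [ins]

theorem src_ins_castSucc (i : Fin e) : (Γ.ins a s).src i.castSucc =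
    if i = a ∧ s = false then Fin.last v else (Γ.src i).castSucc := by simp [ins]

theorem tgt_ins_castSucc (i : Fin e) : (Γ.ins a s).tgt i.castSucc =
    if i = a ∧ s = true then Fin.last v else (Γ.tgt i).castSucc := by simp [ins]

theorem ori_ins_castSucc (c : Fin (k + 1)) (i : Fin e) :
    (Γ.ins a s).ori c i.castSucc = Γ.ori c i := by simp [ins]

theorem ori_castSucc_ins_last (c : Fin k) :
    (Γ.ins a s).ori c.castSucc (Fin.last e) = (Γ.ori c.castSucc a != s) := by
  simp [ins, (Fin.castSucc_lt_last c).ne]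

theorem ori_last_ins_last :
    (Γ.ins a s).ori (Fin.last k) (Fin.last e) = (Γ.ori (Fin.last k) a == s) := by
  simp [ins]

theorem endAt_ins_castSucc (s' : Bool) (i : Fin e) : (Γ.ins a s).endAt s' i.castSucc =
    if i = a ∧ s' = s then Fin.last v else (Γ.endAt s' i).castSucc := by
  cases s' <;> cases s <;> simp [src_ins_castSucc, tgt_ins_castSucc]

variable {Γ a}

theorem inc_ins_castSucc (h0 : Γ.src a ≠ Γ.tgt a) (y : Fin v) (i : Fin e) :
    (Γ.ins a s).Inc y.castSucc i.castSucc ↔ Γ.Inc y i ∧ ¬ (i = a ∧ y = Γ.endAt s a) := by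
  have h1 := (Fin.castSucc_lt_last y).ne'
  by_cases hi : i = a
  · subst hi
    cases s
    · simp only [Inc, src_ins_castSucc, tgt_ins_castSucc, endAt_false]
      simp [h1]
      grind
    · simp only [Inc, src_ins_castSucc, tgt_ins_castSucc, endAt_true]
      simp [h1]
      grind
  · simp [Inc, src_ins_castSucc, tgt_ins_castSucc, hi]

theorem inc_ins_last (y : Fin v) :
    (Γ.ins a s).Inc y.castSucc (Fin.last e) ↔ y = Γ.endAt s a := by
  simp [Inc, src_ins_last, tgt_ins_last, (Fin.castSucc_lt_last y).ne', eq_comm]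

theorem edgePair_ins_last : (Γ.ins a s).EdgePair (Fin.last v) a.castSucc (Fin.last e) := by
  refine ⟨(Fin.castSucc_lt_last a).ne, fun i => ?_⟩
  induction i using Fin.lastCases with
  | last => simp [Inc, tgt_ins_last]
  | cast i =>
    simp only [inc_iff_endAt, endAt_ins_castSucc, Fin.castSucc_inj, (Fin.castSucc_lt_last i).ne,
      or_false]
    by_cases hi : i = a
    · simp [hi]
    · simp [hi, (Fin.castSucc_lt_last _).ne]

variable (Γ a) in
/-- The edges at an old vertex before and after the subdivision. -/
def insEdge (y : Fin v) (i : Fin e) : Fin (e + 1) :=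
  if i = a ∧ y = Γ.endAt s a then Fin.last e else i.castSucc

theorem inc_insEdge (h0 : Γ.src a ≠ Γ.tgt a) (y : Fin v) (i : Fin e) :
    Γ.Inc y i ↔ (Γ.ins a s).Inc y.castSucc (Γ.insEdge a s y i) := by
  unfold insEdge
  split_ifs with h
  · rw [inc_ins_last, h.1, h.2]
    simp [inc_endAt]
  · rw [inc_ins_castSucc s h0, and_iff_left h]

theorem exists_insEdge (h0 : Γ.src a ≠ Γ.tgt a) (y : Fin v) (j : Fin (e + 1))
    (h : (Γ.ins a s).Inc y.castSucc j) : ∃ i, Γ.insEdge a s y i = j := by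
  induction j using Fin.lastCases with
  | last => exact ⟨a, by simp [insEdge, (inc_ins_last s y).1 h]⟩
  | cast i => exact ⟨i, if_neg ((inc_ins_castSucc s h0 y i).1 h).2⟩

theorem valence_ins (h0 : Γ.src a ≠ Γ.tgt a) (y : Fin v) :
    (Γ.ins a s).valence y.castSucc = Γ.valence y := by
  refine (valence_eq_of_map (Γ.insEdge a s y) ?_ (inc_insEdge s h0 y)
    (exists_insEdge s h0 y)).symm
  intro i j hij
  unfold insEdge at hij
  split_ifs at hij with h1 h2 h2
  · rw [h1.1, h2.1]
  · exact absurd hij.symm (Fin.castSucc_lt_last _).ne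
  · exact absurd hij (Fin.castSucc_lt_last _).ne
  · exact Fin.castSucc_injective _ hij

/-- At an old vertex the new edge takes the role of the subdivided one. Only in the last colour does
it have the opposite direction at the subdivided end, because the new vertex does not pass there;
this case is excluded by `h`. -/
theorem head_insEdge (h0 : Γ.src a ≠ Γ.tgt a) (c : Fin (k + 1)) (y : Fin v)
    (h : c = Fin.last k → y ≠ Γ.endAt s a) (i : Fin e) :
    (Γ.ins a s).head c (Γ.insEdge a s y i) = y.castSucc ↔ Γ.head c i = y := by
  unfold insEdge
  have h1 := (Fin.castSucc_lt_last y).ne'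
  split_ifs with h2
  · obtain ⟨rfl, rfl⟩ := h2
    induction c using Fin.lastCases with
    | last => exact absurd rfl (h rfl)
    | cast c =>
      simp only [head_eq_endAt, ori_castSucc_ins_last]
      cases h3 : Γ.ori c.castSucc i <;> cases s <;>
        simp [src_ins_last, tgt_ins_last, h0, h0.symm, (Fin.castSucc_lt_last _).ne']
  · rw [head_eq_endAt, ori_ins_castSucc, endAt_ins_castSucc]
    split_ifs with h3
    · simp only [h1, false_iff]
      rintro rfl
      exact h2 ⟨h3.1, by rw [head_eq_endAt, h3.2, h3.1]⟩
    · rw [Fin.castSucc_inj]; rfl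

theorem tail_insEdge (h0 : Γ.src a ≠ Γ.tgt a) (c : Fin (k + 1)) (y : Fin v)
    (h : c = Fin.last k → y ≠ Γ.endAt s a) (i : Fin e) :
    (Γ.ins a s).tail c (Γ.insEdge a s y i) = y.castSucc ↔ Γ.tail c i = y := by
  unfold insEdge
  have h1 := (Fin.castSucc_lt_last y).ne'
  split_ifs with h2
  · obtain ⟨rfl, rfl⟩ := h2
    induction c using Fin.lastCases with
    | last => exact absurd rfl (h rfl)
    | cast c =>
      simp only [tail_eq_endAt, ori_castSucc_ins_last]
      cases h3 : Γ.ori c.castSucc i <;> cases s <;>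
        simp [src_ins_last, tgt_ins_last, h0, h0.symm, (Fin.castSucc_lt_last _).ne']
  · rw [tail_eq_endAt, ori_ins_castSucc, endAt_ins_castSucc]
    split_ifs with h3
    · simp only [h1, false_iff]
      rintro rfl
      exact h2 ⟨h3.1, by rw [tail_eq_endAt, h3.1, ← h3.2, h3.1]⟩
    · rw [Fin.castSucc_inj, tail_eq_endAt]

theorem passesIn_ins (h0 : Γ.src a ≠ Γ.tgt a) (c : Fin (k + 1)) (y : Fin v)
    (h : c = Fin.last k → y ≠ Γ.endAt s a) :
    (Γ.ins a s).PassesIn c y.castSucc ↔ Γ.PassesIn c y := by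
  rw [PassesIn, PassesIn, valence_ins s h0]
  refine and_congr_right fun _ => and_congr ⟨?_, ?_⟩ ⟨?_, ?_⟩
  · rintro ⟨j, hj⟩
    obtain ⟨i, rfl⟩ := exists_insEdge s h0 y j ((inc_iff_head_or_tail c).2 (Or.inl hj))
    exact ⟨i, (head_insEdge s h0 c y h i).1 hj⟩
  · rintro ⟨i, hi⟩
    exact ⟨_, (head_insEdge s h0 c y h i).2 hi⟩
  · rintro ⟨j, hj⟩
    obtain ⟨i, rfl⟩ := exists_insEdge s h0 y j ((inc_iff_head_or_tail c).2 (Or.inr hj))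
    exact ⟨i, (tail_insEdge s h0 c y h i).1 hj⟩
  · rintro ⟨i, hi⟩
    exact ⟨_, (tail_insEdge s h0 c y h i).2 hi⟩

theorem straight_ins_castSucc (h0 : Γ.src a ≠ Γ.tgt a) (y : Fin v) :
    (Γ.ins a s).Straight y.castSucc ↔ Γ.Straight y := by
  simp only [Straight, valence_ins s h0,
    passesIn_ins s h0 _ y fun h => absurd h (Fin.castSucc_lt_last _).ne]

theorem no_tadpole_ins (h0 : ∀ i, Γ.src i ≠ Γ.tgt i) (i : Fin (e + 1)) :
    (Γ.ins a s).src i ≠ (Γ.ins a s).tgt i := by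
  induction i using Fin.lastCases with
  | last => rw [src_ins_last, tgt_ins_last]; exact (Fin.castSucc_lt_last _).ne
  | cast i =>
    rw [src_ins_castSucc, tgt_ins_castSucc]
    have h1 := h0 i
    have h2 := (Fin.castSucc_lt_last (Γ.src i)).ne
    have h3 := (Fin.castSucc_lt_last (Γ.tgt i)).ne
    cases s <;> by_cases hi : i = a <;> simp_all [Ne.symm]

theorem passesIn_ins_last (h0 : ∀ i, Γ.src i ≠ Γ.tgt i) (c : Fin (k + 1)) :
    (Γ.ins a s).PassesIn c (Fin.last v) ↔ c ≠ Fin.last k := by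
  rw [(edgePair_ins_last s).passesIn (no_tadpole_ins s h0), head_eq_endAt, tail_eq_endAt,
    endAt_ins_castSucc, ori_ins_castSucc]
  have h1 := (Fin.castSucc_lt_last (Γ.src a)).ne
  have h2 := (Fin.castSucc_lt_last (Γ.tgt a)).ne
  induction c using Fin.lastCases with
  | last =>
    rw [ori_last_ins_last]
    cases Γ.ori (Fin.last k) a <;> cases s <;> simp [src_ins_last, tgt_ins_last, h1, h2]
  | cast c =>
    rw [ori_castSucc_ins_last]
    cases Γ.ori c.castSucc a <;> cases s <;>
      simp [src_ins_last, tgt_ins_last, h1, h2, (Fin.castSucc_lt_last c).ne]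

theorem straight_ins_last (h0 : ∀ i, Γ.src i ≠ Γ.tgt i) : (Γ.ins a s).Straight (Fin.last v) :=
  ⟨(edgePair_ins_last s).valence,
    fun c => (passesIn_ins_last s h0 _).2 (Fin.castSucc_lt_last c).ne⟩

end Ins

theorem renumber_last_castSucc (x : Fin (w + 1)) : renumber (Fin.last (w + 1)) x.castSucc = x := by
  rw [← Fin.succAbove_last_apply, renumber_succAbove]

theorem merge_last_castSucc (q : Fin (w + 2)) (x : Fin (w + 1)) :
    merge (Fin.last (w + 1)) q x.castSucc = x := by
  rw [merge_of_ne (Fin.castSucc_lt_last x).ne, renumber_last_castSucc]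

theorem contract_ins_last (Γ : Graph (k + 1) (w + 1) e) (a : Fin e) (s : Bool) :
    (Γ.ins a s).contract (Fin.last e) = Γ := by
  have h1 : ∀ x : Fin (w + 1), (Γ.ins a s).proj (Fin.last e) x.castSucc = x := by
    intro x
    rw [proj, tgt_ins_last, merge_last_castSucc]
  have h2 : (Γ.ins a s).proj (Fin.last e) (Fin.last (w + 1)) = Γ.endAt s a := by
    rw [proj, tgt_ins_last, src_ins_last, merge, if_pos rfl, renumber_last_castSucc]
  refine Graph.ext (funext fun i => ?_) (funext fun i => ?_) (funext fun c => funext fun i => ?_)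
  · rw [src_contract, Fin.succAbove_last_apply, src_ins_castSucc]
    split_ifs with h
    · rw [h2, h.1, h.2]; rfl
    · rw [h1]
  · rw [tgt_contract, Fin.succAbove_last_apply, tgt_ins_castSucc]
    split_ifs with h
    · rw [h2, h.1, h.2]; rfl
    · rw [h1]
  · simp only [contract, Fin.succAbove_last_apply, ori_ins_castSucc]

theorem renumber_castSucc {p x : Fin (w + 2)} (hx : x ≠ p) :
    renumber p.castSucc x.castSucc = (renumber p x).castSucc := by
  obtain ⟨i, rfl⟩ := Fin.exists_succAbove_eq hx
  rw [← Fin.castSucc_succAbove_castSucc, renumber_succAbove, renumber_succAbove]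

theorem merge_castSucc {p q : Fin (w + 2)} (hq : q ≠ p) (x : Fin (w + 2)) :
    merge p.castSucc q.castSucc x.castSucc = (merge p q x).castSucc := by
  by_cases hx : x = p
  · simp [merge, hx, renumber_castSucc hq]
  · rw [merge_of_ne hx, merge_of_ne (by simpa using hx), renumber_castSucc hx]

theorem merge_castSucc_last (p : Fin (w + 2)) (q : Fin (w + 3)) :
    merge p.castSucc q (Fin.last (w + 2)) = Fin.last (w + 1) := by
  rw [merge_of_ne (Fin.castSucc_lt_last p).ne']
  have : p.castSucc.succAbove (Fin.last (w + 1)) = Fin.last (w + 2) := by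
    simp
  rw [← this, renumber_succAbove]

theorem contract_ins (Γ : Graph (k + 1) (w + 2) (e + 1)) {t : Fin (e + 1)}
    (ht : Γ.src t ≠ Γ.tgt t) (a : Fin e) (s : Bool) :
    (Γ.ins (t.succAbove a) s).contract t.castSucc = (Γ.contract t).ins a s := by
  have hta : ¬ (t = t.succAbove a) := (Fin.succAbove_ne t a).symm
  have h1 : ∀ x, (Γ.ins (t.succAbove a) s).proj t.castSucc x.castSucc = (Γ.proj t x).castSucc := by
    intro x
    rw [proj, tgt_ins_castSucc, src_ins_castSucc, if_neg (fun h => hta h.1),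
      if_neg (fun h => hta h.1), merge_castSucc ht]; rfl
  have h2 : (Γ.ins (t.succAbove a) s).proj t.castSucc (Fin.last (w + 2)) = Fin.last (w + 1) := by
    rw [proj, tgt_ins_castSucc, if_neg (fun h => hta h.1), merge_castSucc_last]
  have h3 : t.castSucc.succAbove (Fin.last e) = Fin.last (e + 1) := by simp
  have h4 : ∀ i : Fin e, t.castSucc.succAbove i.castSucc = (t.succAbove i).castSucc :=
    fun i => Fin.castSucc_succAbove_castSucc
  have h5 : ∀ i, t.succAbove i = t.succAbove a ↔ i = a :=
    fun i => Fin.succAbove_right_injective.eq_iff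
  refine Graph.ext (funext fun i => ?_) (funext fun i => ?_) (funext fun c => funext fun i => ?_)
  · rw [src_contract]
    induction i using Fin.lastCases with
    | last => rw [h3, src_ins_last, src_ins_last, h1, endAt_contract]
    | cast i =>
      rw [h4, src_ins_castSucc, src_ins_castSucc]
      simp only [h5]
      split_ifs
      · rw [h2]
      · rw [h1]; rfl
  · rw [tgt_contract]
    induction i using Fin.lastCases with
    | last => rw [h3, tgt_ins_last, tgt_ins_last, h2]
    | cast i =>
      rw [h4, tgt_ins_castSucc, tgt_ins_castSucc]
      simp only [h5]
      split_ifs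
      · rw [h2]
      · rw [h1]; rfl
  · simp only [contract]
    induction i using Fin.lastCases with
    | last =>
      rw [h3]
      induction c using Fin.lastCases with
      | last => rw [ori_last_ins_last, ori_last_ins_last]
      | cast c => rw [ori_castSucc_ins_last, ori_castSucc_ins_last]
    | cast i => rw [h4, ori_ins_castSucc, ori_ins_castSucc]

/-- The new vertex and the new edge come last. So `t` is one step further from the last edge, and
its head one step further from the last vertex, which gives the sign needed for a homotopy. -/
theorem contractSign_ins (n : ℤ) (Γ : Graph (k + 1) (w + 2) (e + 1)) (t : Fin (e + 1)) (a : Fin e)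
    (s : Bool) : (Γ.ins (t.succAbove a) s).contractSign n t.castSucc = -Γ.contractSign n t := by
  have hta : ¬ (t = t.succAbove a) := (Fin.succAbove_ne t a).symm
  by_cases hn : Even n
  · simp only [contractSign, hn, if_true]
    rw [neg_one_pow_tsub' (by simp), neg_one_pow_tsub' (by omega), pow_succ]; simp
  · simp only [contractSign, hn, if_false]
    rw [tgt_ins_castSucc, if_neg (fun h => hta h.1), neg_one_pow_tsub' (by simp),
      neg_one_pow_tsub' (by omega), pow_succ]
    simp

theorem contractSign_ins_last (n : ℤ) (Γ : Graph (k + 1) (w + 1) e) (a : Fin e) (s : Bool) :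
    (Γ.ins a s).contractSign n (Fin.last e) = 1 := by
  unfold contractSign
  rw [tgt_ins_last]
  simp

end Graph

end OGC

namespace OGC

/-! ### The operator that subdivides the ends of skeleton edges -/

namespace Graph

variable {k v e w : ℕ}

/-- Edges with exactly one straight end: the ends of the skeleton edges of length at least two. -/
def IsEnd (Γ : Graph (k + 1) v e) (a : Fin e) : Prop :=
  ¬ (Γ.Straight (Γ.src a) ↔ Γ.Straight (Γ.tgt a))

/-- The end of an edge of `IsEnd` that is not straight. -/
def outer (Γ : Graph (k + 1) v e) (a : Fin e) : Bool := decide (Γ.Straight (Γ.src a))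

theorem not_straight_outer {Γ : Graph (k + 1) v e} {a : Fin e} (h : Γ.IsEnd a) :
    ¬ Γ.Straight (Γ.endAt (Γ.outer a) a) := by
  unfold IsEnd at h
  by_cases h1 : Γ.Straight (Γ.src a) <;> simp [outer, h1] at h ⊢
  exact h

theorem straight_inner {Γ : Graph (k + 1) v e} {a : Fin e} (h : Γ.IsEnd a) :
    Γ.Straight (Γ.endAt (!Γ.outer a) a) := by
  unfold IsEnd at h
  by_cases h1 : Γ.Straight (Γ.src a) <;> simp [outer, h1] at h ⊢
  exact h

theorem isEnd_reverseLast (S : Finset (Fin v)) (Γ : Graph (k + 1) v e) (a : Fin e) :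
    (Γ.reverseLast S).IsEnd a ↔ Γ.IsEnd a := by
  simp only [IsEnd, straight_reverseLast]; rfl

theorem outer_reverseLast (S : Finset (Fin v)) (Γ : Graph (k + 1) v e) (a : Fin e) :
    (Γ.reverseLast S).outer a = Γ.outer a := by
  simp only [outer, straight_reverseLast]; rfl

theorem ins_reverseLast {Γ : Graph (k + 1) v e} {a : Fin e} (h0 : Γ.src a ≠ Γ.tgt a) {z : Fin v}
    (hz : ¬ Γ.Inc z a) (s : Bool) :
    (Γ.reverseLast {z}).ins a s = (Γ.ins a s).reverseLast {z.castSucc} := by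
  have h1 : ¬ ∃ x ∈ ({z} : Finset _), Γ.Inc x a := by simpa using hz
  have h2 : ¬ ∃ x ∈ ({z.castSucc} : Finset _), (Γ.ins a s).Inc x (Fin.last e) := by
    simp only [Finset.mem_singleton, exists_eq_left, inc_ins_last]
    rintro rfl
    exact hz (inc_endAt Γ s a)
  refine Graph.ext rfl rfl (funext fun c => funext fun i => ?_)
  induction i using Fin.lastCases with
  | last =>
    induction c using Fin.lastCases with
    | last => rw [ori_last_ins_last, ori_last_reverseLast, ori_last_reverseLast, if_neg h1,
        if_neg h2,
        ori_last_ins_last]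
    | cast c => rw [ori_castSucc_reverseLast, ori_castSucc_ins_last, ori_castSucc_ins_last,
        ori_castSucc_reverseLast]
  | cast i =>
    have h3 : (∃ x ∈ ({z.castSucc} : Finset _), (Γ.ins a s).Inc x i.castSucc) ↔
        ∃ x ∈ ({z} : Finset _), Γ.Inc x i := by
      simp only [Finset.mem_singleton, exists_eq_left, inc_ins_castSucc s h0]
      rw [and_iff_left_iff_imp]
      rintro h ⟨rfl, -⟩
      exact hz h
    induction c using Fin.lastCases with
    | last =>
      rw [ori_ins_castSucc, ori_last_reverseLast, ori_last_reverseLast, ori_ins_castSucc]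
      simp only [h3]
    | cast c => rw [ori_castSucc_reverseLast, ori_ins_castSucc, ori_ins_castSucc,
        ori_castSucc_reverseLast]

/-! ### The subdivision of an end of a skeleton edge -/

/-- Contracting the new edge gives `Γ` back, so there are no new cycles. The new vertex does not
pass in the last colour. The only old vertex whose directions change is the outer end of `a`, which
is not straight and so cannot become passing. -/
theorem admissible_ins {s : Part} {Γ : Graph (k + 1) v e} (hΓ : Admissible s Γ) {a : Fin e}
    (ha : Γ.IsEnd a) : Admissible s (Γ.ins a (Γ.outer a)) := by
  obtain ⟨w, e, rfl, rfl⟩ := hΓ.exists_size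
  have h0 := hΓ.oriented.no_tadpole
  have h0' := no_tadpole_ins (a := a) (Γ.outer a) h0
  have hc := contract_ins_last Γ a (Γ.outer a)
  have hval : ∀ x, (Γ.ins a (Γ.outer a)).valence (Fin.castSucc x) = Γ.valence x :=
    valence_ins _ (h0 a)
  have hval' : (Γ.ins a (Γ.outer a)).valence (Fin.last _) = 2 := (edgePair_ins_last _).valence
  have hpre : (Γ.ins a (Γ.outer a)).Pre s := by
    refine ⟨h0', Connected.of_contract (t := Fin.last _) (h0' _)
      (by rw [hc]; exact hΓ.oriented.connected), fun x => ?_, ?_⟩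
    · induction x using Fin.lastCases with
      | last => exact hval'.ge
      | cast x => rw [hval]; exact hΓ.two_le x
    · have := hΓ.gc_or_circ
      cases s with
      | gc =>
        obtain ⟨x, hx⟩ := this
        exact ⟨x.castSucc, by rwa [hval]⟩
      | circ =>
        intro x
        induction x using Fin.lastCases with
        | last => exact hval'
        | cast x => rw [hval]; exact this x
  refine hpre.admissible (fun c => ?_) (fun x hx => ?_)
  · exact Ranked.of_contract (t := Fin.last _) (h0' _) (by rw [hc]; exact hΓ.oriented.ranked c)
  · induction x using Fin.lastCases with
    | last => exact (passesIn_ins_last _ h0 _).1 (hx.2 (Fin.last k)) rfl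
    | cast x =>
      have hxs := (straight_ins_castSucc _ (h0 a) x).1 hx.straight
      refine hxs.not_passesIn_last hΓ ((passesIn_ins _ (h0 a) _ x fun _ => ?_).1 (hx.2 _))
      rintro rfl
      exact not_straight_outer ha hxs

theorem hasInner_ins {Γ : Graph (k + 1) v e} (h0 : ∀ i, Γ.src i ≠ Γ.tgt i) {a : Fin e} {s : Bool}
    (h : Γ.Straight (Γ.endAt (!s) a)) : (Γ.ins a s).HasInner := by
  refine ⟨a.castSucc, ?_⟩
  have h1 := straight_ins_last (a := a) s h0
  have h2 := (straight_ins_castSucc s (h0 a) _).2 h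
  rw [src_ins_castSucc, tgt_ins_castSucc]
  cases s
  · simp only [true_and, if_true, Bool.false_eq_true, if_false]; exact ⟨h1, h2⟩
  · simp only [true_and, if_true, Bool.true_eq_false, if_false]; exact ⟨h2, h1⟩

theorem HasInner.ins {Γ : Graph (k + 1) v e} (h0 : ∀ i, Γ.src i ≠ Γ.tgt i) (h : Γ.HasInner)
    {a : Fin e} (ha : Γ.IsEnd a) (s : Bool) : (Γ.ins a s).HasInner := by
  obtain ⟨t, h1, h2⟩ := h
  have hta : t ≠ a := by
    rintro rfl
    exact ha (by simp [h1, h2])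
  refine ⟨t.castSucc, ?_⟩
  rw [src_ins_castSucc, tgt_ins_castSucc, if_neg (fun h => hta h.1), if_neg (fun h => hta h.1),
    straight_ins_castSucc _ (h0 a), straight_ins_castSucc _ (h0 a)]
  exact ⟨h1, h2⟩

theorem Renames.isEnd_iff {σ : Equiv.Perm (Fin v)} {τ : Equiv.Perm (Fin e)}
    {Γ Γ' : Graph (k + 1) v e} (h : Renames σ τ Γ Γ') (a : Fin e) :
    Γ'.IsEnd (τ a) ↔ Γ.IsEnd a := by
  unfold IsEnd
  rcases h.ends a with h1 | h1 <;> rw [h1.1, h1.2, h.straight_iff, h.straight_iff]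
  exact not_congr iff_comm

end Graph

open _root_.OGC.Graph

section Extend

variable (𝕂 : Type*) [Field 𝕂] (n : ℤ) (s : Part) {k v e w : ℕ}

/-- An extension of a permutation by a fixed last element. -/
theorem exists_perm_castSucc {m : ℕ} (σ : Equiv.Perm (Fin m)) :
    ∃ σ' : Equiv.Perm (Fin (m + 1)), (∀ i, σ' i.castSucc = (σ i).castSucc) ∧
      σ' (Fin.last m) = Fin.last m ∧ Equiv.Perm.sign σ' = Equiv.Perm.sign σ := by
  refine ⟨finSuccEquivLast.symm.permCongr (Equiv.optionCongr σ), fun i => by simp, by simp, ?_⟩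
  rw [Equiv.Perm.sign_permCongr, Equiv.optionCongr_sign]

/-- The sum of the subdivisions of a graph at all ends of skeleton edges of length at least two. -/
def insSum (Γ : Graph (k + 1) v e) : GraphComplex 𝕂 n s (k + 1) :=
  ∑ a with Γ.IsEnd a, cls 𝕂 n s (Γ.ins a (Γ.outer a))

theorem ins_permV {σ : Equiv.Perm (Fin v)} {σ' : Equiv.Perm (Fin (v + 1))}
    (h1 : ∀ i, σ' i.castSucc = (σ i).castSucc) (h2 : σ' (Fin.last v) = Fin.last v)
    (Γ : Graph (k + 1) v e) (a : Fin e) (r : Bool) :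
    (Γ.permV σ).ins a r = (Γ.ins a r).permV σ' := by
  refine Graph.ext (funext fun i => ?_) (funext fun i => ?_) (funext fun c => funext fun i => ?_)
  · rw [show ∀ X : Graph (k + 1) (v + 1) (e + 1), (X.permV σ').src i = σ' (X.src i) from
      fun _ => rfl]
    induction i using Fin.lastCases with
    | last =>
      rw [src_ins_last, src_ins_last, h1]
      cases r <;> rfl
    | cast i =>
      rw [src_ins_castSucc, src_ins_castSucc]
      split_ifs
      · rw [h2]
      · rw [h1]; rfl
  · rw [show ∀ X : Graph (k + 1) (v + 1) (e + 1), (X.permV σ').tgt i = σ' (X.tgt i) from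
      fun _ => rfl]
    induction i using Fin.lastCases with
    | last => rw [tgt_ins_last, tgt_ins_last, h2]
    | cast i =>
      rw [tgt_ins_castSucc, tgt_ins_castSucc]
      split_ifs
      · rw [h2]
      · rw [h1]; rfl
  · rfl

theorem cls_ins_permV (σ : Equiv.Perm (Fin v)) (Γ : Graph (k + 1) v e) (a : Fin e) (r : Bool) :
    cls 𝕂 n s ((Γ.permV σ).ins a r) = signV n σ • cls 𝕂 n s (Γ.ins a r) := by
  obtain ⟨σ', h1, h2, h3⟩ := exists_perm_castSucc σ
  have h4 : signV n σ = signV n σ' := by simp only [signV, h3]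
  rw [ins_permV h1 h2, cls_permV, h4]

theorem insSum_permV (Γ : Graph (k + 1) v e) (σ : Equiv.Perm (Fin v)) :
    insSum 𝕂 n s (Γ.permV σ) = signV n σ • insSum 𝕂 n s Γ := by
  have hr := Γ.renames_permV σ
  rw [insSum, insSum, Finset.smul_sum]
  have h5 : ∀ a, (Γ.permV σ).IsEnd a ↔ Γ.IsEnd a := fun a => hr.isEnd_iff a
  simp only [h5]
  refine Finset.sum_congr rfl fun a _ => ?_
  have h6 : (Γ.permV σ).outer a = Γ.outer a := by
    simp only [outer]
    congr 1
    exact propext (hr.straight_iff _)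
  rw [h6, cls_ins_permV]

theorem insSum_permE (Γ : Graph (k + 1) v e) (τ : Equiv.Perm (Fin e)) :
    insSum 𝕂 n s (Γ.permE τ) = signE n τ • insSum 𝕂 n s Γ := by
  obtain ⟨τ', h1, h2, h3⟩ := exists_perm_castSucc τ
  have h4 : signE n τ = signE n τ' := by simp only [signE, h3]
  have hr := Γ.renames_permE τ
  rw [insSum, insSum, Finset.smul_sum, h4, Finset.sum_filter, Finset.sum_filter, ← Equiv.sum_comp τ]
  have h5 : ∀ a, (Γ.permE τ).IsEnd (τ a) ↔ Γ.IsEnd a := fun a => hr.isEnd_iff a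
  simp only [h5]
  refine Finset.sum_congr rfl fun a _ => ?_
  congr 1
  have h6 : (Γ.permE τ).outer (τ a) = Γ.outer a := by
    have := hr.straight_iff (Γ.src a)
    simp only [outer, permE, Equiv.symm_apply_apply]
    congr 1
    exact propext this
  rw [h6, ← cls_permE]
  congr 1
  have h7 : ∀ i : Fin e, τ'.symm i.castSucc = (τ.symm i).castSucc := by
    intro i
    rw [Equiv.symm_apply_eq, h1, Equiv.apply_symm_apply]
  have h8 : τ'.symm (Fin.last e) = Fin.last e := by rw [Equiv.symm_apply_eq, h2]
  have h9 : ∀ i, τ.symm i = a ↔ i = τ a := fun i => by rw [Equiv.symm_apply_eq]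
  refine Graph.ext (funext fun i => ?_) (funext fun i => ?_) (funext fun c => funext fun i => ?_)
  · rw [show ∀ X : Graph (k + 1) (v + 1) (e + 1), (X.permE τ').src i = X.src (τ'.symm i) from
      fun _ => rfl]
    induction i using Fin.lastCases with
    | last =>
      rw [h8, src_ins_last, src_ins_last]
      cases Γ.outer a <;> simp [permE]
    | cast i =>
      rw [h7, src_ins_castSucc, src_ins_castSucc]
      simp only [h9]
      rfl
  · rw [show ∀ X : Graph (k + 1) (v + 1) (e + 1), (X.permE τ').tgt i = X.tgt (τ'.symm i) from
      fun _ => rfl]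
    induction i using Fin.lastCases with
    | last => rw [h8, tgt_ins_last, tgt_ins_last]
    | cast i =>
      rw [h7, tgt_ins_castSucc, tgt_ins_castSucc]
      simp only [h9]
      rfl
  · rw [show ∀ X : Graph (k + 1) (v + 1) (e + 1), (X.permE τ').ori c i = X.ori c (τ'.symm i) from
      fun _ => rfl]
    induction i using Fin.lastCases with
    | last =>
      rw [h8]
      induction c using Fin.lastCases with
      | last => rw [ori_last_ins_last, ori_last_ins_last]; simp [permE]
      | cast c => rw [ori_castSucc_ins_last, ori_castSucc_ins_last]; simp [permE]
    | cast i => rw [h7, ori_ins_castSucc, ori_ins_castSucc]; rfl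

/-- Flipping `a` exchanges its source and target and also the value of `outer`, so the actual vertex
next to which it is subdivided stays the same. -/
theorem insSum_flip (Γ : Graph (k + 1) v e) (b : Fin e) :
    insSum 𝕂 n s (Γ.flip b) = signFlip n • insSum 𝕂 n s Γ := by
  have hr := Γ.renames_flip b
  rw [insSum, insSum, Finset.smul_sum]
  have h5 : ∀ a, (Γ.flip b).IsEnd a ↔ Γ.IsEnd a := fun a => hr.isEnd_iff a
  simp only [h5]
  refine Finset.sum_congr rfl fun a ha => ?_
  have ha' : Γ.IsEnd a := by simpa using ha
  have hst : ∀ x, (Γ.flip b).Straight x ↔ Γ.Straight x := fun x => hr.straight_iff x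
  rw [← cls_flip 𝕂 n s _ b.castSucc]
  congr 1
  have hl : Fin.last e ≠ b.castSucc := (Fin.castSucc_lt_last b).ne'
  have hcs : ∀ i : Fin e, i.castSucc = b.castSucc ↔ i = b := fun i => Fin.castSucc_inj
  by_cases hab : a = b
  · subst hab
    have h6 : (Γ.flip a).outer a = !Γ.outer a := by
      unfold IsEnd at ha'
      have h7 : (Γ.flip a).src a = Γ.tgt a := by simp [Graph.flip]
      simp only [outer, hst, h7]
      by_cases h8 : Γ.Straight (Γ.src a) <;> by_cases h9 : Γ.Straight (Γ.tgt a) <;> simp_all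
    have h7 : (Γ.flip a).endAt (!Γ.outer a) a = Γ.endAt (Γ.outer a) a := by
      cases Γ.outer a <;> simp [Graph.flip]
    rw [h6]
    refine Graph.ext (funext fun i => ?_) (funext fun i => ?_) (funext fun c => funext fun i => ?_)
    · induction i using Fin.lastCases with
      | last => simp only [Graph.flip, src_ins_last, if_neg hl]; exact congrArg _ h7
      | cast i =>
        simp only [Graph.flip, src_ins_castSucc, tgt_ins_castSucc, hcs]
        cases Γ.outer a <;> by_cases hi : i = a <;> simp [hi]
    · induction i using Fin.lastCases with
      | last => simp only [Graph.flip, tgt_ins_last, if_neg hl]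
      | cast i =>
        simp only [Graph.flip, src_ins_castSucc, tgt_ins_castSucc, hcs]
        cases Γ.outer a <;> by_cases hi : i = a <;> simp [hi]
    · induction i using Fin.lastCases with
      | last =>
        have h8 : ∀ X : Graph (k + 1) (v + 1) (e + 1),
          (X.flip a.castSucc).ori c (Fin.last e) = X.ori c (Fin.last e) := fun X => if_neg hl
        rw [h8]
        have h9 : (Γ.flip a).ori c a = !Γ.ori c a := if_pos rfl
        induction c using Fin.lastCases with
        | last =>
          rw [ori_last_ins_last, ori_last_ins_last, h9]
          cases Γ.ori (Fin.last k) a <;> cases Γ.outer a <;> rfl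
        | cast c =>
          rw [ori_castSucc_ins_last, ori_castSucc_ins_last, h9]
          cases Γ.ori c.castSucc a <;> cases Γ.outer a <;> rfl
      | cast i => simp only [Graph.flip, ori_ins_castSucc, hcs]
  · have h6 : (Γ.flip b).outer a = Γ.outer a := by
      simp only [outer, hst]
      simp [Graph.flip, hab]
    have h7 : ∀ s, (Γ.flip b).endAt s a = Γ.endAt s a := by
      intro s
      cases s <;> simp [Graph.flip, hab]
    rw [h6]
    refine Graph.ext (funext fun i => ?_) (funext fun i => ?_) (funext fun c => funext fun i => ?_)
    · induction i using Fin.lastCases with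
      | last => simp only [Graph.flip, src_ins_last, if_neg hl]; exact congrArg _ (h7 _)
      | cast i =>
        simp only [Graph.flip, src_ins_castSucc, tgt_ins_castSucc, hcs]
        by_cases hi : i = b <;> by_cases hi' : i = a <;> simp_all
    · induction i using Fin.lastCases with
      | last => simp only [Graph.flip, tgt_ins_last, if_neg hl]
      | cast i =>
        simp only [Graph.flip, src_ins_castSucc, tgt_ins_castSucc, hcs]
        by_cases hi : i = b <;> by_cases hi' : i = a <;> simp_all
    · induction i using Fin.lastCases with
      | last =>
        have h8 : ∀ X : Graph (k + 1) (v + 1) (e + 1),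
          (X.flip b.castSucc).ori c (Fin.last e) = X.ori c (Fin.last e) := fun X => if_neg hl
        rw [h8]
        have h9 : (Γ.flip b).ori c a = Γ.ori c a := if_neg hab
        induction c using Fin.lastCases with
        | last => rw [ori_last_ins_last, ori_last_ins_last, h9]
        | cast c => rw [ori_castSucc_ins_last, ori_castSucc_ins_last, h9]
      | cast i => simp only [Graph.flip, ori_ins_castSucc, hcs]

theorem exists_extend : ∃ f : GraphComplex 𝕂 n s (k + 1) →ₗ[𝕂] GraphComplex 𝕂 n s (k + 1),
    ∀ {v e : ℕ} (Γ : Graph (k + 1) v e), Admissible s Γ → f (cls 𝕂 n s Γ) = insSum 𝕂 n s Γ :=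
  exists_descend 𝕂 n s (fun Γ => insSum 𝕂 n s Γ) (fun Γ σ _ => insSum_permV 𝕂 n s Γ σ)
    (fun Γ τ _ => insSum_permE 𝕂 n s Γ τ) (fun Γ a _ => insSum_flip 𝕂 n s Γ a)

variable (k) in
/-- The operator of degree `1` that makes the skeleton edges of length at least two longer. -/
def extend : GraphComplex 𝕂 n s (k + 1) →ₗ[𝕂] GraphComplex 𝕂 n s (k + 1) :=
  (exists_extend 𝕂 n s).choose

theorem extend_cls {Γ : Graph (k + 1) v e} (hΓ : Admissible s Γ) :
    extend 𝕂 n s k (cls 𝕂 n s Γ) = insSum 𝕂 n s Γ :=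
  (exists_extend 𝕂 n s).choose_spec Γ hΓ

theorem extend_mem_homogeneous {i : ℤ} {x : GraphComplex 𝕂 n s (k + 1)}
    (hx : x ∈ homogeneous 𝕂 n s (k + 1) i) :
    extend 𝕂 n s k x ∈ homogeneous 𝕂 n s (k + 1) (i + 1) := by
  rw [homogeneous_eq_span] at hx
  induction hx using Submodule.span_induction with
  | zero => rw [map_zero]; exact zero_mem _
  | add x y _ _ hx hy => rw [map_add]; exact add_mem hx hy
  | smul c x _ hx => rw [map_smul]; exact Submodule.smul_mem _ c hx
  | mem x hx =>
    obtain ⟨v, e, Γ, hΓ, hi, rfl⟩ := hx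
    rw [extend_cls 𝕂 n s hΓ, insSum]
    refine sum_mem fun a _ => cls_mem_homogeneous 𝕂 n s _ _ ?_
    rw [← hi]; push_cast; ring

/-- Inner edges persist under `extend`, so the case of a graph with an inner edge is clear.
Otherwise, subdividing away from `z` commutes with the reversal, while subdividing an edge at `z`
creates an inner edge, so that each of the two terms lies in `cross` by itself. -/
theorem extend_mem_cross (hs : s = Part.circ → 1 ≤ k) {x : GraphComplex 𝕂 n s (k + 1)}
    (hx : x ∈ cross 𝕂 n s k) : extend 𝕂 n s k x ∈ cross 𝕂 n s k := by
  induction hx using Submodule.span_induction with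
  | zero => rw [map_zero]; exact zero_mem _
  | add x y _ _ hx hy => rw [map_add]; exact add_mem hx hy
  | smul c x _ hx => rw [map_smul]; exact Submodule.smul_mem _ c hx
  | mem x hx =>
    obtain ⟨v, e, Γ, z, hΓ, hz, rfl⟩ := hx
    have h0 := hΓ.oriented.no_tadpole
    rw [map_add, extend_cls 𝕂 n s hΓ]
    by_cases h : Γ.HasInner
    · refine add_mem ?_ ?_
      · exact sum_mem fun a ha => cls_mem_cross 𝕂 n s hs (h.ins h0 (by simpa using ha) _)
      · by_cases hr : Admissible s (Γ.reverseLast {z})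
        · rw [extend_cls 𝕂 n s hr]
          exact sum_mem fun a ha => cls_mem_cross 𝕂 n s hs
            (HasInner.ins (Γ := Γ.reverseLast {z}) h0 (hasInner_reverseLast.2 h)
              (by simpa using ha) _)
        · rw [cls_of_not 𝕂 n s hr, map_zero]; exact zero_mem _
    · rw [extend_cls 𝕂 n s (admissible_reverseLast_singleton hΓ (hz.isolated h)), insSum, insSum]
      simp only [isEnd_reverseLast, outer_reverseLast]
      rw [← Finset.sum_add_distrib]
      refine sum_mem fun a ha => ?_
      have ha' : Γ.IsEnd a := by simpa using ha
      by_cases hza : Γ.Inc z a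
      · refine add_mem (cls_mem_cross 𝕂 n s hs (hasInner_ins h0 (straight_inner ha')))
          (cls_mem_cross 𝕂 n s hs (hasInner_ins (Γ := Γ.reverseLast {z}) h0 ?_))
        rw [straight_reverseLast]
        exact straight_inner ha'
      · rw [ins_reverseLast (h0 a) hza]
        exact add_mem_cross 𝕂 n s ((straight_ins_castSucc _ (h0 a) z).2 hz)

/-! ### The differential preserves the dagger part -/

theorem contract_reverseLast {Γ : Graph (k + 1) (w + 2) (e + 1)} {t : Fin (e + 1)}
    (ht : Γ.src t ≠ Γ.tgt t) {z : Fin (w + 2)} (hz : ¬ Γ.Inc z t) :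
    (Γ.reverseLast {z}).contract t = (Γ.contract t).reverseLast {Γ.proj t z} := by
  refine Graph.ext rfl rfl (funext fun c => funext fun i => ?_)
  have h1 : (Γ.reverseLast {z}).ori c (t.succAbove i) =
    ((Γ.contract t).reverseLast {Γ.proj t z}).ori c i := by
    induction c using Fin.lastCases with
    | last =>
      rw [ori_last_reverseLast, ori_last_reverseLast]
      simp only [Finset.mem_singleton, exists_eq_left, inc_contract_of_not_inc ht hz]
      rfl
    | cast c => rw [ori_castSucc_reverseLast, ori_castSucc_reverseLast]; rfl
  exact h1

/-- The surviving edges have the same colours: in the first colours because `z` passes, in the last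
because `z` does not pass but one of the two graphs is reversed there. -/
theorem cterm_reverseLast_pair {Γ : Graph (k + 1) (w + 2) (e + 1)} (hΓ : Admissible s Γ)
    {z : Fin (w + 2)} (hz : Γ.Straight z) {a b : Fin (e + 1)} (hab : Γ.EdgePair z a b) :
    cterm 𝕂 n s Γ a = -cterm 𝕂 n s (Γ.reverseLast {z}) b := by
  have h0 := hΓ.oriented.no_tadpole
  refine cterm_pair 𝕂 n s rfl rfl hab h0 (fun c i hia hib => ?_) (fun c => ?_)
  · have : ¬ ∃ x ∈ ({z} : Finset _), Γ.Inc x i := by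
      simp only [Finset.mem_singleton, exists_eq_left, hab.2]
      tauto
    simp only [reverseLast, this, and_false, if_false]
  · induction c using Fin.lastCases with
    | last =>
      rw [tail_last_reverseLast_of_inc ⟨z, by simp, hab.left⟩]
      have h1 := hz.not_passesIn_last hΓ
      rw [hab.passesIn h0] at h1
      have h2 := head_eq_iff (h0 b) (Fin.last k) hab.right
      tauto
    | cast c =>
      rw [tail_castSucc_reverseLast]
      exact (hab.symm.passesIn h0 _).1 (hz.2 c)

/-- Contractions away from `z` commute with the reversal and keep `z` straight. The four
contractions of edges at `z`, two in each graph, cancel in pairs, each of `a` against one of `b`. -/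
theorem differential_mem_cross {x : GraphComplex 𝕂 n s (k + 1)}
    (hx : x ∈ cross 𝕂 n s k) : differential 𝕂 n s (k + 1) x ∈ cross 𝕂 n s k := by
  induction hx using Submodule.span_induction with
  | zero => rw [map_zero]; exact zero_mem _
  | add x y _ _ hx hy => rw [map_add]; exact add_mem hx hy
  | smul c x _ hx => rw [map_smul]; exact Submodule.smul_mem _ c hx
  | mem x hx =>
    obtain ⟨v, e, Γ, z, hΓ, hz, rfl⟩ := hx
    obtain ⟨w, e, rfl, rfl⟩ := hΓ.exists_size
    have h0 := hΓ.oriented.no_tadpole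
    obtain ⟨a, b, hab⟩ := exists_edgePair hz.1
    rw [map_add, differential_cls_of_pre 𝕂 n s hΓ.pre,
      differential_cls_of_pre 𝕂 n s hΓ.pre.reverseLast, ← Finset.sum_add_distrib,
      ← Finset.add_sum_erase _ _ (Finset.mem_univ a),
      ← Finset.add_sum_erase _ _ (Finset.mem_erase.2 ⟨hab.1.symm, Finset.mem_univ b⟩),
      cterm_reverseLast_pair 𝕂 n s hΓ hz hab, cterm_reverseLast_pair 𝕂 n s hΓ hz hab.symm,
      ← add_assoc]
    refine add_mem ?_ (sum_mem fun t ht => ?_)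
    · convert zero_mem (cross 𝕂 n s k) using 1
      abel
    · have ht' : ¬ Γ.Inc z t := by
        simp only [Finset.mem_erase] at ht
        rw [hab.2]; tauto
      rw [cterm, cterm, contract_reverseLast (h0 t) ht']
      have h1 : (Γ.reverseLast {z}).contractSign n t = Γ.contractSign n t := rfl
      rw [h1, ← smul_add]
      exact unit_smul_mem 𝕂 _ (add_mem_cross 𝕂 n s ((straight_contract_of_not_inc (h0 t) ht').2 hz))

end Extend

end OGC

namespace OGC

namespace Graph

variable {K k v e w : ℕ}

/-! ### Contractions and straight vertices -/

theorem inc_iff_endAt_or {Γ : Graph K v e} {x : Fin v} {a : Fin e} (r : Bool) :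
    Γ.Inc x a ↔ x = Γ.endAt r a ∨ x = Γ.endAt (!r) a := by
  cases r <;> simp [Inc, eq_comm, or_comm]

theorem endAt_ne {Γ : Graph K v e} {a : Fin e} (h : Γ.src a ≠ Γ.tgt a) (r : Bool) :
    Γ.endAt (!r) a ≠ Γ.endAt r a := by
  cases r
  · exact h.symm
  · exact h

theorem valence_contract_endAt {Γ : Graph K (w + 2) (e + 1)} {t : Fin (e + 1)}
    (ht : Γ.src t ≠ Γ.tgt t) (hp : Γ.NoParallel t) (r : Bool) :
    (Γ.contract t).valence (Γ.proj t (Γ.endAt r t)) + 2 =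
      Γ.valence (Γ.endAt r t) + Γ.valence (Γ.endAt (!r) t) := by
  rw [valence_contract_of_inc ht hp (inc_endAt Γ r t)]
  cases r
  · rfl
  · exact add_comm _ _

section Straight

variable {s : Part} {Γ : Graph (k + 1) (w + 2) (e + 1)} {t : Fin (e + 1)}

theorem NoParallel.edgePair_ne (hp : Γ.NoParallel t) {b d : Fin (e + 1)} {r : Bool}
    (hb : Γ.EdgePair (Γ.endAt r t) t b) (hd : Γ.EdgePair (Γ.endAt (!r) t) t d) : b ≠ d := by
  rintro rfl
  have h1 := hb.right
  have h2 := hd.right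
  cases r
  · exact hp b hb.1.symm ⟨h1, h2⟩
  · exact hp b hb.1.symm ⟨h2, h1⟩

theorem passesIn_contract_endAt (h0 : ∀ a, Γ.src a ≠ Γ.tgt a) (hp : Γ.NoParallel t) {r : Bool}
    (h1 : Γ.valence (Γ.endAt r t) = 2) (h2 : Γ.valence (Γ.endAt (!r) t) = 2) (c : Fin (k + 1)) :
    (Γ.contract t).PassesIn c (Γ.proj t (Γ.endAt r t)) ↔
      (Γ.PassesIn c (Γ.endAt r t) ↔ Γ.PassesIn c (Γ.endAt (!r) t)) := by
  obtain ⟨b, hb⟩ := exists_edgePair_of_inc h1 (inc_endAt Γ r t)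
  obtain ⟨d, hd⟩ := exists_edgePair_of_inc h2 (inc_endAt Γ (!r) t)
  have hbd := hp.edgePair_ne hb hd
  obtain ⟨b, rfl⟩ := Fin.exists_succAbove_eq hb.1.symm
  obtain ⟨d, rfl⟩ := Fin.exists_succAbove_eq hd.1.symm
  exact passesIn_contract_of_inc (endAt_ne (h0 t) r) h0 hb hd (fun h => hbd (by rw [h]))
    ((noParallel_iff h0).1 hp) c

/-- Both ends pass in the first colours and neither passes in the last, so by the product rule for
merging the new vertex passes in all colours. -/
theorem not_admissible_contract (hs : s = Part.circ → 1 ≤ k) (hΓ : Admissible s Γ)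
    (h1 : Γ.Straight (Γ.src t)) (h2 : Γ.Straight (Γ.tgt t)) : ¬ Admissible s (Γ.contract t) := by
  intro h
  have h0 := hΓ.oriented.no_tadpole
  have hp := noParallel_of_straight hs hΓ h1 h2
  have h3 := passesIn_contract_endAt (r := false) h0 hp h1.1 h2.1
  have h4 := valence_contract_endAt (h0 t) hp false
  rw [show Γ.valence (Γ.endAt false t) = 2 from h1.1,
    show Γ.valence (Γ.endAt (!false) t) = 2 from h2.1] at h4
  refine h.not_passing (Γ.proj t (Γ.src t)) ⟨by simpa using h4, fun c => (h3 c).2 ?_⟩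
  induction c using Fin.lastCases with
  | last => exact iff_of_false (h1.not_passesIn_last hΓ) (h2.not_passesIn_last hΓ)
  | cast c => exact iff_of_true (h1.2 c) (h2.2 c)

/-- Contracting an edge from a straight vertex to a vertex that is not straight gives a vertex
that is not straight. -/
theorem not_straight_contract (h0 : ∀ a, Γ.src a ≠ Γ.tgt a) (hp : Γ.NoParallel t) {r : Bool}
    (hz : Γ.Straight (Γ.endAt r t)) (hx : ¬ Γ.Straight (Γ.endAt (!r) t)) :
    ¬ (Γ.contract t).Straight (Γ.proj t (Γ.endAt r t)) := by
  intro h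
  have h4 := valence_contract_endAt (h0 t) hp r
  rw [h.1, hz.1] at h4
  have h5 : Γ.valence (Γ.endAt (!r) t) = 2 := by omega
  refine hx ⟨h5, fun c => ?_⟩
  have := (passesIn_contract_endAt h0 hp hz.1 h5 c.castSucc).1 (h.2 c)
  exact this.1 (hz.2 c)

/-- This is the contraction of the outermost edge `t` of a skeleton edge of length at least 3, which
runs from the skeleton vertex `x` over `z` to the straight vertex `y`. The merged vertex is not
straight, hence not passing. The only other edge at `z` goes to `y ≠ x`, so `t` has no parallel
edge. It remains to exclude new cycles. -/
theorem admissible_contract (hΓ : Admissible s Γ) {b : Fin (e + 1)} {r q : Bool}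
    (hz : Γ.Straight (Γ.endAt r t)) (hx : ¬ Γ.Straight (Γ.endAt (!r) t))
    (hb : Γ.EdgePair (Γ.endAt r t) t b) (hq : Γ.endAt q b = Γ.endAt r t)
    (hy : Γ.Straight (Γ.endAt (!q) b)) : Admissible s (Γ.contract t) := by
  have h0 := hΓ.oriented.no_tadpole
  set z := Γ.endAt r t with hzdef
  set x := Γ.endAt (!r) t with hxdef
  set y := Γ.endAt (!q) b with hydef
  have hxz : x ≠ z := endAt_ne (h0 t) r
  have hyz : y ≠ z := by rw [← hq]; exact endAt_ne (h0 b) q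
  have hyx : y ≠ x := by rintro h; exact hx (h ▸ hy)
  have hinct : ∀ p, Γ.Inc p t ↔ p = z ∨ p = x := fun p => inc_iff_endAt_or r
  have hincb : ∀ p, Γ.Inc p b ↔ p = z ∨ p = y := fun p => by
    rw [inc_iff_endAt_or q, hq]
  have hyt : ¬ Γ.Inc y t := by rw [hinct]; tauto
  have hp : Γ.NoParallel t := by
    intro i hi h
    have h1 : Γ.Inc z i ∧ Γ.Inc x i := by
      rw [hzdef, hxdef]
      cases r
      · exact h
      · exact h.symm
    have h2 := ((hb.2 i).1 h1.1).resolve_left hi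
    rw [h2] at h1
    rcases (hincb x).1 h1.2 with h3 | h3
    exacts [hxz h3, hyx h3.symm]
  have hm := not_straight_contract h0 hp hz hx
  -- A rank function descends to the contraction by giving the merged vertex the rank of `x`: the
  -- chosen representative is never `z`.
  have hg : ∀ f : Fin (w + 2) → ℤ, ∃ g : Fin (w + 1) → ℤ, ∀ p, p ≠ z → g (Γ.proj t p) = f p := by
    intro f
    refine ⟨fun p' => f (Classical.epsilon fun p => p ≠ z ∧ Γ.proj t p = p'), fun p hpz => ?_⟩
    have h1 := Classical.epsilon_spec (p := fun p' => p' ≠ z ∧ Γ.proj t p' = Γ.proj t p)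
      ⟨p, hpz, rfl⟩
    dsimp only
    congr 1
    rcases (proj_eq_iff (h0 t) _ _).1 h1.2 with h2 | h2
    · exact h2
    · rw [hinct, hinct] at h2
      rw [h2.1.resolve_left h1.1, h2.2.resolve_left hpz]
  have hne : ∀ i, t.succAbove i ≠ b → ¬ Γ.Inc z (t.succAbove i) := by
    intro i hi
    rw [hb.2]
    rintro (h | h)
    exacts [Fin.succAbove_ne t i h, hi h]
  refine (hΓ.pre.contract hp).admissible (fun c => ?_) (fun p hpp => ?_)
  · obtain ⟨f, hf⟩ := hΓ.oriented.ranked c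
    obtain ⟨g, hg⟩ := hg f
    have hgen : ∀ i, t.succAbove i ≠ b →
        g ((Γ.contract t).tail c i) < g ((Γ.contract t).head c i) := by
      intro i hi
      have h1 := hne i hi
      rw [inc_iff_head_or_tail c, not_or] at h1
      rw [tail_contract, head_contract, hg _ h1.2, hg _ h1.1]
      exact hf _
    induction c using Fin.lastCases with
    | last =>
      have h1 : ¬ (Γ.contract t).PassesIn (Fin.last k) (Γ.proj t y) := by
        rw [passesIn_contract_of_not_inc (h0 t) hyt]
        exact hy.not_passesIn_last hΓ
      have h2 : (Γ.contract t).valence (Γ.proj t y) = 2 := by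
        rw [valence_contract_of_not_inc (h0 t) hyt]; exact hy.1
      -- In the last colour the ranks of `x` and `y` need not compare in the direction of `b`. But
      -- `y` is a source or a sink, so the edges at `y`, among them `b`, can be ignored.
      refine ranked_of_extremal _ ((not_passesIn_iff h2 _).1 h1) ⟨g, fun i hi => hgen i ?_⟩
      rintro h
      rw [inc_contract_of_not_inc (h0 t) hyt, h] at hi
      exact hi (inc_endAt Γ _ _)
    | cast c =>
      refine ⟨g, fun i => ?_⟩
      by_cases hi : t.succAbove i = b
      -- As `z` passes in this colour, `t` and `b` form a directed path between `x` and `y`, and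
      -- their inequalities compose.
      · have h1 := (hb.passesIn h0 _).1 (hz.2 c)
        have h2 := hf t
        have h3 := hf b
        have h4 : Γ.proj t z = Γ.proj t x :=
          (proj_eq_iff (h0 t) _ _).2 (Or.inr ⟨(hinct z).2 (Or.inl rfl), (hinct x).2 (Or.inr rfl)⟩)
        rw [tail_contract, head_contract, hi]
        have h5 := head_ne_tail (h0 t) c.castSucc
        have h6 := head_ne_tail (h0 b) c.castSucc
        have h7 : ∀ p, (Γ.head c.castSucc t = p ∨ Γ.tail c.castSucc t = p) ↔ p = z ∨ p = x :=
          fun p => by rw [← inc_iff_head_or_tail, hinct]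
        have h8 : ∀ p, (Γ.head c.castSucc b = p ∨ Γ.tail c.castSucc b = p) ↔ p = z ∨ p = y :=
          fun p => by rw [← inc_iff_head_or_tail, hincb]
        by_cases h9 : Γ.head c.castSucc t = z
        · have h10 := h1.1 h9
          have h11 : Γ.tail c.castSucc t = x := by
            have := (h7 x).2 (Or.inr rfl)
            rw [h9] at this
            exact this.resolve_left hxz.symm
          have h12 : Γ.head c.castSucc b = y := by
            have := (h8 y).2 (Or.inr rfl)
            rw [h10] at this
            exact this.resolve_right hyz.symm
          rw [h10, h12, h4, hg _ hxz, hg _ hyz]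
          rw [h9, h11] at h2
          rw [h10, h12] at h3
          exact h2.trans h3
        · have h10 : Γ.tail c.castSucc b ≠ z := fun h => h9 (h1.2 h)
          have h11 : Γ.tail c.castSucc t = z := ((h7 z).2 (Or.inl rfl)).resolve_left h9
          have h12 : Γ.head c.castSucc b = z := ((h8 z).2 (Or.inl rfl)).resolve_right h10
          have h13 : Γ.head c.castSucc t = x := by
            have := (h7 x).2 (Or.inr rfl)
            rw [h11] at this
            exact this.resolve_right hxz.symm
          have h14 : Γ.tail c.castSucc b = y := by
            have := (h8 y).2 (Or.inr rfl)
            rw [h12] at this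
            exact this.resolve_left hyz.symm
          rw [h12, h14, h4, hg _ hxz, hg _ hyz]
          rw [h11, h13] at h2
          rw [h12, h14] at h3
          exact h3.trans h2
      · exact hgen i hi
  · obtain ⟨p, rfl⟩ := proj_surjective Γ t p
    by_cases hpt : Γ.Inc p t
    · rw [(proj_eq_of_inc (h0 t) (inc_endAt Γ r t) p).2 hpt] at hpp
      exact hm hpp.straight
    · exact hΓ.not_passing p ((passing_contract_of_not_inc (h0 t) hpt).1 hpp)

end Straight

/-- `Γ` is the contraction of the new edge, and this edge is the outermost one of a skeleton edge of
length at least 3. -/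
theorem admissible_of_ins {s : Part} {Γ : Graph (k + 1) (w + 1) (e + 1)}
    (h0 : ∀ a, Γ.src a ≠ Γ.tgt a) {a : Fin (e + 1)} (ha : Γ.IsEnd a)
    (h : Admissible s (Γ.ins a (Γ.outer a))) : Admissible s Γ := by
  have h1 := edgePair_ins_last (Γ := Γ) (a := a) (Γ.outer a)
  rw [← contract_ins_last Γ a (Γ.outer a)]
  refine admissible_contract h (r := true) (q := Γ.outer a) (b := a.castSucc) ?_ ?_ ?_ ?_ ?_
  · rw [endAt_true, tgt_ins_last]; exact straight_ins_last _ h0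
  · rw [Bool.not_true, endAt_false, src_ins_last, straight_ins_castSucc _ (h0 a)]
    exact not_straight_outer ha
  · rw [endAt_true, tgt_ins_last]
    exact h1.symm
  · rw [endAt_true, tgt_ins_last, endAt_ins_castSucc, if_pos ⟨rfl, rfl⟩]
  · rw [endAt_ins_castSucc, if_neg (by simp), straight_ins_castSucc _ (h0 a)]
    exact straight_inner ha

end Graph

end OGC

namespace OGC

open _root_.OGC.Graph

/-! ### Contracting an edge at a straight vertex and subdividing again -/

section Transfer

variable (𝕂 : Type*) [Field 𝕂] (n : ℤ) (s : Part) {k v e w : ℕ}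

/-- The permutation that makes the element `p` the last one. -/
theorem exists_perm_last {m : ℕ} (p : Fin (m + 1)) : ∃ σ : Equiv.Perm (Fin (m + 1)),
    σ p = Fin.last m ∧ (∀ i, σ (p.succAbove i) = i.castSucc) ∧
      Equiv.Perm.sign σ = (-1) ^ (m - (p : ℕ)) := by
  refine ⟨(Fin.last m).cycleRange.symm * p.cycleRange, ?_, fun i => ?_, ?_⟩
  · rw [Equiv.Perm.mul_apply, Fin.cycleRange_self, Fin.cycleRange_symm_zero]
  · rw [Equiv.Perm.mul_apply, Fin.cycleRange_succAbove, Fin.cycleRange_symm_succ,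
      Fin.succAbove_last_apply]
  · rw [map_mul, Equiv.Perm.sign_symm, Fin.sign_cycleRange, Fin.sign_cycleRange,
      neg_one_pow_tsub' (by omega), Fin.val_last]

section Move

variable {Γ : Graph (k + 1) (w + 2) (e + 1)} {t : Fin (e + 1)} {b : Fin e} {q : Bool}

theorem ori_castSucc_of_edgePair (h0 : ∀ a, Γ.src a ≠ Γ.tgt a)
    (hz : Γ.Straight (Γ.tgt t)) (hb : Γ.EdgePair (Γ.tgt t) t (t.succAbove b))
    (hq : Γ.endAt q (t.succAbove b) = Γ.tgt t) (c : Fin k) :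
    Γ.ori c.castSucc t = (Γ.ori c.castSucc (t.succAbove b) != q) := by
  have h1 := (hb.passesIn h0 _).1 (hz.2 c)
  have h2 := h0 t
  have h3 := h0 (t.succAbove b)
  rw [head_eq_endAt, tail_eq_endAt, ← hq] at h1
  cases q <;> cases h4 : Γ.ori c.castSucc t <;> cases h5 : Γ.ori c.castSucc (t.succAbove b) <;>
    simp_all <;> first | exact h0 _ (hq.trans h1.symm) | exact h0 _ (h1.trans hq.symm)

theorem ori_last_of_edgePair (h0 : ∀ a, Γ.src a ≠ Γ.tgt a)
    (hz : ¬ Γ.PassesIn (Fin.last k) (Γ.tgt t)) (hb : Γ.EdgePair (Γ.tgt t) t (t.succAbove b))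
    (hq : Γ.endAt q (t.succAbove b) = Γ.tgt t) :
    Γ.ori (Fin.last k) t = (Γ.ori (Fin.last k) (t.succAbove b) == q) := by
  rw [hb.passesIn h0] at hz
  have h2 := h0 t
  have h3 := h0 (t.succAbove b)
  rw [head_eq_endAt, tail_eq_endAt, ← hq] at hz
  cases q <;> cases h4 : Γ.ori (Fin.last k) t <;>
    cases h5 : Γ.ori (Fin.last k) (t.succAbove b) <;> simp_all <;>
    first | exact h0 _ (hq.trans hz.symm) | exact h0 _ (hz.trans hq.symm)

theorem contractSign_eq_sign {σ : Equiv.Perm (Fin (w + 2))} {τ : Equiv.Perm (Fin (e + 1))}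
    (hσ : Equiv.Perm.sign σ = (-1) ^ (w + 1 - (Γ.tgt t : ℕ)))
    (hτ : Equiv.Perm.sign τ = (-1) ^ (e - (t : ℕ))) :
    signV n σ * signE n τ = Γ.contractSign n t := by
  by_cases hn : Even n
  · simp [signV, signE, contractSign, hn, hτ]
  · simp [signV, signE, contractSign, hn, hσ]

theorem proj_of_ne {y : Fin (w + 2)} {σ : Equiv.Perm (Fin (w + 2))}
    (h : ∀ i, σ ((Γ.tgt t).succAbove i) = i.castSucc) (hy : y ≠ Γ.tgt t) :
    (Γ.proj t y).castSucc = σ y := by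
  obtain ⟨i, rfl⟩ := Fin.exists_succAbove_eq hy
  rw [h, proj, merge_of_ne hy, renumber_succAbove]

theorem proj_tgt : Γ.proj t (Γ.tgt t) = Γ.proj t (Γ.src t) := by
  simp [proj, merge]

/-- Subdividing `b` at the end where `z` was restores the graph, with `z` moved to the last vertex
and `t` to the last edge. The sign of this move is the sign of the contraction, so the two cancel.
-/
theorem cls_ins_contract_same_of_tgt (h0 : ∀ a, Γ.src a ≠ Γ.tgt a)
    (hz : Γ.Straight (Γ.tgt t)) (hz' : ¬ Γ.PassesIn (Fin.last k) (Γ.tgt t))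
    (hb : Γ.EdgePair (Γ.tgt t) t (t.succAbove b))
    (hq : Γ.endAt q (t.succAbove b) = Γ.tgt t) :
    Γ.contractSign n t • cls 𝕂 n s ((Γ.contract t).ins b q) = cls 𝕂 n s Γ := by
  obtain ⟨σ, hσ1, hσ2, hσ3⟩ := exists_perm_last (Γ.tgt t)
  obtain ⟨τ, hτ1, hτ2, hτ3⟩ := exists_perm_last t
  have hne : ∀ i, i ≠ b → ¬ Γ.Inc (Γ.tgt t) (t.succAbove i) := by
    intro i hi
    rw [hb.2]
    rintro (h | h)
    exacts [Fin.succAbove_ne t i h, hi (Fin.succAbove_right_injective h)]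
  have hend : ∀ (r : Bool) (i : Fin e), ¬ (i = b ∧ r = q) →
      (Γ.proj t (Γ.endAt r (t.succAbove i))).castSucc = σ (Γ.endAt r (t.succAbove i)) := by
    intro r i hi
    refine proj_of_ne hσ2 fun h => hi ?_
    by_cases hib : i = b
    · subst hib
      refine ⟨rfl, ?_⟩
      by_contra hr
      rw [show r = !q by cases r <;> cases q <;> simp_all, ← hq] at h
      exact endAt_ne (h0 _) q h
    · exact absurd (h ▸ inc_endAt Γ r _) (hne i hib)
  have key := cls_rename 𝕂 n s (Γ := Γ) (Γ' := (Γ.contract t).ins b q) σ τ ∅ ?_ ?_ ?_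
  · rw [Finset.card_empty, pow_zero, mul_one, contractSign_eq_sign n hσ3 hτ3] at key
    rw [key, smul_smul, Int.units_mul_self, one_smul]
  · intro a
    rw [if_neg (Finset.notMem_empty _)]
    by_cases ha : a = t
    · subst ha
      rw [hτ1, src_ins_last, endAt_contract, hq, proj_tgt, proj_of_ne hσ2 (h0 a)]
    · obtain ⟨i, rfl⟩ := Fin.exists_succAbove_eq ha
      rw [hτ2, src_ins_castSucc]
      split_ifs with h
      · rw [← hσ1, ← hq, h.1, h.2]; rfl
      · exact hend false i (fun h' => h ⟨h'.1, h'.2.symm⟩)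
  · intro a
    rw [if_neg (Finset.notMem_empty _)]
    by_cases ha : a = t
    · subst ha
      rw [hτ1, tgt_ins_last, hσ1]
    · obtain ⟨i, rfl⟩ := Fin.exists_succAbove_eq ha
      rw [hτ2, tgt_ins_castSucc]
      split_ifs with h
      · rw [← hσ1, ← hq, h.1, h.2]; rfl
      · exact hend true i (fun h' => h ⟨h'.1, h'.2.symm⟩)
  · intro c a
    rw [if_neg (Finset.notMem_empty _)]
    by_cases ha : a = t
    · subst ha
      rw [hτ1]
      induction c using Fin.lastCases with
      | last => rw [ori_last_ins_last, ori_last_of_edgePair h0 hz' hb hq]; rfl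
      | cast c => rw [ori_castSucc_ins_last, ori_castSucc_of_edgePair h0 hz hb hq]; rfl
    · obtain ⟨i, rfl⟩ := Fin.exists_succAbove_eq ha
      rw [hτ2, ori_ins_castSucc]; rfl

/-- Subdividing `b` at its other end exchanges the roles of the two edges at `z`: `b` now lies where
`t` was, and the new edge where `b` was. In the last colour `b` keeps its direction along the
string, and since `z` does not pass, this reverses the colour at `z`. -/
theorem cls_ins_contract_other_of_tgt (h0 : ∀ a, Γ.src a ≠ Γ.tgt a)
    (hz : Γ.Straight (Γ.tgt t)) (hz' : ¬ Γ.PassesIn (Fin.last k) (Γ.tgt t))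
    (hb : Γ.EdgePair (Γ.tgt t) t (t.succAbove b))
    (hq : Γ.endAt q (t.succAbove b) = Γ.tgt t) :
    Γ.contractSign n t • cls 𝕂 n s ((Γ.contract t).ins b (!q)) =
      -cls 𝕂 n s (Γ.reverseLast {Γ.tgt t}) := by
  obtain ⟨σ, hσ1, hσ2, hσ3⟩ := exists_perm_last (Γ.tgt t)
  obtain ⟨τ, hτ1, hτ2, hτ3⟩ := exists_perm_last t
  have hbt : t.succAbove b ≠ t := Fin.succAbove_ne t b
  have hne : ∀ i, i ≠ b → ¬ Γ.Inc (Γ.tgt t) (t.succAbove i) := by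
    intro i hi
    rw [hb.2]
    rintro (h | h)
    exacts [Fin.succAbove_ne t i h, hi (Fin.succAbove_right_injective h)]
  have hend : ∀ (r : Bool) (i : Fin e), i ≠ b →
      (Γ.proj t (Γ.endAt r (t.succAbove i))).castSucc = σ (Γ.endAt r (t.succAbove i)) :=
    fun r i hi => proj_of_ne hσ2 fun h => absurd (h ▸ inc_endAt Γ r _) (hne i hi)
  have hy : (Γ.proj t (Γ.endAt (!q) (t.succAbove b))).castSucc =
      σ (Γ.endAt (!q) (t.succAbove b)) :=
    proj_of_ne hσ2 (by rw [← hq]; exact endAt_ne (h0 _) q)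
  have hx : (Γ.proj t (Γ.endAt q (t.succAbove b))).castSucc = σ (Γ.src t) := by
    rw [hq, proj_tgt, proj_of_ne hσ2 (h0 t)]
  have hq' : σ (Γ.endAt q (t.succAbove b)) = Fin.last _ := by rw [hq, hσ1]
  have hz1 : ∃ x ∈ ({Γ.tgt t} : Finset _), Γ.Inc x t := by simpa using hb.left
  have hz2 : ∃ x ∈ ({Γ.tgt t} : Finset _), Γ.Inc x (t.succAbove b) := by simpa using hb.right
  have hτt : (τ * Equiv.swap t (t.succAbove b)) t = b.castSucc := by simp [hτ2]
  have hτb : (τ * Equiv.swap t (t.succAbove b)) (t.succAbove b) = Fin.last e := by simp [hτ1]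
  have hτi : ∀ i, i ≠ b →
      (τ * Equiv.swap t (t.succAbove b)) (t.succAbove i) = i.castSucc := by
    intro i hi
    rw [Equiv.Perm.mul_apply, Equiv.swap_apply_of_ne_of_ne (Fin.succAbove_ne t i)
      (fun h => hi (Fin.succAbove_right_injective h)), hτ2]
  -- Exactly one of the two edges at `z` changes its intrinsic orientation, and which one depends on
  -- `q`. The sign comes from this flip for `n` odd and from the transposition of the two edges for
  -- `n` even.
  set B : Finset (Fin (e + 1)) := {if q then t else t.succAbove b} with hB
  have hBt : t ∈ B ↔ q = true := by
    cases q <;> simp [hB, hbt.symm]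
  have hBb : t.succAbove b ∈ B ↔ q = false := by
    cases q <;> simp [hB, hbt]
  have hBi : ∀ i, i ≠ b → t.succAbove i ∉ B := by
    intro i hi
    cases q <;> simp [hB, Fin.succAbove_ne, hi]
  have key := cls_rename 𝕂 n s (Γ := Γ.reverseLast {Γ.tgt t}) (Γ' := (Γ.contract t).ins b (!q))
    σ (τ * Equiv.swap t (t.succAbove b)) B ?_ ?_ ?_
  · have hsign : signV n σ * signE n (τ * Equiv.swap t (t.succAbove b)) * signFlip n ^ B.card =
        -Γ.contractSign n t := by
      rw [← contractSign_eq_sign n hσ3 hτ3, hB, Finset.card_singleton, pow_one]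
      by_cases hn : Even n
      · simp [signV, signE, signFlip, hn, Equiv.Perm.sign_swap hbt.symm]
      · simp [signV, signE, signFlip, hn]
    rw [key, hsign, smul_smul, mul_neg, Int.units_mul_self, Units.neg_smul, one_smul]
  · intro a
    by_cases ha : a = t
    · subst ha
      rw [hτt, src_ins_castSucc, src_contract]
      simp only [hBt]
      cases q
      · simpa [reverseLast] using hx
      · simpa [reverseLast] using hσ1.symm
    · obtain ⟨i, rfl⟩ := Fin.exists_succAbove_eq ha
      by_cases hi : i = b
      · subst hi
        rw [hτb, src_ins_last, endAt_contract, hy]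
        simp only [hBb]
        cases q <;> simp [reverseLast]
      · rw [hτi i hi, src_ins_castSucc, if_neg (fun h => hi h.1), if_neg (hBi i hi)]
        exact hend false i hi
  · intro a
    by_cases ha : a = t
    · subst ha
      rw [hτt, tgt_ins_castSucc, tgt_contract]
      simp only [hBt]
      cases q
      · simpa [reverseLast] using hσ1.symm
      · simpa [reverseLast] using hx
    · obtain ⟨i, rfl⟩ := Fin.exists_succAbove_eq ha
      by_cases hi : i = b
      · subst hi
        rw [hτb, tgt_ins_last, ← hq']
        simp only [hBb]
        cases q <;> simp [reverseLast]
      · rw [hτi i hi, tgt_ins_castSucc, if_neg (fun h => hi h.1), if_neg (hBi i hi)]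
        exact hend true i hi
  · intro c a
    by_cases ha : a = t
    · subst ha
      rw [hτt, ori_ins_castSucc]
      simp only [hBt]
      change Γ.ori c (a.succAbove b) = _
      induction c using Fin.lastCases with
      | last =>
        rw [ori_last_reverseLast, if_pos hz1, ori_last_of_edgePair h0 hz' hb hq]
        cases q <;> simp
      | cast c =>
        rw [ori_castSucc_reverseLast, ori_castSucc_of_edgePair h0 hz hb hq]
        cases q <;> simp
    · obtain ⟨i, rfl⟩ := Fin.exists_succAbove_eq ha
      by_cases hi : i = b
      · subst hi
        rw [hτb]
        simp only [hBb]
        induction c using Fin.lastCases with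
        | last =>
          rw [ori_last_ins_last, ori_last_reverseLast, if_pos hz2]
          change (Γ.ori _ (t.succAbove i) == !q) = _
          cases q <;> simp
        | cast c =>
          rw [ori_castSucc_ins_last, ori_castSucc_reverseLast]
          change (Γ.ori _ (t.succAbove i) != !q) = _
          cases q <;> simp
      · rw [hτi i hi, ori_ins_castSucc, if_neg (hBi i hi)]
        have h3 : ¬ ∃ x ∈ ({Γ.tgt t} : Finset _), Γ.Inc x (t.succAbove i) := by
          simpa using hne i hi
        simp only [reverseLast, h3, and_false, if_false]; rfl

end Move

theorem reverseLast_flip (S : Finset (Fin v)) (Γ : Graph (k + 1) v e) (b : Fin e) :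
    (Γ.flip b).reverseLast S = (Γ.reverseLast S).flip b := by
  refine Graph.ext rfl rfl (funext fun c => funext fun i => ?_)
  simp only [reverseLast, inc_flip]
  by_cases h2 : i = b
  · subst h2
    by_cases h1 : c = Fin.last k ∧ ∃ z ∈ S, Γ.Inc z i <;> simp [Graph.flip, h1]
  · simp [Graph.flip, h2]

theorem cls_ins_contract_flip (Γ : Graph (k + 1) (w + 2) (e + 1)) {t : Fin (e + 1)}
    (ht : Γ.src t ≠ Γ.tgt t) (b : Fin e) (q : Bool) :
    (Γ.flip t).contractSign n t • cls 𝕂 n s (((Γ.flip t).contract t).ins b q) =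
      signFlip n • Γ.contractSign n t • cls 𝕂 n s ((Γ.contract t).ins b q) := by
  obtain ⟨σ', h1, h2⟩ := contract_flip_sign n Γ ht
  rw [h1, cls_ins_permV, smul_smul, h2, smul_smul]

theorem cls_ins_contract {Γ : Graph (k + 1) (w + 2) (e + 1)} {t : Fin (e + 1)} {b : Fin e}
    {r q : Bool} (h0 : ∀ a, Γ.src a ≠ Γ.tgt a) (hz : Γ.Straight (Γ.endAt r t))
    (hz' : ¬ Γ.PassesIn (Fin.last k) (Γ.endAt r t))
    (hb : Γ.EdgePair (Γ.endAt r t) t (t.succAbove b))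
    (hq : Γ.endAt q (t.succAbove b) = Γ.endAt r t) :
    Γ.contractSign n t • cls 𝕂 n s ((Γ.contract t).ins b q) = cls 𝕂 n s Γ ∧
    Γ.contractSign n t • cls 𝕂 n s ((Γ.contract t).ins b (!q)) =
      -cls 𝕂 n s (Γ.reverseLast {Γ.endAt r t}) := by
  cases r with
  | true => exact ⟨cls_ins_contract_same_of_tgt 𝕂 n s h0 hz hz' hb hq,
      cls_ins_contract_other_of_tgt 𝕂 n s h0 hz hz' hb hq⟩
  | false =>
    have hr := Γ.renames_flip t
    have h1 : (Γ.flip t).tgt t = Γ.src t := by simp [Graph.flip]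
    have h2 : (Γ.flip t).endAt q (t.succAbove b) = Γ.endAt q (t.succAbove b) := by
      cases q <;> simp [Graph.flip, Fin.succAbove_ne]
    have g0 : ∀ a, (Γ.flip t).src a ≠ (Γ.flip t).tgt a := fun a => src_ne_tgt_flip (h0 a) t
    have gz : (Γ.flip t).Straight ((Γ.flip t).tgt t) := by
      rw [h1]; exact (hr.straight_iff _).2 hz
    have gz' : ¬ (Γ.flip t).PassesIn (Fin.last k) ((Γ.flip t).tgt t) := by
      rw [h1]; exact fun h => hz' ((hr.passesIn_iff _ _).1 h)
    have gb : (Γ.flip t).EdgePair ((Γ.flip t).tgt t) t (t.succAbove b) := by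
      rw [h1]
      exact ⟨hb.1, fun i => (inc_flip Γ t _ i).trans (hb.2 i)⟩
    have gq : (Γ.flip t).endAt q (t.succAbove b) = (Γ.flip t).tgt t := by
      rw [h1, h2]; exact hq
    have k1 := cls_ins_contract_same_of_tgt 𝕂 n s g0 gz gz' gb gq
    have k2 := cls_ins_contract_other_of_tgt 𝕂 n s g0 gz gz' gb gq
    rw [cls_ins_contract_flip 𝕂 n s Γ (h0 t), cls_flip] at k1
    rw [cls_ins_contract_flip 𝕂 n s Γ (h0 t), reverseLast_flip, cls_flip, h1, ← smul_neg] at k2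
    exact ⟨smul_left_cancel _ k1, smul_left_cancel _ k2⟩

end Transfer

end OGC

namespace OGC

/-! ### The commutator of the differential and `extend` on graphs -/

namespace Graph

variable {k v e w : ℕ}

/-- The number of vertices that are not straight. -/
def numSkeleton (Γ : Graph (k + 1) v e) : ℕ := (Finset.univ.filter fun x => ¬ Γ.Straight x).card

theorem numSkeleton_reverseLast (S : Finset (Fin v)) (Γ : Graph (k + 1) v e) :
    (Γ.reverseLast S).numSkeleton = Γ.numSkeleton := by
  simp only [numSkeleton, straight_reverseLast]

theorem numSkeleton_ins_le {Γ : Graph (k + 1) v e} (h0 : ∀ i, Γ.src i ≠ Γ.tgt i) (a : Fin e)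
    (r : Bool) : (Γ.ins a r).numSkeleton ≤ Γ.numSkeleton := by
  refine (Finset.card_le_card fun x hx => ?_).trans_eq (Finset.card_map Fin.castSuccEmb)
  rw [Finset.mem_filter] at hx
  induction x using Fin.lastCases with
  | last => exact absurd (straight_ins_last r h0) hx.2
  | cast x =>
    rw [straight_ins_castSucc r (h0 a)] at hx
    exact Finset.mem_map.2 ⟨x, by simpa using hx.2, rfl⟩

theorem numSkeleton_contract_lt {Γ : Graph (k + 1) (w + 2) (e + 1)} {t : Fin (e + 1)}
    (ht : Γ.src t ≠ Γ.tgt t) (h1 : ¬ Γ.Straight (Γ.src t)) (h2 : ¬ Γ.Straight (Γ.tgt t)) :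
    (Γ.contract t).numSkeleton < Γ.numSkeleton := by
  have h3 : Γ.tgt t ∈ Finset.univ.filter fun x => ¬ Γ.Straight x := by simpa using h2
  refine lt_of_le_of_lt ?_ (Finset.card_erase_lt_of_mem h3)
  refine le_trans (Finset.card_le_card fun x hx => ?_) (Finset.card_image_le (f := Γ.proj t))
  obtain ⟨x, rfl⟩ := proj_surjective Γ t x
  rw [Finset.mem_image]
  by_cases hxt : Γ.Inc x t
  · refine ⟨Γ.src t, by simpa using ⟨ht, h1⟩, ?_⟩
    exact (proj_eq_of_inc ht hxt _).2 (Γ.inc_src t)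
  · refine ⟨x, ?_, rfl⟩
    rw [Finset.mem_filter, straight_contract_of_not_inc ht hxt] at hx
    simp only [Finset.mem_erase, Finset.mem_filter, Finset.mem_univ, true_and]
    exact ⟨fun h => hxt (h ▸ Γ.inc_tgt t), hx.2⟩

/-- At an end of a skeleton edge, reverse the last colour at the straight vertex if this skeleton
edge has length two. -/
def turn (Γ : Graph (k + 1) v e) (t : Fin e) : Graph (k + 1) v e :=
  if Γ.Isolated (Γ.endAt (!Γ.outer t) t) then Γ.reverseLast {Γ.endAt (!Γ.outer t) t} else Γ

end Graph

open _root_.OGC.Graph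

section Transfer

variable (𝕂 : Type*) [Field 𝕂] (n : ℤ) (s : Part) {k v e w : ℕ}

/-- The difference between subdividing after and before the contraction of `t`. -/
def defect (Γ : Graph (k + 1) (w + 2) (e + 1)) (t : Fin (e + 1)) (a : Fin e) :
    GraphComplex 𝕂 n s (k + 1) :=
  (if Admissible s (Γ.contract t) ∧ (Γ.contract t).IsEnd a then
    cls 𝕂 n s ((Γ.contract t).ins a ((Γ.contract t).outer a)) else 0) -
  if Γ.IsEnd (t.succAbove a) then
    cls 𝕂 n s ((Γ.contract t).ins a (Γ.outer (t.succAbove a))) else 0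

/-- Contracting the new edge gives the graph back. Contracting the rest of the subdivided edge gives
zero. All other contractions commute with the subdivision up to the sign `-1` of `contractSign_ins`.
-/
theorem differential_insSum (hs : s = Part.circ → 1 ≤ k) {Γ : Graph (k + 1) (w + 2) (e + 1)}
    (hΓ : Admissible s Γ) : differential 𝕂 n s (k + 1) (insSum 𝕂 n s Γ) =
      (∑ a with Γ.IsEnd a, cls 𝕂 n s Γ) -
      ∑ t, Γ.contractSign n t • ∑ a : Fin e, if Γ.IsEnd (t.succAbove a) then
        cls 𝕂 n s ((Γ.contract t).ins a (Γ.outer (t.succAbove a))) else 0 := by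
  have h0 := hΓ.oriented.no_tadpole
  have h1 : ∀ a, Γ.IsEnd a → differential 𝕂 n s (k + 1) (cls 𝕂 n s (Γ.ins a (Γ.outer a))) =
      cls 𝕂 n s Γ + ∑ t : Fin (e + 1), cterm 𝕂 n s (Γ.ins a (Γ.outer a)) t.castSucc := by
    intro a ha
    rw [differential_cls 𝕂 n s (admissible_ins hΓ ha), Fin.sum_univ_castSucc, contract_ins_last,
      contractSign_ins_last, one_smul]
    exact add_comm _ _
  rw [insSum, map_sum, Finset.sum_congr rfl fun a ha => h1 a (by simpa using ha),
    Finset.sum_add_distrib, sub_eq_add_neg]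
  congr 1
  rw [Finset.sum_filter, ← Finset.sum_neg_distrib]
  have h2 : ∀ a, (if Γ.IsEnd a then
      ∑ t : Fin (e + 1), cterm 𝕂 n s (Γ.ins a (Γ.outer a)) t.castSucc else 0) =
      ∑ t : Fin (e + 1), if Γ.IsEnd a then
        cterm 𝕂 n s (Γ.ins a (Γ.outer a)) t.castSucc else 0 := by
    intro a
    split_ifs <;> simp
  simp only [h2]
  rw [Finset.sum_comm]
  refine Finset.sum_congr rfl fun t _ => ?_
  rw [Fin.sum_univ_succAbove _ t]
  -- After the subdivision, the old part of `t` joins the new vertex to the old straight end, so its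
  -- contraction would be passing at the merged vertex.
  have h3 : (if Γ.IsEnd t then cterm 𝕂 n s (Γ.ins t (Γ.outer t)) t.castSucc else 0) = 0 := by
    split_ifs with ht
    · have h4 := straight_ins_last (a := t) (Γ.outer t) h0
      have h5 := (straight_ins_castSucc (Γ.outer t) (h0 t) _).2 (straight_inner ht)
      refine cterm_of_not 𝕂 n s (not_admissible_contract hs (admissible_ins hΓ ht) ?_ ?_)
      · rw [src_ins_castSucc]
        cases h6 : Γ.outer t <;> simp only [h6] at h4 h5 ⊢ <;> simp <;> assumption
      · rw [tgt_ins_castSucc]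
        cases h6 : Γ.outer t <;> simp only [h6] at h4 h5 ⊢ <;> simp <;> assumption
    · rfl
  rw [h3, zero_add, Finset.smul_sum, ← Finset.sum_neg_distrib]
  refine Finset.sum_congr rfl fun a _ => ?_
  split_ifs
  · rw [cterm, contract_ins Γ (h0 t), contractSign_ins, Units.neg_smul]
  · rw [smul_zero, neg_zero]

/-- The terms with sign `-1` in `differential_insSum` meet those of `extend` after the differential.
What remains is where the ends of skeleton edges before and after the contraction disagree. -/
theorem differential_extend_add (hs : s = Part.circ → 1 ≤ k)
    {Γ : Graph (k + 1) (w + 2) (e + 1)} (hΓ : Admissible s Γ) :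
    differential 𝕂 n s (k + 1) (extend 𝕂 n s k (cls 𝕂 n s Γ)) +
      extend 𝕂 n s k (differential 𝕂 n s (k + 1) (cls 𝕂 n s Γ)) =
      (∑ a with Γ.IsEnd a, cls 𝕂 n s Γ) +
        ∑ t, Γ.contractSign n t • ∑ a, defect 𝕂 n s Γ t a := by
  rw [extend_cls 𝕂 n s hΓ, differential_insSum 𝕂 n s hs hΓ, differential_cls 𝕂 n s hΓ, map_sum,
    sub_add_eq_add_sub, add_sub_assoc, ← Finset.sum_sub_distrib]
  congr 1
  refine Finset.sum_congr rfl fun t _ => ?_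
  simp only [defect]
  rw [map_unit_smul, ← smul_sub, Finset.sum_sub_distrib]
  congr 2
  by_cases h : Admissible s (Γ.contract t)
  · simp only [h, true_and]
    rw [extend_cls 𝕂 n s h, insSum, Finset.sum_filter]
  · simp only [h, false_and, if_false]
    rw [cls_of_not 𝕂 n s h, map_zero, Finset.sum_const_zero]

variable {Γ : Graph (k + 1) (w + 2) (e + 1)} {t : Fin (e + 1)}

theorem defect_of_tadpole {a b : Fin e} (hb : (Γ.contract t).src b = (Γ.contract t).tgt b)
    (hab : a ≠ b) : defect 𝕂 n s Γ t a = 0 := by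
  have h1 : ¬ Admissible s (Γ.contract t) := fun h => h.oriented.no_tadpole b hb
  have h2 : ∀ r, ¬ Admissible s ((Γ.contract t).ins a r) := by
    intro r h
    refine h.oriented.no_tadpole b.castSucc ?_
    rw [src_ins_castSucc, tgt_ins_castSucc, if_neg (fun h => hab h.1.symm),
      if_neg (fun h => hab h.1.symm), hb]
  rw [defect, if_neg (fun h => h1 h.1), cls_of_not 𝕂 n s (h2 _), ite_self, sub_zero]

/-- The edge is subdivided at the same end before and after the contraction, or not at all. If the
contraction is not admissible, neither is its subdivision, by `admissible_of_ins`. -/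
theorem defect_of_straight_iff {a : Fin e} (h0 : ∀ i, (Γ.contract t).src i ≠ (Γ.contract t).tgt i)
    (h : ∀ r, (Γ.contract t).Straight ((Γ.contract t).endAt r a) ↔
      Γ.Straight (Γ.endAt r (t.succAbove a))) : defect 𝕂 n s Γ t a = 0 := by
  obtain ⟨e, rfl⟩ : ∃ e', e = e' + 1 :=
    Nat.exists_eq_succ_of_ne_zero (fun h => by subst h; exact a.elim0)
  have h1 : (Γ.contract t).IsEnd a ↔ Γ.IsEnd (t.succAbove a) :=
    not_congr (iff_congr (h false) (h true))
  have h2 : (Γ.contract t).outer a = Γ.outer (t.succAbove a) := by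
    simp only [outer]
    congr 1
    exact propext (h false)
  rw [defect, ← h1, ← h2]
  by_cases h3 : (Γ.contract t).IsEnd a
  · by_cases h4 : Admissible s (Γ.contract t)
    · rw [if_pos ⟨h4, h3⟩, if_pos h3, sub_self]
    · rw [if_neg (fun h => h4 h.1), if_pos h3, cls_of_not 𝕂 n s (mt (admissible_of_ins h0 h3) h4),
        sub_zero]
  · rw [if_neg (fun h => h3 h.2), if_neg h3, sub_zero]

/-- Contracting `t` would produce a passing vertex, and a subdivision elsewhere does not change
this, as both ends of `t` stay straight. -/
theorem defect_of_straight (hs : s = Part.circ → 1 ≤ k) (hΓ : Admissible s Γ)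
    (h1 : Γ.Straight (Γ.src t)) (h2 : Γ.Straight (Γ.tgt t)) (a : Fin e) :
    defect 𝕂 n s Γ t a = 0 := by
  have h0 := hΓ.oriented.no_tadpole
  rw [defect, if_neg (fun h => not_admissible_contract hs hΓ h1 h2 h.1), zero_sub, neg_eq_zero]
  split_ifs with h
  · refine cls_of_not 𝕂 n s ?_
    rw [← contract_ins Γ (h0 t)]
    have hne : ¬ t = t.succAbove a := (Fin.succAbove_ne t a).symm
    refine not_admissible_contract hs (admissible_ins hΓ h) ?_ ?_
    · rw [src_ins_castSucc, if_neg (fun h => hne h.1), straight_ins_castSucc _ (h0 _)]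
      exact h1
    · rw [tgt_ins_castSucc, if_neg (fun h => hne h.1), straight_ins_castSucc _ (h0 _)]
      exact h2
  · rfl

/-- Away from the contracted edge the straight vertices do not change, if the edge does not end at
straight vertices. -/
theorem straight_contract_iff {a : Fin e} (ht : Γ.src t ≠ Γ.tgt t)
    (hm : ¬ (Γ.contract t).Straight (Γ.proj t (Γ.src t)))
    (ha : ∀ x, Γ.Inc x t → Γ.Inc x (t.succAbove a) → ¬ Γ.Straight x) (r : Bool) :
    (Γ.contract t).Straight ((Γ.contract t).endAt r a) ↔
      Γ.Straight (Γ.endAt r (t.succAbove a)) := by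
  rw [endAt_contract]
  by_cases h : Γ.Inc (Γ.endAt r (t.succAbove a)) t
  · rw [(proj_eq_of_inc ht (Γ.inc_src t) _).2 h]
    exact iff_of_false hm (ha _ h (inc_endAt Γ r _))
  · exact straight_contract_of_not_inc ht h

/-- Let `z` be the straight end of `t` and `b` the other edge at `z`; only `b` contributes. If the
far end `y` of `b` is straight, `b` becomes an end by the contraction and its subdivision restores
`Γ`. If not, `b` was an end before and is none afterwards, and its earlier subdivision at `y` gives
the reversal of `Γ` at `z`. The two signs work out to be `+1` in both cases. -/
theorem sum_defect_of_isEnd (hΓ : Admissible s Γ) (ht : Γ.IsEnd t) :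
    Γ.contractSign n t • ∑ a, defect 𝕂 n s Γ t a = cls 𝕂 n s (Γ.turn t) := by
  have h0 := hΓ.oriented.no_tadpole
  obtain ⟨r, hr⟩ : ∃ r, r = !Γ.outer t := ⟨_, rfl⟩
  have hz : Γ.Straight (Γ.endAt r t) := hr ▸ straight_inner ht
  have hx : ¬ Γ.Straight (Γ.endAt (!r) t) := by
    rw [hr, Bool.not_not]; exact not_straight_outer ht
  obtain ⟨b, hb⟩ := exists_edgePair_of_inc hz.1 (inc_endAt Γ r t)
  obtain ⟨b, rfl⟩ := Fin.exists_succAbove_eq hb.1.symm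
  obtain ⟨q, hq⟩ := inc_iff_endAt.1 hb.right
  have hinct : ∀ p, Γ.Inc p t ↔ p = Γ.endAt r t ∨ p = Γ.endAt (!r) t :=
    fun p => inc_iff_endAt_or r
  have hincb : ∀ p, Γ.Inc p (t.succAbove b) ↔
      p = Γ.endAt r t ∨ p = Γ.endAt (!q) (t.succAbove b) := fun p => by
    rw [inc_iff_endAt_or q, hq]
  have hne : ∀ a, a ≠ b → ¬ Γ.Inc (Γ.endAt r t) (t.succAbove a) := by
    intro i hi
    rw [hb.2]
    rintro (h | h)
    exacts [Fin.succAbove_ne t i h, hi (Fin.succAbove_right_injective h)]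
  have hyz : Γ.endAt (!q) (t.succAbove b) ≠ Γ.endAt r t := by rw [← hq]; exact endAt_ne (h0 _) q
  have hm : Γ.NoParallel t → ¬ (Γ.contract t).Straight (Γ.proj t (Γ.endAt r t)) :=
    fun hp => not_straight_contract h0 hp hz hx
  have hm' : Γ.proj t (Γ.endAt r t) = Γ.proj t (Γ.src t) :=
    (proj_eq_of_inc (h0 t) (Γ.inc_src t) _).2 (inc_endAt Γ r t)
  have hpar : ∀ a, (Γ.contract t).src a = (Γ.contract t).tgt a → a = b := by
    intro a ha
    by_contra hab
    refine hne a hab ?_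
    rw [tadpole_contract_iff h0] at ha
    cases r
    exacts [ha.1, ha.2]
  -- The merged vertex is no more straight than `x` was, so nothing changes at other edges. An edge
  -- parallel to `t` can only be `b`; it becomes a tadpole, which survives the subdivision of `a`.
  have hoff : ∀ a, a ≠ b → defect 𝕂 n s Γ t a = 0 := by
    intro a hab
    by_cases hp : Γ.NoParallel t
    · refine defect_of_straight_iff 𝕂 n s ((noParallel_iff h0).1 hp)
        (straight_contract_iff (h0 t) (hm' ▸ hm hp) fun x hxt hxa => ?_)
      rcases (hinct x).1 hxt with rfl | rfl
      · exact absurd hxa (hne a hab)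
      · exact hx
    · rw [noParallel_iff h0] at hp
      push Not at hp
      obtain ⟨i, hi⟩ := hp
      rw [hpar i hi] at hi
      exact defect_of_tadpole 𝕂 n s hi hab
  rw [Finset.sum_eq_single b (fun a _ h => hoff a h) (by simp)]
  obtain ⟨k1, k2⟩ := cls_ins_contract 𝕂 n s h0 hz (hz.not_passesIn_last hΓ) hb hq
  have hiso : Γ.Isolated (Γ.endAt r t) ↔ ¬ Γ.Straight (Γ.endAt (!q) (t.succAbove b)) := by
    constructor
    · intro h h'
      exact hyz (h.2 _ _ hb.right (inc_endAt Γ _ _) h')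
    · intro h
      refine ⟨hz, fun a y hza hya hy => ?_⟩
      rcases (hb.2 a).1 hza with rfl | rfl
      · rcases (hinct y).1 hya with rfl | rfl
        exacts [rfl, absurd hy hx]
      · rcases (hincb y).1 hya with rfl | rfl
        exacts [rfl, absurd hy h]
  have houter : ∀ (Γ' : Graph (k + 1) (w + 1) e), Γ'.IsEnd b → Γ'.Straight (Γ'.endAt (!q) b) →
      Γ'.outer b = q := by
    intro Γ' h1 h2
    have h3 := not_straight_outer h1
    by_contra h4
    rw [show Γ'.outer b = !q by revert h4; cases Γ'.outer b <;> cases q <;> simp] at h3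
    exact h3 h2
  by_cases hy : Γ.Straight (Γ.endAt (!q) (t.succAbove b))
  · have hadm := admissible_contract hΓ hz hx hb hq hy
    have hp := noParallel_of_admissible h0 hadm
    have hyt : ¬ Γ.Inc (Γ.endAt (!q) (t.succAbove b)) t := by
      rw [hinct]
      rintro (h | h)
      exacts [hyz h, hx (h ▸ hy)]
    have h1 : (Γ.contract t).Straight ((Γ.contract t).endAt (!q) b) := by
      rw [endAt_contract, straight_contract_of_not_inc (h0 t) hyt]; exact hy
    have h2 : ¬ (Γ.contract t).Straight ((Γ.contract t).endAt q b) := by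
      rw [endAt_contract, hq]; exact hm hp
    have h3 : (Γ.contract t).IsEnd b := by
      unfold IsEnd
      cases q
      · exact fun h => h2 (h.2 h1)
      · exact fun h => h2 (h.1 h1)
    have h4 : ¬ Γ.IsEnd (t.succAbove b) := by
      unfold IsEnd
      rw [← hq] at hz
      cases q
      · exact fun h => h (iff_of_true hz hy)
      · exact fun h => h (iff_of_true hy hz)
    -- Length at least 3: only the subdivision after the contraction is present.
    rw [defect, if_pos ⟨hadm, h3⟩, if_neg h4, sub_zero, houter _ h3 h1, k1, turn, ← hr,
      if_neg (fun h => hiso.1 h hy)]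
  · have h4 : Γ.IsEnd (t.succAbove b) := by
      unfold IsEnd
      rw [← hq] at hz
      cases q
      · exact fun h => hy (h.1 hz)
      · exact fun h => hy (h.2 hz)
    have h5 : Γ.outer (t.succAbove b) = !q := by
      have h3 := straight_inner h4
      by_contra h6
      rw [show (!Γ.outer (t.succAbove b)) = !q by
        revert h6; cases Γ.outer (t.succAbove b) <;> cases q <;> simp] at h3
      exact hy h3
    have h6 : ¬ (Admissible s (Γ.contract t) ∧ (Γ.contract t).IsEnd b) := by
      rintro ⟨h6, h7⟩
      have hp := noParallel_of_admissible h0 h6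
      have hyt : ¬ Γ.Inc (Γ.endAt (!q) (t.succAbove b)) t := by
        rw [hinct]
        rintro (h | h)
        · exact hyz h
        · refine h6.oriented.no_tadpole b ((tadpole_contract_iff h0 b).2 ?_)
          have h8 := hb.right
          have h9 : Γ.Inc (Γ.endAt (!r) t) (t.succAbove b) := h ▸ inc_endAt Γ _ _
          cases r
          exacts [⟨h8, h9⟩, ⟨h9, h8⟩]
      have h8 : ¬ (Γ.contract t).Straight ((Γ.contract t).endAt (!q) b) := by
        rw [endAt_contract, straight_contract_of_not_inc (h0 t) hyt]; exact hy
      have h9 : ¬ (Γ.contract t).Straight ((Γ.contract t).endAt q b) := by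
        rw [endAt_contract, hq]; exact hm hp
      refine h7 ?_
      cases q
      exacts [iff_of_false h9 h8, iff_of_false h8 h9]
    -- Length 2: only the subdivision before the contraction is present, also if both skeleton
    -- vertices coincide and `b` becomes a tadpole.
    rw [defect, if_neg h6, if_pos h4, h5, zero_sub, smul_neg, k2, neg_neg, turn, ← hr,
      if_pos (hiso.2 hy)]

variable (k) in
/-- The span of the graphs with less than `p` vertices that are not straight. -/
def lower (p : ℕ) : Submodule 𝕂 (GraphComplex 𝕂 n s (k + 1)) :=
  Submodule.span 𝕂 {x | ∃ (v e : ℕ) (Γ : Graph (k + 1) v e), Admissible s Γ ∧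
    Γ.numSkeleton < p ∧ x = cls 𝕂 n s Γ}

theorem cls_mem_lower {p : ℕ} {Γ : Graph (k + 1) v e} (h : Γ.numSkeleton < p) :
    cls 𝕂 n s Γ ∈ lower 𝕂 n s k p := by
  by_cases hΓ : Admissible s Γ
  · exact Submodule.subset_span ⟨v, e, Γ, hΓ, h, rfl⟩
  · rw [cls_of_not 𝕂 n s hΓ]; exact zero_mem _

/-- An edge parallel to `t` has no straight end, so it is not subdivided. Any other edge leaves the
tadpole in place. -/
theorem defect_of_not_noParallel (hΓ : Admissible s Γ)
    (h1 : ¬ Γ.Straight (Γ.src t)) (h2 : ¬ Γ.Straight (Γ.tgt t)) (hp : ¬ Γ.NoParallel t)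
    (a : Fin e) : defect 𝕂 n s Γ t a = 0 := by
  have h0 := hΓ.oriented.no_tadpole
  rw [noParallel_iff h0] at hp
  push Not at hp
  obtain ⟨b, hb⟩ := hp
  by_cases hab : a = b
  · subst hab
    have h3 : ¬ Admissible s (Γ.contract t) := fun h => h.oriented.no_tadpole a hb
    have h4 := (tadpole_contract_iff h0 a).1 hb
    have h5 : ¬ Γ.IsEnd (t.succAbove a) := by
      have hne := h0 t
      have hne' := h0 (t.succAbove a)
      unfold IsEnd
      unfold Inc at h4
      rcases h4.1 with h | h <;> rcases h4.2 with h' | h'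
      · exact absurd (h.symm.trans h') hne
      · rw [h, h']; tauto
      · rw [h, h']; tauto
      · exact absurd (h.symm.trans h') hne
    rw [defect, if_neg (fun h => h3 h.1), if_neg h5, sub_zero]
  · exact defect_of_tadpole 𝕂 n s hb hab

theorem defect_mem_lower (hΓ : Admissible s Γ)
    (h1 : ¬ Γ.Straight (Γ.src t)) (h2 : ¬ Γ.Straight (Γ.tgt t)) (a : Fin e) :
    defect 𝕂 n s Γ t a ∈ lower 𝕂 n s k Γ.numSkeleton := by
  have h0 := hΓ.oriented.no_tadpole
  by_cases hp : Γ.NoParallel t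
  · have h3 : ∀ r, cls 𝕂 n s ((Γ.contract t).ins a r) ∈ lower 𝕂 n s k Γ.numSkeleton := fun r =>
      cls_mem_lower 𝕂 n s ((numSkeleton_ins_le ((noParallel_iff h0).1 hp) a r).trans_lt
        (numSkeleton_contract_lt (h0 t) h1 h2))
    unfold defect
    refine sub_mem ?_ ?_
    · split_ifs
      exacts [h3 _, zero_mem _]
    · split_ifs
      exacts [h3 _, zero_mem _]
  · rw [defect_of_not_noParallel 𝕂 n s hΓ h1 h2 hp]; exact zero_mem _

/-- With one colour, not straight means at least 3-valent. Merging two such vertices gives a vertex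
of valence at least 4, so no straight vertex is created. -/
theorem defect_of_zero (hk : k = 0) (hΓ : Admissible s Γ)
    (h1 : ¬ Γ.Straight (Γ.src t)) (h2 : ¬ Γ.Straight (Γ.tgt t)) (a : Fin e) :
    defect 𝕂 n s Γ t a = 0 := by
  have h0 := hΓ.oriented.no_tadpole
  by_cases hp : Γ.NoParallel t
  · have h3 : ∀ x, ¬ Γ.Straight x → 3 ≤ Γ.valence x := by
      intro x hx
      have h4 := hΓ.two_le x
      have h5 : Γ.valence x ≠ 2 := fun h => hx ⟨h, fun c => by subst hk; exact c.elim0⟩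
      omega
    refine defect_of_straight_iff 𝕂 n s ((noParallel_iff h0).1 hp)
      (straight_contract_iff (h0 t) (fun h => ?_) fun x hxt _ => ?_)
    · have h4 := valence_contract_of_inc (h0 t) hp (Γ.inc_src t)
      have h5 := h3 _ h1
      have h6 := h3 _ h2
      rw [h.1] at h4
      omega
    · rcases hxt with rfl | rfl
      exacts [h1, h2]
  · exact defect_of_not_noParallel 𝕂 n s hΓ h1 h2 hp a

/-- The commutator of `extend` with the differential, up to graphs with fewer vertices that are not
straight; for one colour there are no such graphs. -/
theorem differential_extend_add_sub_mem (hs : s = Part.circ → 1 ≤ k) {Γ : Graph (k + 1) v e}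
    (hΓ : Admissible s Γ) :
    ∃ y ∈ lower 𝕂 n s k Γ.numSkeleton, (k = 0 → y = 0) ∧
      differential 𝕂 n s (k + 1) (extend 𝕂 n s k (cls 𝕂 n s Γ)) +
        extend 𝕂 n s k (differential 𝕂 n s (k + 1) (cls 𝕂 n s Γ)) =
      ∑ t with Γ.IsEnd t, (cls 𝕂 n s Γ + cls 𝕂 n s (Γ.turn t)) + y := by
  obtain ⟨w, e, rfl, rfl⟩ := hΓ.exists_size
  refine ⟨∑ t with ¬ Γ.IsEnd t, Γ.contractSign n t • ∑ a, defect 𝕂 n s Γ t a, ?_, ?_, ?_⟩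
  · refine sum_mem fun t ht => unit_smul_mem 𝕂 _ (sum_mem fun a _ => ?_)
    rw [Finset.mem_filter, IsEnd, not_not] at ht
    by_cases h1 : Γ.Straight (Γ.src t)
    · rw [defect_of_straight 𝕂 n s hs hΓ h1 (ht.2.1 h1)]; exact zero_mem _
    · exact defect_mem_lower 𝕂 n s hΓ h1 (mt ht.2.2 h1) a
  · refine fun hk => Finset.sum_eq_zero fun t ht => ?_
    rw [Finset.mem_filter, IsEnd, not_not] at ht
    rw [Finset.sum_eq_zero, smul_zero]
    intro a _
    by_cases h1 : Γ.Straight (Γ.src t)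
    · exact defect_of_straight 𝕂 n s hs hΓ h1 (ht.2.1 h1) a
    · exact defect_of_zero 𝕂 n s hk hΓ h1 (mt ht.2.2 h1) a
  · rw [differential_extend_add 𝕂 n s hs hΓ, Finset.sum_add_distrib, add_assoc]
    congr 1
    rw [← Finset.sum_filter_add_sum_filter_not Finset.univ (fun t => Γ.IsEnd t)]
    congr 1
    exact Finset.sum_congr rfl fun t ht => sum_defect_of_isEnd 𝕂 n s hΓ (by simpa using ht)

end Transfer

end OGC

namespace OGC

open _root_.OGC.Graph

/-! ### Vectors annihilated by a polynomial with nonzero constant term -/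

section Killed

open Polynomial

variable {𝕂 M : Type*} [Field 𝕂] [AddCommGroup M] [Module 𝕂 M]

/-- The vectors that are annihilated by a polynomial in `f` with nonzero constant term. -/
def killed (f : Module.End 𝕂 M) : Submodule 𝕂 M where
  carrier := {x | ∃ Q : 𝕂[X], Q.eval 0 ≠ 0 ∧ aeval f Q x = 0}
  zero_mem' := ⟨1, by simp, by simp⟩
  add_mem' := by
    rintro x y ⟨Q, hQ, hx⟩ ⟨R, hR, hy⟩
    refine ⟨Q * R, by simp [hQ, hR], ?_⟩
    rw [map_add]
    nth_rewrite 1 [mul_comm Q R]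
    simp [Module.End.mul_apply, hx, hy]
  smul_mem' := by
    rintro c x ⟨Q, hQ, hx⟩
    exact ⟨Q, hQ, by rw [map_smul, hx, smul_zero]⟩

/-- Multiplying the annihilating polynomial by `X - C c` keeps the constant term nonzero. -/
theorem mem_killed_of_sub_mem {f : Module.End 𝕂 M} {c : 𝕂} (hc : c ≠ 0) {x : M}
    (h : f x - c • x ∈ killed f) : x ∈ killed f := by
  obtain ⟨Q, hQ, hx⟩ := h
  refine ⟨Q * (X - C c), by simp [hQ, hc], ?_⟩
  rw [map_mul, Module.End.mul_apply]
  simpa using hx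

theorem aeval_mem {f : Module.End 𝕂 M} {N : Submodule 𝕂 M} (h : ∀ x ∈ N, f x ∈ N) (Q : 𝕂[X])
    {x : M} (hx : x ∈ N) : aeval f Q x ∈ N := by
  induction Q using Polynomial.induction_on' with
  | add p q hp hq => rw [map_add]; exact add_mem hp hq
  | monomial m a =>
    rw [aeval_monomial, Module.End.mul_apply, Module.algebraMap_end_apply]
    refine Submodule.smul_mem _ a ?_
    induction m with
    | zero => simpa using hx
    | succ m ih => rw [pow_succ', Module.End.mul_apply]; exact h _ ih

/-- Homotopies for endomorphisms that are invertible on each vector make cycles into boundaries. -/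
theorem exists_boundary_of_killed {d g : Module.End 𝕂 M} (hd : ∀ x, d (d x) = 0) {x : M}
    (hx : d x = 0) (h : x ∈ killed (d * g + g * d)) {N : Submodule 𝕂 M}
    (hN : ∀ y ∈ N, (d * g + g * d) y ∈ N) (hxN : x ∈ N) : ∃ u ∈ N, d (g u) = x := by
  obtain ⟨Q, hQ, hx0⟩ := h
  obtain ⟨f, hf⟩ : ∃ f, f = d * g + g * d := ⟨_, rfl⟩
  rw [← hf] at hx0 hN
  have hker : ∀ y ∈ LinearMap.ker d, f y ∈ LinearMap.ker d := by
    intro y hy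
    rw [LinearMap.mem_ker] at hy ⊢
    simp [hf, hd, hy]
  set u := aeval f Q.divX x with hu
  have hdu : d u = 0 := aeval_mem hker _ hx
  -- Writing the polynomial as `X * Q.divX` plus its constant term exhibits `x` as a multiple of `f
  -- u`, where `u` is again a cycle, so that `f u` is just `d (g u)`.
  have h1 : f u + Q.eval 0 • x = 0 := by
    rw [← Polynomial.X_mul_divX_add Q, map_add, map_mul, aeval_X, aeval_C, LinearMap.add_apply,
      Module.End.mul_apply, Module.algebraMap_end_apply,
      Polynomial.coeff_zero_eq_eval_zero] at hx0
    exact hx0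
  have h2 : f u = d (g u) := by simp [hf, hdu]
  refine ⟨-(Q.eval 0)⁻¹ • u, Submodule.smul_mem _ _ (aeval_mem hN _ hxN), ?_⟩
  rw [map_smul, map_smul, ← h2, eq_neg_of_add_eq_zero_left h1, smul_neg, neg_smul, neg_neg,
    smul_smul, inv_mul_cancel₀ hQ, one_smul]

theorem eq_zero_of_killed {f : Module.End 𝕂 M} {x : M} (h : x ∈ killed f) (hx : f x = 0) :
    x = 0 := by
  obtain ⟨Q, hQ, hx0⟩ := h
  rw [← Polynomial.divX_mul_X_add Q, map_add, map_mul, aeval_X, aeval_C, LinearMap.add_apply,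
    Module.End.mul_apply, hx, map_zero, zero_add, Module.algebraMap_end_apply,
    Polynomial.coeff_zero_eq_eval_zero] at hx0
  exact (smul_eq_zero.1 hx0).resolve_left hQ

end Killed

/-! ### Open ends, and the acyclicity of the dagger part -/

namespace Graph

variable {k v e : ℕ} {s : Part} {Γ : Graph (k + 1) v e}

theorem turn_reverseLast (S : Finset (Fin v)) (Γ : Graph (k + 1) v e) (t : Fin e) :
    (Γ.reverseLast S).turn t = (Γ.turn t).reverseLast S := by
  have h1 : (Γ.reverseLast S).endAt (!(Γ.reverseLast S).outer t) t =
      Γ.endAt (!Γ.outer t) t := by rw [outer_reverseLast]; rfl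
  unfold turn
  rw [h1]
  simp only [isolated_reverseLast]
  split_ifs
  · exact reverseLast_comm _ _ _
  · rfl

/-- The ends of the skeleton edges that are not dotted. -/
def openEnds (Γ : Graph (k + 1) v e) (T : Finset (Fin v)) : Finset (Fin e) :=
  Finset.univ.filter fun t => Γ.IsEnd t ∧ Γ.endAt (!Γ.outer t) t ∉ T

theorem isEnd_of_endAt {a : Fin e} {r : Bool} (h1 : Γ.Straight (Γ.endAt r a))
    (h2 : ¬ Γ.Straight (Γ.endAt (!r) a)) : Γ.IsEnd a ∧ Γ.endAt (!Γ.outer a) a = Γ.endAt r a := by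
  cases r
  · exact ⟨fun h => h2 (h.1 h1), by
      rw [show Γ.outer a = true from decide_eq_true h1]; rfl⟩
  · exact ⟨fun h => h2 (h.2 h1), by
      rw [show Γ.outer a = false from decide_eq_false h2]; rfl⟩

/-- A skeleton edge that is crossed or of length at least 3 has ends, as its string of straight
vertices must stop somewhere: not all vertices are straight. -/
theorem openEnds_nonempty (hs : s = Part.circ → 1 ≤ k) (hΓ : Admissible s Γ) {T : Finset (Fin v)}
    (hT : T ⊆ Γ.middles) (h : Γ.HasInner ∨ T ≠ Γ.middles) : (Γ.openEnds T).Nonempty := by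
  have h0 := hΓ.oriented.no_tadpole
  rcases h with ⟨a, ha1, ha2⟩ | h
  · obtain ⟨x, hx⟩ := exists_not_straight hs hΓ
    by_contra hne
    -- Without open ends, the straight vertices that are not isolated would be closed under
    -- adjacency: an edge from such a vertex to one that is not straight is an open end. By
    -- connectedness all vertices would be straight.
    refine hx (Connected.forall_of_closed (Γ := Γ) hΓ.oriented.connected
      (fun y => Γ.Straight y ∧ ¬ Γ.Isolated y) (fun b => ?_) (x := Γ.src a) ⟨ha1, fun h => ?_⟩ x).1
    · have key : ∀ r, Γ.Straight (Γ.endAt r b) ∧ ¬ Γ.Isolated (Γ.endAt r b) →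
          Γ.Straight (Γ.endAt (!r) b) ∧ ¬ Γ.Isolated (Γ.endAt (!r) b) := by
        rintro r ⟨h1, h2⟩
        have h3 : Γ.Straight (Γ.endAt (!r) b) := by
          by_contra h3
          obtain ⟨h4, h5⟩ := isEnd_of_endAt h1 h3
          refine hne ⟨b, Finset.mem_filter.2 ⟨Finset.mem_univ b, h4, fun h6 => h2 ?_⟩⟩
          rw [h5] at h6
          exact (mem_middles hs hΓ _).1 (hT h6)
        exact ⟨h3, fun h4 => endAt_ne (h0 b) r
          (h4.2 b _ (inc_endAt Γ _ b) (inc_endAt Γ r b) h1).symm⟩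
      exact ⟨key false, key true⟩
    · exact h0 a (h.2 a _ (Γ.inc_src a) (Γ.inc_tgt a) ha2).symm
  · obtain ⟨z, hz, hzT⟩ := Finset.exists_of_ssubset (hT.ssubset_of_ne h)
    rw [mem_middles hs hΓ] at hz
    obtain ⟨a, b, hab⟩ := exists_edgePair hz.1.1
    obtain ⟨r, rfl⟩ := inc_iff_endAt.1 hab.left
    have h2 : ¬ Γ.Straight (Γ.endAt (!r) a) := fun h' =>
      endAt_ne (h0 a) r (hz.2 a _ hab.left (inc_endAt Γ _ a) h')
    obtain ⟨h4, h5⟩ := isEnd_of_endAt hz.1 h2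
    exact ⟨a, Finset.mem_filter.2 ⟨Finset.mem_univ a, h4, by rwa [h5]⟩⟩

theorem openEnds_middles (hs : s = Part.circ → 1 ≤ k) (hΓ : Admissible s Γ) (h : ¬ Γ.HasInner) :
    Γ.openEnds Γ.middles = ∅ := by
  refine Finset.filter_eq_empty_iff.2 fun t _ ht => ht.2 ?_
  rw [mem_middles hs hΓ]
  exact (straight_inner ht.1).isolated h

end Graph

section Acyclic

variable (𝕂 : Type*) [Field 𝕂] (n : ℤ) (s : Part) {k v e : ℕ}

variable (k) in
/-- The commutator of the differential and `extend`. -/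
def laplacian : Module.End 𝕂 (GraphComplex 𝕂 n s (k + 1)) :=
  differential 𝕂 n s (k + 1) * extend 𝕂 n s k + extend 𝕂 n s k * differential 𝕂 n s (k + 1)

/-- If `t` ends at a middle vertex, `turn` is the reversal there, of which the decorated graph is an
eigenvector. Otherwise `turn` changes nothing. -/
theorem sum_turn (hs : s = Part.circ → 1 ≤ k) {Γ : Graph (k + 1) v e}
    (hΓ : Admissible s Γ) {T : Finset (Fin v)} (hT : T ⊆ Γ.middles) (t : Fin e) :
    (2⁻¹ : 𝕂) ^ Γ.middles.card • ∑ S ∈ Γ.middles.powerset, (-1 : 𝕂) ^ (S ∩ T).card •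
      cls 𝕂 n s ((Γ.reverseLast S).turn t) =
    (if Γ.endAt (!Γ.outer t) t ∈ T then (-1 : 𝕂) else 1) • decorated 𝕂 n s Γ T := by
  simp only [turn_reverseLast]
  set z := Γ.endAt (!Γ.outer t) t with hz
  by_cases h : Γ.Isolated z
  · have h1 : {z} ⊆ Γ.middles := by
      rw [Finset.singleton_subset_iff, mem_middles hs hΓ]; exact h
    have h2 := decorated_reverseLast 𝕂 n s hs hΓ h1 T
    rw [decorated, middles_reverseLast s hs hΓ h1] at h2
    rw [turn, if_pos h, h2]
    congr 1
    split_ifs with h3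
    · rw [Finset.inter_eq_left.2 (Finset.singleton_subset_iff.2 h3)]; simp
    · rw [Finset.singleton_inter_of_notMem h3]; simp
  · have h3 : z ∉ T := fun h3 => h ((mem_middles hs hΓ z).1 (hT h3))
    rw [turn, if_neg h, if_neg h3, one_smul]
    rfl

/-- Each end contributes the decorated graph plus its `turn`: twice the graph if the end is open,
and zero if it belongs to a dotted edge. -/
theorem laplacian_decorated (hs : s = Part.circ → 1 ≤ k) {Γ : Graph (k + 1) v e}
    (hΓ : Admissible s Γ) {T : Finset (Fin v)} (hT : T ⊆ Γ.middles) :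
    ∃ y ∈ lower 𝕂 n s k Γ.numSkeleton, (k = 0 → y = 0) ∧
      laplacian 𝕂 n s k (decorated 𝕂 n s Γ T) =
        (2 * (Γ.openEnds T).card : 𝕂) • decorated 𝕂 n s Γ T + y := by
  have h1 : ∀ S : Finset (Fin v), ∃ y, y ∈ lower 𝕂 n s k Γ.numSkeleton ∧ (k = 0 → y = 0) ∧
      (S ⊆ Γ.middles → laplacian 𝕂 n s k (cls 𝕂 n s (Γ.reverseLast S)) =
        ∑ t with Γ.IsEnd t, (cls 𝕂 n s (Γ.reverseLast S) +
          cls 𝕂 n s ((Γ.reverseLast S).turn t)) + y) := by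
    intro S
    by_cases hS : S ⊆ Γ.middles
    · obtain ⟨y, h2, h3, h4⟩ := differential_extend_add_sub_mem 𝕂 n s hs
        (admissible_reverseLast hΓ fun z hz => (mem_middles hs hΓ z).1 (hS hz))
      rw [numSkeleton_reverseLast] at h2
      simp only [isEnd_reverseLast] at h4
      exact ⟨y, h2, h3, fun _ => h4⟩
    · exact ⟨0, zero_mem _, fun _ => rfl, fun h => absurd h hS⟩
  choose y h2 h3 h4 using h1
  refine ⟨(2⁻¹ : 𝕂) ^ Γ.middles.card • ∑ S ∈ Γ.middles.powerset, (-1 : 𝕂) ^ (S ∩ T).card • y S,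
    Submodule.smul_mem _ _ (sum_mem fun S _ => Submodule.smul_mem _ _ (h2 S)), fun hk => ?_, ?_⟩
  · simp only [h3 _ hk, smul_zero, Finset.sum_const_zero]
  have h5 : ∀ S ∈ Γ.middles.powerset,
      laplacian 𝕂 n s k ((-1 : 𝕂) ^ (S ∩ T).card • cls 𝕂 n s (Γ.reverseLast S)) =
      ∑ t with Γ.IsEnd t, ((-1 : 𝕂) ^ (S ∩ T).card • cls 𝕂 n s (Γ.reverseLast S) +
        (-1 : 𝕂) ^ (S ∩ T).card • cls 𝕂 n s ((Γ.reverseLast S).turn t)) +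
        (-1 : 𝕂) ^ (S ∩ T).card • y S := by
    intro S hS
    rw [map_smul, h4 S (Finset.mem_powerset.1 hS), smul_add, Finset.smul_sum]
    simp only [smul_add]
  conv_lhs => rw [decorated, map_smul, map_sum, Finset.sum_congr rfl h5, Finset.sum_add_distrib,
    Finset.sum_comm, smul_add, Finset.smul_sum]
  congr 1
  simp only [Finset.sum_add_distrib, smul_add, sum_turn 𝕂 n s hs hΓ hT]
  have h6 : (2⁻¹ : 𝕂) ^ Γ.middles.card •
      ∑ S ∈ Γ.middles.powerset, (-1 : 𝕂) ^ (S ∩ T).card • cls 𝕂 n s (Γ.reverseLast S) =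
      decorated 𝕂 n s Γ T := rfl
  rw [h6, ← Finset.sum_add_distrib, openEnds, ← Finset.filter_filter, Finset.card_filter,
    Nat.cast_sum, Finset.mul_sum, Finset.sum_smul]
  refine Finset.sum_congr rfl fun t _ => ?_
  by_cases h7 : Γ.endAt (!Γ.outer t) t ∈ T
  · simp [h7]
  · simp [h7, two_smul]

theorem laplacian_mem_dagger [CharZero 𝕂] (hs : s = Part.circ → 1 ≤ k)
    {x : GraphComplex 𝕂 n s (k + 1)} (hx : x ∈ dagger 𝕂 n s k) :
    laplacian 𝕂 n s k x ∈ dagger 𝕂 n s k := by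
  rw [dagger_eq_cross 𝕂 n s hs] at hx ⊢
  exact add_mem (differential_mem_cross 𝕂 n s (extend_mem_cross 𝕂 n s hs hx))
    (extend_mem_cross 𝕂 n s hs (differential_mem_cross 𝕂 n s hx))

/-- By induction on the number of skeleton vertices: `laplacian` minus the positive scalar `2 *
(Γ.openEnds T).card` sends the generator to an error term in `dagger` with fewer skeleton vertices.
-/
theorem decorated_mem_killed [CharZero 𝕂] (hs : s = Part.circ → 1 ≤ k) (p : ℕ) :
    ∀ {v e : ℕ} {Γ : Graph (k + 1) v e}, Γ.numSkeleton = p → Admissible s Γ →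
      ∀ {T : Finset (Fin v)}, T ⊆ Γ.middles → (Γ.HasInner ∨ T ≠ Γ.middles) →
      decorated 𝕂 n s Γ T ∈ killed (laplacian 𝕂 n s k) := by
  induction p using Nat.strong_induction_on with
  | _ p ih =>
    intro v e Γ hp hΓ T hT h
    obtain ⟨y, hy, -, h1⟩ := laplacian_decorated 𝕂 n s hs hΓ hT
    have hd := decorated_mem_dagger 𝕂 n s hs hΓ hT h
    -- The graphs in the error term need not lie in `dagger` one by one. Their dagger components are
    -- covered by the induction, and the error term as a whole equals its dagger component.
    have hlow : ∀ x ∈ lower 𝕂 n s k p,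
        x - specialProj 𝕂 n s k hs x ∈ killed (laplacian 𝕂 n s k) := by
      intro x hx
      induction hx using Submodule.span_induction with
      | zero => rw [map_zero, sub_zero]; exact zero_mem _
      | add x y _ _ hx hy => rw [map_add, add_sub_add_comm]; exact add_mem hx hy
      | smul c x _ hx => rw [map_smul, ← smul_sub]; exact Submodule.smul_mem _ c hx
      | mem x hx =>
        obtain ⟨v', e', Γ', hΓ', hp', rfl⟩ := hx
        rw [cls_sub_specialProj 𝕂 n s hs hΓ']
        refine sum_mem fun T' hT' => ?_
        rw [Finset.mem_filter, Finset.mem_powerset] at hT'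
        exact ih _ hp' rfl hΓ' hT'.1 hT'.2
    have hyd : y ∈ dagger 𝕂 n s k := by
      rw [← sub_eq_iff_eq_add'] at h1
      rw [← h1]
      exact sub_mem (laplacian_mem_dagger 𝕂 n s hs hd) (Submodule.smul_mem _ _ hd)
    refine mem_killed_of_sub_mem (c := 2 * ((Γ.openEnds T).card : 𝕂)) ?_ ?_
    · have := (openEnds_nonempty hs hΓ hT h).card_pos
      exact mul_ne_zero two_ne_zero (Nat.cast_ne_zero.2 this.ne')
    · rw [h1, add_sub_cancel_left]
      have := hlow y (hp ▸ hy)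
      rwa [specialProj_of_mem_dagger 𝕂 n s hs hyd, sub_zero] at this

theorem dagger_le_killed [CharZero 𝕂] (hs : s = Part.circ → 1 ≤ k) :
    dagger 𝕂 n s k ≤ killed (laplacian 𝕂 n s k) := by
  rw [dagger, Submodule.span_le]
  rintro x ⟨v, e, Γ, T, hΓ, hT, h, rfl⟩
  rw [exists_three_le_iff hs hΓ] at h
  exact decorated_mem_killed 𝕂 n s hs _ rfl hΓ hT h

theorem differential_differential (x : GraphComplex 𝕂 n s k) :
    differential 𝕂 n s k (differential 𝕂 n s k x) = 0 :=
  LinearMap.congr_fun (differential_comp_differential 𝕂 n s) x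

theorem differential_mem_homogeneous {i : ℤ} {x : GraphComplex 𝕂 n s k}
    (hx : x ∈ homogeneous 𝕂 n s k i) : differential 𝕂 n s k x ∈ homogeneous 𝕂 n s k (i - 1) :=
  (isDifferential 𝕂 n s).2 i x hx

/-- Cycles in the dagger part are boundaries in the dagger part. -/
theorem exists_boundary [CharZero 𝕂] (hs : s = Part.circ → 1 ≤ k) {i : ℤ}
    {x : GraphComplex 𝕂 n s (k + 1)} (hx : x ∈ dagger 𝕂 n s k)
    (hi : x ∈ homogeneous 𝕂 n s (k + 1) i) (hd : differential 𝕂 n s (k + 1) x = 0) :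
    ∃ y ∈ dagger 𝕂 n s k, y ∈ homogeneous 𝕂 n s (k + 1) (i + 1) ∧
      differential 𝕂 n s (k + 1) y = x := by
  have hN : ∀ y ∈ dagger 𝕂 n s k ⊓ homogeneous 𝕂 n s (k + 1) i,
      laplacian 𝕂 n s k y ∈ dagger 𝕂 n s k ⊓ homogeneous 𝕂 n s (k + 1) i := by
    rintro y ⟨h1, h2⟩
    refine ⟨laplacian_mem_dagger 𝕂 n s hs h1, add_mem ?_ ?_⟩
    · have := differential_mem_homogeneous 𝕂 n s (extend_mem_homogeneous 𝕂 n s h2)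
      rwa [add_sub_cancel_right] at this
    · have := extend_mem_homogeneous 𝕂 n s (differential_mem_homogeneous 𝕂 n s h2)
      rwa [sub_add_cancel] at this
  obtain ⟨u, hu, h⟩ := exists_boundary_of_killed (differential_differential 𝕂 n s) hd
    (dagger_le_killed 𝕂 n s hs hx) hN ⟨hx, hi⟩
  refine ⟨_, ?_, extend_mem_homogeneous 𝕂 n s hu.2, h⟩
  have := hu.1
  rw [dagger_eq_cross 𝕂 n s hs] at this ⊢
  exact extend_mem_cross 𝕂 n s hs this

theorem laplacian_of_mem_special (hs : s = Part.circ → 1 ≤ k) (hk : k = 0)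
    {x : GraphComplex 𝕂 n s (k + 1)} (hx : x ∈ special 𝕂 n s k) :
    laplacian 𝕂 n s k x = 0 := by
  induction hx using Submodule.span_induction with
  | zero => rw [map_zero]
  | add x y _ _ hx hy => rw [map_add, hx, hy, add_zero]
  | smul c x _ hx => rw [map_smul, hx, smul_zero]
  | mem x hx =>
    obtain ⟨v, e, Γ, hΓ, h, rfl⟩ := hx
    have h' : ¬ Γ.HasInner := by
      rw [← exists_three_le_iff hs hΓ]
      rintro ⟨a, ha⟩
      have := h a
      omega
    obtain ⟨y, -, hy, h1⟩ := laplacian_decorated 𝕂 n s hs hΓ (Finset.Subset.refl Γ.middles)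
    rw [h1, hy hk, openEnds_middles hs hΓ h']
    simp

/-- For one colour `laplacian` is zero on `special` and injective on `dagger`, so `special` is its
kernel, and it commutes with the differential. -/
theorem differential_mem_special [CharZero 𝕂] (hs : s = Part.circ → 1 ≤ k) (hk : k = 0)
    {x : GraphComplex 𝕂 n s (k + 1)} (hx : x ∈ special 𝕂 n s k) :
    differential 𝕂 n s (k + 1) x ∈ special 𝕂 n s k := by
  set y := differential 𝕂 n s (k + 1) x with hy
  have h1 : laplacian 𝕂 n s k y = differential 𝕂 n s (k + 1) (laplacian 𝕂 n s k x) := by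
    simp [laplacian, hy, differential_differential]
  rw [laplacian_of_mem_special 𝕂 n s hs hk hx, map_zero] at h1
  have h2 := sub_specialProj_mem 𝕂 n s hs y
  -- The dagger component of `y` is annihilated by `laplacian` and by a polynomial in it with
  -- nonzero constant term, so it is zero.
  have h3 : y - specialProj 𝕂 n s k hs y = 0 := by
    refine eq_zero_of_killed (dagger_le_killed 𝕂 n s hs h2) ?_
    rw [map_sub, h1, laplacian_of_mem_special 𝕂 n s hs hk (specialProj_mem 𝕂 n s hs y), sub_zero]
  rw [sub_eq_zero.1 h3]
  exact specialProj_mem 𝕂 n s hs y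

theorem specialProj_mem_homogeneous (hs : s = Part.circ → 1 ≤ k) {i : ℤ}
    {x : GraphComplex 𝕂 n s (k + 1)} (hx : x ∈ homogeneous 𝕂 n s (k + 1) i) :
    specialProj 𝕂 n s k hs x ∈ homogeneous 𝕂 n s (k + 1) i := by
  rw [homogeneous_eq_span] at hx
  induction hx using Submodule.span_induction with
  | zero => rw [map_zero]; exact zero_mem _
  | add x y _ _ hx hy => rw [map_add]; exact add_mem hx hy
  | smul c x _ hx => rw [map_smul]; exact Submodule.smul_mem _ c hx
  | mem x hx =>
    obtain ⟨v, e, Γ, hΓ, hi, rfl⟩ := hx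
    rw [specialProj_cls 𝕂 n s hs hΓ]
    split_ifs
    · exact zero_mem _
    · exact Submodule.smul_mem _ _ (sum_mem fun S _ =>
        Submodule.smul_mem _ _ (cls_mem_homogeneous 𝕂 n s _ _ hi))

end Acyclic

end OGC

namespace OGC

/-! ### Complexes with an acyclic direct summand -/

section Homology

variable {𝕂 M M' : Type*} [Field 𝕂] [AddCommGroup M] [Module 𝕂 M] [AddCommGroup M'] [Module 𝕂 M']
  {A : ℤ → Submodule 𝕂 M} {d : M →ₗ[𝕂] M} {A' : ℤ → Submodule 𝕂 M'} {d' : M' →ₗ[𝕂] M'}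

theorem subsingleton_homology {i : ℤ}
    (h : ∀ x ∈ A i, d x = 0 → ∃ y ∈ A (i + 1), d y = x) : Subsingleton (Homology A d i) := by
  rw [Submodule.Quotient.subsingleton_iff, eq_top_iff]
  rintro ⟨x, hx, hd⟩ -
  obtain ⟨y, hy, rfl⟩ := h x hx hd
  exact ⟨y, hy, rfl⟩

/-- On the level of chains, `h3` is injectivity and `h4` surjectivity on homology. -/
theorem isQuasiIso_of_forall {f : M →ₗ[𝕂] M'} (h1 : ∀ i, ∀ x ∈ A i, f x ∈ A' i)
    (h2 : ∀ x, f (d x) = d' (f x))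
    (h3 : ∀ i, ∀ x ∈ A i, d x = 0 → ∀ y ∈ A' (i + 1), d' y = f x → ∃ u ∈ A (i + 1), d u = x)
    (h4 : ∀ i, ∀ x ∈ A' i, d' x = 0 →
      ∃ u ∈ A i, d u = 0 ∧ ∃ y ∈ A' (i + 1), d' y = x - f u) :
    IsQuasiIso A d A' d' f := by
  refine ⟨h1, LinearMap.ext h2, fun i => ?_⟩
  have hf : ∀ x ∈ A i ⊓ LinearMap.ker d, f x ∈ A' i ⊓ LinearMap.ker d' := by
    rintro x ⟨hx, hd⟩
    rw [SetLike.mem_coe, LinearMap.mem_ker] at hd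
    refine ⟨h1 i x hx, ?_⟩
    rw [SetLike.mem_coe, LinearMap.mem_ker, ← h2, hd, map_zero]
  let ψ : ↥(A i ⊓ LinearMap.ker d) →ₗ[𝕂] Homology A' d' i :=
    (((A' (i + 1)).map d').submoduleOf (A' i ⊓ LinearMap.ker d')).mkQ ∘ₗ f.restrict hf
  have hψ : ((A (i + 1)).map d).submoduleOf (A i ⊓ LinearMap.ker d) = LinearMap.ker ψ := by
    ext ⟨x, hx, hd⟩
    rw [LinearMap.mem_ker, LinearMap.comp_apply, Submodule.mkQ_apply,
      Submodule.Quotient.mk_eq_zero]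
    constructor
    · rintro ⟨u, hu, hux⟩
      exact ⟨f u, h1 _ u hu, by rw [← h2, hux]; rfl⟩
    · rintro ⟨y, hy, hyx⟩
      obtain ⟨u, hu, rfl⟩ := h3 i x hx hd y hy hyx
      exact ⟨u, hu, rfl⟩
  have hsurj : Function.Surjective ψ := by
    intro c
    obtain ⟨⟨x, hx, hd⟩, rfl⟩ := Submodule.Quotient.mk_surjective _ c
    obtain ⟨u, hu, hdu, y, hy, hyx⟩ := h4 i x hx hd
    have h5 : d' y = x - f u := hyx
    refine ⟨⟨u, hu, hdu⟩, ((Submodule.Quotient.eq _).2 ?_).symm⟩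
    exact Submodule.mem_map.2 ⟨y, hy, h5⟩
  refine ⟨(Submodule.quotEquivOfEq _ _ hψ).trans (ψ.quotKerEquivOfSurjective hsurj),
    fun x y hxy => ?_⟩
  have : f.restrict hf x = y := Subtype.ext hxy
  rw [← this]
  rfl

section Summand

variable {S D : Submodule 𝕂 M} (h : IsCompl S D)

theorem sub_projectionOnto_mem (x : M) : x - S.projectionOnto D h x ∈ D := by
  rw [← Submodule.projectionOnto_apply_eq_zero_iff h, map_sub,
    Submodule.projectionOnto_apply_left, sub_self]

theorem projectionOnto_differential (hD : ∀ x ∈ D, d x ∈ D) (x : M) :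
    S.projectionOnto D h (d x) = inducedOn d S D h (S.projectionOnto D h x) := by
  change _ = S.projectionOnto D h (d (S.projectionOnto D h x))
  rw [← sub_eq_zero, ← map_sub, ← map_sub, Submodule.projectionOnto_apply_eq_zero_iff]
  exact hD _ (sub_projectionOnto_mem h x)

theorem isDifferential_inducedOn (hd : IsDifferential A d) (hD : ∀ x ∈ D, d x ∈ D)
    (hπ : ∀ i, ∀ x ∈ A i, (S.projectionOnto D h x : M) ∈ A i) :
    IsDifferential (gradingOn A S) (inducedOn d S D h) := by
  refine ⟨LinearMap.ext fun x => ?_, fun i x hx => hπ _ _ (hd.2 i _ hx)⟩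
  have h1 := projectionOnto_differential h hD (d x)
  rw [show d (d x) = 0 from LinearMap.congr_fun hd.1 _, map_zero] at h1
  exact h1.symm

/-- The projection is the quotient map by the acyclic subcomplex `D`, so cycles and boundaries can
be corrected by elements of `D`. -/
theorem isQuasiIso_projectionOnto (hd : IsDifferential A d) (hD : ∀ x ∈ D, d x ∈ D)
    (hπ : ∀ i, ∀ x ∈ A i, (S.projectionOnto D h x : M) ∈ A i)
    (hac : ∀ i, ∀ x ∈ D, x ∈ A i → d x = 0 → ∃ y ∈ D, y ∈ A (i + 1) ∧ d y = x) :
    IsQuasiIso A d (gradingOn A S) (inducedOn d S D h) (S.projectionOnto D h) := by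
  have hdd : ∀ x, d (d x) = 0 := LinearMap.congr_fun hd.1
  refine isQuasiIso_of_forall hπ (projectionOnto_differential h hD)
    (fun i x hx hdx y hy hyx => ?_) (fun i x hx hdx => ?_)
  · have h1 : x - d y ∈ D := by
      rw [← Submodule.projectionOnto_apply_eq_zero_iff h, map_sub, sub_eq_zero]
      exact hyx.symm
    have h2 : d y ∈ A i := by
      have := hd.2 _ _ hy
      rwa [add_sub_cancel_right] at this
    obtain ⟨u, -, hu, hux⟩ := hac i _ h1 (sub_mem hx h2) (by rw [map_sub, hdx, hdd, sub_zero])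
    exact ⟨u + y, add_mem hu hy, by rw [map_add, hux, sub_add_cancel]⟩
  -- A cycle `x` of the induced differential need not be a cycle of `d`. But `d x` is a cycle in
  -- `D`, hence equals `d u` with `u ∈ D`, and `x - u` is a cycle that projects to `x`.
  · have h1 : d x ∈ D := (Submodule.projectionOnto_apply_eq_zero_iff h).1 hdx
    obtain ⟨u, huD, hu, hux⟩ := hac (i - 1) _ h1 (hd.2 _ _ hx) (hdd _)
    rw [sub_add_cancel] at hu
    refine ⟨x - u, sub_mem hx hu, by rw [map_sub, hux, sub_self], 0, zero_mem _, ?_⟩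
    rw [map_zero, map_sub, Submodule.projectionOnto_apply_left,
      (Submodule.projectionOnto_apply_eq_zero_iff h).2 huD, sub_zero, sub_self]

/-- If `S` is stable, the projection is a retraction of complexes, which gives injectivity. A cycle
differs from its projection by a cycle in `D`, hence by a boundary. -/
theorem isQuasiIso_subtype (hD : ∀ x ∈ D, d x ∈ D)
    (hS : ∀ x ∈ S, d x ∈ S) (hπ : ∀ i, ∀ x ∈ A i, (S.projectionOnto D h x : M) ∈ A i)
    (hac : ∀ i, ∀ x ∈ D, x ∈ A i → d x = 0 → ∃ y ∈ D, y ∈ A (i + 1) ∧ d y = x) :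
    IsQuasiIso (gradingOn A S) (d.restrict hS) A d S.subtype := by
  have hcomm : ∀ x, S.projectionOnto D h (d x) = d.restrict hS (S.projectionOnto D h x) := by
    intro x
    rw [projectionOnto_differential h hD]
    exact Submodule.projectionOnto_apply_left h (d.restrict hS (S.projectionOnto D h x))
  refine isQuasiIso_of_forall (fun i x hx => hx) (fun x => rfl)
    (fun i x _ _ y hy hyx => ?_) (fun i x hx hdx => ?_)
  · refine ⟨S.projectionOnto D h y, hπ _ _ hy, ?_⟩
    rw [← hcomm, hyx]
    exact Submodule.projectionOnto_apply_left h x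
  · have h1 : d.restrict hS (S.projectionOnto D h x) = 0 := by rw [← hcomm, hdx, map_zero]
    have h2 : d (S.projectionOnto D h x : M) = 0 := congrArg Subtype.val h1
    obtain ⟨u, -, hu, hux⟩ := hac i _ (sub_projectionOnto_mem h x) (sub_mem hx (hπ i x hx))
      (by rw [map_sub, hdx, h2, sub_zero])
    exact ⟨S.projectionOnto D h x, hπ i x hx, h1, u, hu, hux⟩

end Summand

end Homology

end OGC

end

/-! ### The proposition -/

theorem proposition4p1 (𝕂 : Type*) [Field 𝕂] [CharZero 𝕂] (n : ℤ) (k : ℕ) (s : OGC.Part)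
    (hs : s = OGC.Part.circ → 1 ≤ k) :
    OGC.IsDifferential (OGC.homogeneous 𝕂 n s (k + 1)) (OGC.differential 𝕂 n s (k + 1)) ∧
    ∃ (hSD : IsCompl (OGC.special 𝕂 n s k) (OGC.dagger 𝕂 n s k))
      (hD : ∀ x ∈ OGC.dagger 𝕂 n s k,
        OGC.differential 𝕂 n s (k + 1) x ∈ OGC.dagger 𝕂 n s k),
      (∀ i : ℤ, Subsingleton (OGC.Homology
        (OGC.gradingOn (OGC.homogeneous 𝕂 n s (k + 1)) (OGC.dagger 𝕂 n s k))
        ((OGC.differential 𝕂 n s (k + 1)).restrict hD) i)) ∧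
      OGC.IsDifferential
        (OGC.gradingOn (OGC.homogeneous 𝕂 n s (k + 1)) (OGC.special 𝕂 n s k))
        (OGC.inducedOn (OGC.differential 𝕂 n s (k + 1)) _ _ hSD) ∧
      OGC.IsQuasiIso
        (OGC.homogeneous 𝕂 n s (k + 1)) (OGC.differential 𝕂 n s (k + 1))
        (OGC.gradingOn (OGC.homogeneous 𝕂 n s (k + 1)) (OGC.special 𝕂 n s k))
        (OGC.inducedOn (OGC.differential 𝕂 n s (k + 1)) _ _ hSD)
        ((OGC.special 𝕂 n s k).projectionOnto (OGC.dagger 𝕂 n s k) hSD) ∧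
      (k = 0 → ∀ x ∈ OGC.special 𝕂 n s k,
        OGC.differential 𝕂 n s (k + 1) x ∈ OGC.special 𝕂 n s k) ∧
      (∀ hS : ∀ x ∈ OGC.special 𝕂 n s k,
          OGC.differential 𝕂 n s (k + 1) x ∈ OGC.special 𝕂 n s k,
        OGC.IsQuasiIso
          (OGC.gradingOn (OGC.homogeneous 𝕂 n s (k + 1)) (OGC.special 𝕂 n s k))
          ((OGC.differential 𝕂 n s (k + 1)).restrict hS)
          (OGC.homogeneous 𝕂 n s (k + 1)) (OGC.differential 𝕂 n s (k + 1))
          (OGC.special 𝕂 n s k).subtype) := by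
  have hd := OGC.isDifferential 𝕂 n s (K := k + 1)
  have hSD := OGC.isCompl_special_dagger 𝕂 n s hs
  have hD : ∀ x ∈ OGC.dagger 𝕂 n s k,
      OGC.differential 𝕂 n s (k + 1) x ∈ OGC.dagger 𝕂 n s k := by
    intro x hx
    rw [OGC.dagger_eq_cross 𝕂 n s hs] at hx ⊢
    exact OGC.differential_mem_cross 𝕂 n s hx
  have hac : ∀ i, ∀ x ∈ OGC.dagger 𝕂 n s k, x ∈ OGC.homogeneous 𝕂 n s (k + 1) i →
      OGC.differential 𝕂 n s (k + 1) x = 0 → ∃ y ∈ OGC.dagger 𝕂 n s k,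
        y ∈ OGC.homogeneous 𝕂 n s (k + 1) (i + 1) ∧ OGC.differential 𝕂 n s (k + 1) y = x :=
    fun i x hx hi hdx => OGC.exists_boundary 𝕂 n s hs hx hi hdx
  have hπ : ∀ i, ∀ x ∈ OGC.homogeneous 𝕂 n s (k + 1) i,
      ((OGC.special 𝕂 n s k).projectionOnto (OGC.dagger 𝕂 n s k) hSD x :
        OGC.GraphComplex 𝕂 n s (k + 1)) ∈ OGC.homogeneous 𝕂 n s (k + 1) i := by
    intro i x hx
    rw [OGC.projectionOnto_eq_specialProj 𝕂 n s hs]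
    exact OGC.specialProj_mem_homogeneous 𝕂 n s hs hx
  refine ⟨hd, hSD, hD, fun i => OGC.subsingleton_homology fun x hx hdx => ?_,
    OGC.isDifferential_inducedOn hSD hd hD hπ, OGC.isQuasiIso_projectionOnto hSD hd hD hπ hac,
    fun hk x hx => OGC.differential_mem_special 𝕂 n s hs hk hx,
    fun hS => OGC.isQuasiIso_subtype hSD hD hS hπ hac⟩
  obtain ⟨y, hy, hi, hyx⟩ := hac i x x.2 hx (congrArg Subtype.val hdx)
  exact ⟨⟨y, hy⟩, hi, Subtype.ext hyx⟩
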